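/- **Setting.** Let $\Omega\subset\mathbb R$ be open and $u:\Omega\to\mathbb R$ smooth. Let $N=2n\ge 2$ be even, $h=\Delta x>0$, and let $x$ be a cell interface of a uniform mesh of size $h$. The stencil consists of the $N$ cells $I_l=[x+(l-n)h,\,x+(l+1-n)h]$, $0\le l<N$, with cell averages $\bar u_l=\frac1h\int_{I_l}u$, centres $c_l=x+(l-n+\tfrac12)h$ and interfaces $y_i=x+(i-n)h$, $0\le i\le N$ (so $y_n=x$). Let $\phi(y)=\Phi(y^2)$ be a smooth radial basis function on $\mathbb R$, meaning: $\Phi$ is $C^\infty$ near $0$ and the matrices $(\phi^{(i+j)}(0))_{0\le i,j\le m}$ are nonsingular for all $m\ge0$. The shape parameter $\lambda\ne0$ is real or purely imaginary; put $\mu=\lambda^2\in\mathbb R\setminus\{0\}$ and $\phi_\lambda(y)=\Phi(\mu y^2)$ (for the Gaussian, $\Phi(r)=e^{-r}$ and $\phi_\lambda(y)=e^{-\lambda^2y^2}$). Two reconstructions of $u(x)$ from the cell averages are considered. * *Direct:* $Au(y)=\sum_{k=0}^{N-1}\alpha_k\phi_\lambda(y-c_k)$ with $\frac1h\int_{I_l}Au=\bar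 u_l$ for $0\le l<N$; the reconstructed value is $Au(x)$. * *Primitive function:* with $U(y)=\int_{x-h}^{y}u$, whose values at the interfaces are signed sums of the numbers $h\bar u_l$, put $AU(y)=\sum_{k=0}^{N}\alpha_k\phi_\lambda(y-y_k)$ with $AU(y_i)=U(y_i)$ for $0\le i\le N$; the reconstructed value is $AU'(x)=\sum_k\alpha_k\phi_\lambda'(x-y_k)$. **Theorem.** 1. The Gaussian is a smooth radial basis function in this sense. So is every $\phi(y)=\Phi(y^2)$ with $\phi$ smooth on $\mathbb R$, $\Phi$ smooth near $0$, and $\phi$ positive definite (i.e. $\sum_{i,j}\alpha_i\alpha_j\phi(x_i-x_j)>0$ for all finite families of distinct points $x_i$ and all $\alpha\ne0$). 2. For the Gaussian, for all even $N\ge 2$, $h>0$, $\mu\ne0$ and arbitrary data $(\bar u_l)$, the coefficients $\alpha_k$ exist and are unique, for both reconstructions. 3. For each smooth radial basis function, each of the two reconstructions and each even $N=2n\ge2$ there are constants $\gamma_0,\dots,\gamma_n$, depending on nothing else, with $\gamma_n\ne0$, such that with $$E_N(x,\mu)=\sum_{k=0}^{n}\gamma_k\,u^{(2k)}(x)\,\mu^{\,n-k}$$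 the following holds for every open $\Omega$, every smooth $u$ on $\Omega$, every compact $K\subset\Omega$ and every $M$. There are $C$ and $h_0>0$ such that for all $x\in K$, $0<h<h_0$ and $\mu\neq0$ with $|\mu|\le M$ the stencil lies in $\Omega$, the coefficients $\alpha_k$ exist and are unique, and the reconstructed value equals $u(x)+h^NE_N(x,\mu)+R$ with $|R|\le Ch^{N+2}$. Moreover, for all $0\le p\le2$ and $c$ there are $C$ and $h_0>0$ such that whenever $x\in K$, $0<h<h_0$, $\mu=\lambda^2\ne0$ and $|\lambda^2-\mu_0|\le c\,h^p$ for some real root $\mu_0$ of $E_N(x,\cdot)$ with $|\mu_0|\le M$, the stencil lies in $\Omega$, the coefficients exist and are unique, and the reconstructed value differs from $u(x)$ by at most $C\,h^{N+p}$, i.e. the reconstruction is of order $N+p$. 4. Let $\phi$ be the Gaussian, $K\subset\Omega$ compact with $u\ne0$ on $K$, $0\le p\le2$ and $c$ given. There are $C$ and $h_0>0$ such that, for $x\in K$, $0<h<h_0$ and $\lambda^2\ne0$, the coefficients exist and are unique and the reconstructed value differs from $u(x)$ by at most $Ch^{N+p}$ in each of these cases (all derivatives are taken at $x$): * $N=2$,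 primitive function, $\left|\lambda^2+\dfrac{u''}{6u}\right|\le c\,h^p$; * $N=2$, direct, $\left|\lambda^2+\dfrac{u''}{2u}\right|\le c\,h^p$; * $N=4$, primitive function, $\frac19(u'')^2-\frac1{15}u\,u^{(4)}\ge0$ and $$\left|\lambda^2-\frac{-\frac13u''\pm\sqrt{\frac19(u'')^2-\frac1{15}u\,u^{(4)}}}{2u}\right|\le c\,h^p,$$ for either choice of the sign. In particular, for $p=2$ the order is $4$ for $N=2$ and $6$ for $N=4$. -/

import Mathlib

open scoped ContDiff

/-- The radial function `x ↦ φ(λ x)` on `ℝ` with profile `Φ`, that is `φ(y) = Φ(y²)`, written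
through `μ = λ²`. Real `λ ≠ 0` gives `μ > 0`, imaginary `λ ≠ 0` gives `μ < 0`. -/
def radial (Φ : ℝ → ℝ) (μ : ℝ) (x : ℝ) : ℝ := Φ (μ * x ^ 2)

/-- The profile of the Gaussian: `radial gaussianProfile (λ²) x = exp (-λ² x²)`. -/
noncomputable def gaussianProfile (r : ℝ) : ℝ := Real.exp (-r)

/-- Smooth radial basis function `φ(x) = Φ(x²)` on the line: `Φ` is smooth near `0`, and for every
`m` no nontrivial linear combination of `φ, φ', …, φ⁽ᵐ⁾` vanishes at `0` together with its first `m`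
derivatives. -/
structure IsSmoothRBF (Φ : ℝ → ℝ) : Prop where
  smooth : ContDiffAt ℝ ∞ Φ 0
  nondegenerate : ∀ m : ℕ,
    (Matrix.of fun i j : Fin (m + 1) =>
      iteratedDeriv ((i : ℕ) + (j : ℕ)) (radial Φ 1) 0).det ≠ 0

/-- (Strict) positive definiteness of a function on the line (order zero, no side conditions). -/
def IsPositiveDefinite (φ : ℝ → ℝ) : Prop :=
  Continuous φ ∧ ∀ (N : ℕ) (x : Fin N → ℝ), Function.Injective x →
    ∀ α : Fin N → ℝ, α ≠ 0 → 0 < ∑ i, ∑ j, α i * α j * φ (x i - x j)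

/-- Cell interfaces of the uniform stencil of `2 * n` cells of size `h` that is symmetric about the
interface `x`: for `i = 0, …, 2 * n` these are `x - n h, …, x + n h`, and `x` has index `n`. -/
noncomputable def interface (x h : ℝ) (n i : ℕ) : ℝ := x + ((i : ℝ) - (n : ℝ)) * h

/-- The centre of the `k`-th cell, `k = 0, …, 2 * n - 1`. -/
noncomputable def cellCenter (x h : ℝ) (n k : ℕ) : ℝ := x + ((k : ℝ) - (n : ℝ) + 1 / 2) * h

/-- The average of `f` over the `l`-th cell `[interface l, interface (l + 1)]`. -/
noncomputable def cellAvg (f : ℝ → ℝ) (x h : ℝ) (n l : ℕ) : ℝ :=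
  (1 / h) * ∫ y in (interface x h n l)..(interface x h n (l + 1)), f y

/-- The values at the `i`-th interface of the primitive based at the interface `x - h`, computed
from cell averages: `h` times the (signed) sum of the averages between `x - h` and interface `i`. -/
noncomputable def primitiveData (h : ℝ) (n : ℕ) (ubar : Fin (2 * n) → ℝ) (i : ℕ) : ℝ :=
  h * ((∑ l : Fin (2 * n), if (l : ℕ) < i then ubar l else 0)
    - ∑ l : Fin (2 * n), if (l : ℕ) + 1 < n then ubar l else 0)

/-- The approximant `y ↦ ∑ₖ αₖ φ(λ (y - cₖ))`. -/
noncomputable def rbfSum (Φ : ℝ → ℝ) (μ : ℝ) {N : ℕ} (c α : Fin N → ℝ) (y : ℝ) : ℝ :=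
  ∑ k, α k * radial Φ μ (y - c k)

/-- The approximant `y ↦ ∑ₖ αₖ (d/dy) φ(λ (y - cₖ))`. -/
noncomputable def rbfDerivSum (Φ : ℝ → ℝ) (μ : ℝ) {N : ℕ} (c α : Fin N → ℝ) (y : ℝ) : ℝ :=
  ∑ k, α k * deriv (radial Φ μ) (y - c k)

/-- The two reconstructions from cell averages. -/
inductive Reconstruction where
  | direct
  | primitive

/-- Number of reference points: the `2 * n` cell centres for the direct reconstruction, the
`2 * n + 1` interfaces for the reconstruction by a primitive function. -/
def Reconstruction.size : Reconstruction → ℕ → ℕ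
  | .direct, n => 2 * n
  | .primitive, n => 2 * n + 1

/-- The conditions that define the coefficients from the cell averages `ubar`.
Direct: the approximant has the given averages on the `2 * n` cells.
Primitive: the approximant takes the values of the primitive at the `2 * n + 1` interfaces. -/
def Reconstruction.IsSolution (A : Reconstruction) (Φ : ℝ → ℝ) (μ x h : ℝ) (n : ℕ)
    (ubar : Fin (2 * n) → ℝ) (α : Fin (A.size n) → ℝ) : Prop :=
  match A, α with
  | .direct, α => ∀ i : Fin (2 * n),
      cellAvg (rbfSum Φ μ (fun k : Fin (2 * n) => cellCenter x h n k) α) x h n i = ubar i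
  | .primitive, α => ∀ i : Fin (2 * n + 1),
      rbfSum Φ μ (fun k : Fin (2 * n + 1) => interface x h n k) α (interface x h n i)
        = primitiveData h n ubar i

/-- The reconstructed value at the central interface `x`: the approximant itself for the direct
reconstruction, the derivative of the approximant for the primitive-function reconstruction. -/
noncomputable def Reconstruction.value (A : Reconstruction) (Φ : ℝ → ℝ) (μ x h : ℝ) (n : ℕ)
    (α : Fin (A.size n) → ℝ) : ℝ :=
  match A, α with
  | .direct, α => rbfSum Φ μ (fun k : Fin (2 * n) => cellCenter x h n k) α x
  | .primitive, α => rbfDerivSum Φ μ (fun k : Fin (2 * n + 1) => interface x h n k) α x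

/-- The coefficients are determined by the cell averages of `u`, and the reconstructed value at `x`
is within `ε` of `v`. -/
def Reconstruction.IsAccurate (A : Reconstruction) (Φ : ℝ → ℝ) (μ x h : ℝ) (n : ℕ)
    (u : ℝ → ℝ) (v ε : ℝ) : Prop :=
  (∃! α, A.IsSolution Φ μ x h n (fun l => cellAvg u x h n l) α) ∧
  ∀ α, A.IsSolution Φ μ x h n (fun l => cellAvg u x h n l) α → |A.value Φ μ x h n α - v| ≤ ε

/-- The polynomial `∑_{k ≤ n} γₖ u⁽²ᵏ⁾(x) μⁿ⁻ᵏ` in `μ = λ²`. -/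
noncomputable def errorCoeff (γ : ℕ → ℝ) (n : ℕ) (u : ℝ → ℝ) (x μ : ℝ) : ℝ :=
  ∑ k ∈ Finset.range (n + 1), γ k * iteratedDeriv (2 * k) u x * μ ^ (n - k)

open Asymptotics Filter Topology

/-! Substituting `y = x + h t` turns both reconstructions into problems on a fixed unit grid with
the single parameter `ε = μ h²`: a collocation matrix `A ε`, a row `r ε` that reads off the value
(`v = 0`) or the derivative (`v = 1`) at `0`, and weights `w = r A⁻¹` that are applied to the data.
The error is governed by the moments of `w` as `ε → 0`, a singular limit, since all translates of
the kernel become constant.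

The limit is resolved by the expansion `Φ (ε (t + s)²) = ∑ b q ε ^ q (t + s) ^ (2 q)`. In bases of
functionals dual to the monomials, the entry `(i, j)` of the matrix is `b ((i + j) / 2) * choose (i
+ j) i * ε ^ ((i + j) / 2)` to leading order if `i + j` is even, and negligible otherwise. These
powers of `ε` can be scaled out of rows and columns. What remains tends to a matrix that is
diagonally equivalent to the Hankel matrix of the derivatives `φ⁽ⁱ⁺ʲ⁾(0)`, nonsingular by
assumption. So `A ε` is invertible for small `ε ≠ 0`, and solving the scaled system
(`exists_moment_expansion`) gives the moment of degree `2 k + v` as `[k = 0] + (2 k + v)! γ k ε ^ (n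
- k)` with error `O(ε ^ (n - k + 1))`; moments of the other parity vanish by reflection.

Inserted into the Taylor expansion of the data, `h ^ (2 k) ε ^ (n - k) = h ^ (2 n) μ ^ (n - k)`
produces the error coefficient (`MomentExpansion.exists_error_bound`). Here `γ n` is the error
constant of polynomial reconstruction; it is nonzero because a polynomial of degree at most `2 n +
1` that vanishes at all interfaces, doubly at the central one, is zero. The error coefficient is
Lipschitz in `μ`, so a parameter within `O(h ^ p)` of a root gains the order `p`
(`order_of_near_root`). The `γ k` also satisfy `∑ γ k φ⁽²⁽ᵏ⁺ˡ⁺ᵛ⁾⁾(0) = 0` for `l < n`. For the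
Gaussian in the explicit cases these relations fix `γ` up to a factor, hence also the stated roots.

For every `ε ≠ 0` Gaussian systems are uniquely solvable, since factoring `exp (-ε (t - k)²)` leaves
a Vandermonde system (`gaussian_sum_eq_zero`). If the Hankel matrix of a smooth even positive
definite function were singular, Cauchy–Schwarz in the associated inner product would give a linear
differential equation for the function; its translates would span a finite-dimensional space,
contradicting strict positivity (`IsPositiveDefinite.hankel_det_ne_zero`). -/

/-! ### Taylor expansions and their uniqueness. -/

theorem ContDiffOn.continuousOn_iteratedDeriv_of_isOpen {Ω : Set ℝ} {u : ℝ → ℝ} {D : ℕ}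
    (hΩ : IsOpen Ω) (hu : ContDiffOn ℝ D u Ω) {i : ℕ} (hi : i ≤ D) :
    ContinuousOn (iteratedDeriv i u) Ω :=
  (hu.continuousOn_iteratedDerivWithin (by exact_mod_cast hi) hΩ.uniqueDiffOn).congr
    fun _ hx => ((iteratedDerivWithin_of_isOpen hΩ) hx).symm

theorem exists_abs_iteratedDeriv_le {Ω K : Set ℝ} {u : ℝ → ℝ} {D : ℕ} (hΩ : IsOpen Ω)
    (hu : ContDiffOn ℝ D u Ω) (hK : IsCompact K) (hKΩ : K ⊆ Ω) :
    ∃ B : ℝ, 0 ≤ B ∧ ∀ i ≤ D, ∀ x ∈ K, |iteratedDeriv i u x| ≤ B := by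
  have h : ∀ i : Fin (D + 1), ∃ B : ℝ, ∀ x ∈ K, |iteratedDeriv i u x| ≤ B := fun i =>
    hK.exists_bound_of_continuousOn
      ((hu.continuousOn_iteratedDeriv_of_isOpen hΩ (Nat.le_of_lt_succ i.2)).mono hKΩ)
  choose B hB using h
  refine ⟨∑ i, |B i|, by positivity, fun i hi x hx => ?_⟩
  refine (hB ⟨i, Nat.lt_succ_of_le hi⟩ x hx).trans ((le_abs_self _).trans ?_)
  exact Finset.single_le_sum (f := fun i => |B i|) (fun _ _ => abs_nonneg _) (Finset.mem_univ _)

/-- Taylor's formula with a remainder that is uniform on compact sets. -/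
theorem exists_uniform_taylor_bound {Ω K : Set ℝ} {u : ℝ → ℝ} (D : ℕ) (hΩ : IsOpen Ω)
    (hu : ContDiffOn ℝ (D + 1 : ℕ) u Ω) (hK : IsCompact K) (hKΩ : K ⊆ Ω) :
    ∃ C δ : ℝ, 0 ≤ C ∧ 0 < δ ∧ ∀ x ∈ K, Set.Icc (x - δ) (x + δ) ⊆ Ω ∧
      ∀ y ∈ Set.Icc (x - δ) (x + δ),
        |u y - ∑ i ∈ Finset.range (D + 1), iteratedDeriv i u x / i.factorial * (y - x) ^ i|
          ≤ C * |y - x| ^ (D + 1) := by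
  obtain ⟨δ, hδ, hδΩ⟩ := hK.exists_cthickening_subset_open hΩ hKΩ
  obtain ⟨B, hB0, hB⟩ := exists_abs_iteratedDeriv_le hΩ hu (hK.cthickening (r := δ)) hδΩ
  have hsub : ∀ x ∈ K, Set.Icc (x - δ) (x + δ) ⊆ Metric.cthickening δ K := fun x hx y hy => by
    refine Metric.closedBall_subset_cthickening hx δ ?_
    rwa [Real.closedBall_eq_Icc]
  refine ⟨B, δ, hB0, hδ, fun x hx => ⟨(hsub x hx).trans hδΩ, fun y hy => ?_⟩⟩
  -- The Lagrange form of the remainder needs two distinct points.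
  rcases eq_or_ne x y with rfl | hxy
  · rw [Finset.sum_range_succ']
    simp
  have hxI : x ∈ Set.Icc (x - δ) (x + δ) := ⟨by linarith, by linarith⟩
  have huI : Set.uIcc x y ⊆ Set.Icc (x - δ) (x + δ) := Set.uIcc_subset_Icc hxI hy
  have huΩ : Set.uIcc x y ⊆ Ω := huI.trans ((hsub x hx).trans hδΩ)
  obtain ⟨z, hz, h⟩ := taylor_mean_remainder_lagrange_iteratedDeriv (n := D) hxy
    (by exact_mod_cast hu.mono huΩ)
  have hzI : z ∈ Metric.cthickening δ K :=
    hsub x hx (huI (Set.Ioo_subset_Icc_self hz))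
  have hsum : taylorWithinEval u D (Set.uIcc x y) x y =
      ∑ i ∈ Finset.range (D + 1), iteratedDeriv i u x / i.factorial * (y - x) ^ i := by
    rw [taylor_within_apply]
    refine Finset.sum_congr rfl fun i hi => ?_
    rw [iteratedDerivWithin_eq_iteratedDeriv (uniqueDiffOn_uIcc hxy) _ Set.left_mem_uIcc]
    · simp only [smul_eq_mul]; ring
    · refine (hu.contDiffAt (hΩ.mem_nhds (hKΩ hx))).of_le ?_
      have := Finset.mem_range.1 hi
      exact_mod_cast this.le
  rw [← hsum, h, abs_div, abs_mul, abs_pow]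
  have h1 : (1 : ℝ) ≤ |((D + 1).factorial : ℝ)| := by
    rw [Nat.abs_cast]; exact_mod_cast Nat.one_le_iff_ne_zero.2 (Nat.factorial_ne_zero _)
  refine (div_le_self (by positivity) h1).trans ?_
  gcongr
  exact hB _ le_rfl _ hzI

/-- Taylor's formula at `0` with a `O`-remainder. -/
theorem ContDiffAt.taylor_isBigO {f : ℝ → ℝ} (hf : ContDiffAt ℝ ∞ f 0) (D : ℕ) :
    (fun r => f r - ∑ i ∈ Finset.range D, iteratedDeriv i f 0 / i.factorial * r ^ i)
      =O[𝓝 0] fun r => r ^ D := by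
  have hf' : ContDiffAt ℝ (D + 1 : ℕ) f 0 := hf.of_le (by exact_mod_cast le_top)
  obtain ⟨U, hU, hfU⟩ := hf'.contDiffOn le_rfl (by simp)
  obtain ⟨Ω, hΩU, hΩ, h0⟩ := mem_nhds_iff.1 hU
  rcases D with _ | D
  · simpa using hf.continuousAt.norm.isBoundedUnder_le.isBigO_one ℝ
  obtain ⟨C, δ, -, hδ, h⟩ := exists_uniform_taylor_bound D hΩ
    ((hfU.mono hΩU).of_le (by exact_mod_cast Nat.le_succ _)) isCompact_singleton
    (Set.singleton_subset_iff.2 h0)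
  refine IsBigO.of_bound C ?_
  filter_upwards [Icc_mem_nhds (show 0 - δ < 0 by linarith) (show 0 < 0 + δ by linarith)] with r hr
  simpa using (h 0 rfl).2 r hr

/-- A polynomial that is `O(x ^ D)` has no terms of degree less than `D`. -/
theorem coeff_eq_zero_of_isBigO {D : ℕ} {a : ℕ → ℝ}
    (h : (fun x : ℝ => ∑ i ∈ Finset.range D, a i * x ^ i) =O[𝓝 0] fun x => x ^ D) :
    ∀ i < D, a i = 0 := by
  induction D generalizing a with
  | zero => intro i hi; omega
  | succ D ih =>
    have h0 : a 0 = 0 := by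
      have h1 := h.trans_tendsto (by
        have : Tendsto (fun x : ℝ => x ^ (D + 1)) (𝓝 0) (𝓝 (0 ^ (D + 1))) :=
          (continuous_pow _).tendsto 0
        simpa using this)
      have h2 : Tendsto (fun x : ℝ => ∑ i ∈ Finset.range (D + 1), a i * x ^ i) (𝓝 0)
          (𝓝 (∑ i ∈ Finset.range (D + 1), a i * 0 ^ i)) :=
        Continuous.tendsto (f := fun x : ℝ => ∑ i ∈ Finset.range (D + 1), a i * x ^ i)
          (by fun_prop) 0
      have h3 := tendsto_nhds_unique h2 h1
      rw [Finset.sum_range_succ'] at h3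
      simpa using h3
    have hz : ∀ i < D, a (i + 1) = 0 := by
      refine ih (a := fun i => a (i + 1)) ?_
      obtain ⟨C, hC⟩ := h.bound
      have hne : (fun x : ℝ => ∑ i ∈ Finset.range D, a (i + 1) * x ^ i) =O[𝓝[≠] 0]
          fun x => x ^ D := by
        refine IsBigO.of_bound C ?_
        filter_upwards [nhdsWithin_le_nhds hC, self_mem_nhdsWithin] with x hx hx0
        rw [Finset.sum_range_succ', h0] at hx
        have hx0' : 0 < |x| := abs_pos.2 hx0
        have : ∑ i ∈ Finset.range D, a (i + 1) * x ^ (i + 1) =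
            (∑ i ∈ Finset.range D, a (i + 1) * x ^ i) * x := by
          rw [Finset.sum_mul]; exact Finset.sum_congr rfl fun i _ => by ring
        rw [this, zero_mul, add_zero, norm_mul, pow_succ, norm_mul, ← mul_assoc] at hx
        exact le_of_mul_le_mul_right hx hx0'
      -- Division by `x` has given the estimate only off `0`. At `0` itself it amounts to `a 1 = 0`
      -- when the reduced degree is positive, which follows by passing to the limit.
      rcases D with _ | D
      · simpa using isBoundedUnder_const
      · have hcont : Tendsto (fun x : ℝ => ∑ i ∈ Finset.range (D + 1), a (i + 1) * x ^ i) (𝓝[≠] 0)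
            (𝓝 (a 1)) := by
          have : Tendsto (fun x : ℝ => ∑ i ∈ Finset.range (D + 1), a (i + 1) * x ^ i) (𝓝 0)
              (𝓝 (∑ i ∈ Finset.range (D + 1), a (i + 1) * 0 ^ i)) :=
            Continuous.tendsto (f := fun x : ℝ => ∑ i ∈ Finset.range (D + 1), a (i + 1) * x ^ i)
              (by fun_prop) 0
          rw [Finset.sum_range_succ'] at this
          simpa using this.mono_left nhdsWithin_le_nhds
        have hcont0 := tendsto_nhds_unique hcont (hne.trans_tendsto (by
          have : Tendsto (fun x : ℝ => x ^ (D + 1)) (𝓝 0) (𝓝 (0 ^ (D + 1))) :=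
            (continuous_pow _).tendsto 0
          simpa using this.mono_left nhdsWithin_le_nhds))
        have hsplit : 𝓝 (0 : ℝ) = pure 0 ⊔ 𝓝[≠] 0 := by rw [sup_comm, nhdsNE_sup_pure]
        rw [hsplit]
        refine IsBigO.sup ?_ hne
        refine IsBigO.of_bound 1 ?_
        rw [eventually_pure, Finset.sum_range_succ']
        simp [hcont0]
    intro i hi
    rcases i with _ | i
    · exact h0
    · exact hz i (by omega)

theorem iteratedDeriv_eq_of_isBigO {f : ℝ → ℝ} (hf : ContDiffAt ℝ ∞ f 0) {D : ℕ} {a : ℕ → ℝ}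
    (h : (fun x => f x - ∑ i ∈ Finset.range D, a i * x ^ i) =O[𝓝 0] fun x => x ^ D) {i : ℕ}
    (hi : i < D) : iteratedDeriv i f 0 = i.factorial * a i := by
  have h1 := (h.sub (hf.taylor_isBigO D))
  have h2 := coeff_eq_zero_of_isBigO (a := fun i => iteratedDeriv i f 0 / i.factorial - a i)
    (D := D) (h1.congr_left fun x => by simp only [sub_mul, Finset.sum_sub_distrib]; ring) i hi
  have : (i.factorial : ℝ) ≠ 0 := by exact_mod_cast Nat.factorial_ne_zero i
  field_simp at h2
  linarith

theorem radial_one_taylor_isBigO {Φ : ℝ → ℝ} (hΦ : ContDiffAt ℝ ∞ Φ 0) (Q : ℕ) :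
    (fun x => radial Φ 1 x -
      ∑ i ∈ Finset.range (2 * Q),
        (if Even i then iteratedDeriv (i / 2) Φ 0 / (i / 2).factorial else 0) * x ^ i)
      =O[𝓝 0] fun x => x ^ (2 * Q) := by
  have ht : Tendsto (fun x : ℝ => x ^ 2) (𝓝 0) (𝓝 0) := by
    simpa using (continuous_pow 2 : Continuous fun x : ℝ => x ^ 2).tendsto 0
  refine ((hΦ.taylor_isBigO Q).comp_tendsto ht).congr (fun x => ?_) fun x => ?_
  · have : ∀ Q : ℕ, ∑ i ∈ Finset.range (2 * Q),
        (if Even i then iteratedDeriv (i / 2) Φ 0 / (i / 2).factorial else 0) * x ^ i =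
        ∑ i ∈ Finset.range Q, iteratedDeriv i Φ 0 / i.factorial * (x ^ 2) ^ i := by
      intro Q
      induction Q with
      | zero => simp
      | succ Q ih =>
        rw [show 2 * (Q + 1) = 2 * Q + 1 + 1 by ring, Finset.sum_range_succ, Finset.sum_range_succ,
          Finset.sum_range_succ, ih]
        simp [pow_mul]
    simp only [Function.comp, radial, one_mul, this]
  · simp [pow_mul]

/-- Derivatives at `0` of `x ↦ Φ (x ^ 2)` in terms of those of `Φ`. -/
theorem iteratedDeriv_radial_one {Φ : ℝ → ℝ} (hΦ : ContDiffAt ℝ ∞ Φ 0) (i : ℕ) :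
    iteratedDeriv i (radial Φ 1) 0 = if Even i then
      i.factorial * (iteratedDeriv (i / 2) Φ 0 / (i / 2).factorial) else 0 := by
  have hr : ContDiffAt ℝ ∞ (radial Φ 1) 0 := by
    refine ContDiffAt.comp (g := Φ) (f := fun x : ℝ => 1 * x ^ 2) 0 (by simpa using hΦ) ?_
    fun_prop
  rw [iteratedDeriv_eq_of_isBigO hr (radial_one_taylor_isBigO hΦ (i + 1)) (by omega)]
  split_ifs <;> simp

open Matrix

/-! ### Expansion of the kernel in the scale parameter. -/

theorem isBigO_pow_pow_nhds_zero {m n : ℕ} (h : n ≤ m) :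
    (fun x : ℝ => x ^ m) =O[𝓝 0] fun x => x ^ n := by
  refine IsBigO.of_bound 1 ?_
  filter_upwards [Icc_mem_nhds (show (-1 : ℝ) < 0 by norm_num) (show (0 : ℝ) < 1 by norm_num)]
    with x hx
  rw [one_mul, norm_pow, norm_pow]
  exact pow_le_pow_of_le_one (norm_nonneg _) (abs_le.2 hx) h

/-- The truncated expansion in `ε` of `(p ⊗ s) Φ (ε (t + s) ^ 2)`, where the functionals `p` and `s`
are given by their values on the monomials and `b` are the Taylor coefficients of `Φ`. -/
noncomputable def kernelExpansion (b : ℕ → ℝ) (Q : ℕ) (p s : ℕ → ℝ) (ε : ℝ) : ℝ :=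
  ∑ q ∈ Finset.range Q, b q * ε ^ q *
    ∑ x ∈ Finset.HasAntidiagonal.antidiagonal (2 * q), ((2 * q).choose x.1 : ℝ) * p x.1 * s x.2

theorem kernelExpansion_sum_left {ι : Type*} [Fintype ι] (b : ℕ → ℝ) (Q : ℕ) (c : ι → ℝ)
    (p : ι → ℕ → ℝ) (s : ℕ → ℝ) (ε : ℝ) :
    kernelExpansion b Q (fun i => ∑ l, c l * p l i) s ε =
      ∑ l, c l * kernelExpansion b Q (p l) s ε := by
  simp only [kernelExpansion, Finset.mul_sum, Finset.sum_mul]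
  rw [Finset.sum_comm]
  refine Finset.sum_congr rfl fun q _ => ?_
  rw [Finset.sum_comm]
  exact Finset.sum_congr rfl fun x _ => Finset.sum_congr rfl fun l _ => by ring

theorem kernelExpansion_sum_right {ι : Type*} [Fintype ι] (b : ℕ → ℝ) (Q : ℕ) (c : ι → ℝ)
    (p : ℕ → ℝ) (s : ι → ℕ → ℝ) (ε : ℝ) :
    kernelExpansion b Q p (fun i => ∑ l, c l * s l i) ε =
      ∑ l, c l * kernelExpansion b Q p (s l) ε := by
  simp only [kernelExpansion, Finset.mul_sum]
  rw [Finset.sum_comm]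
  refine Finset.sum_congr rfl fun q _ => ?_
  rw [Finset.sum_comm]
  exact Finset.sum_congr rfl fun x _ => Finset.sum_congr rfl fun l _ => by ring

theorem kernelExpansion_sub_left (b : ℕ → ℝ) (Q : ℕ) (p p' s : ℕ → ℝ) (ε : ℝ) :
    kernelExpansion b Q (fun i => p i - p' i) s ε =
      kernelExpansion b Q p s ε - kernelExpansion b Q p' s ε := by
  simp only [kernelExpansion, ← Finset.sum_sub_distrib, ← mul_sub]
  refine Finset.sum_congr rfl fun q _ => ?_
  congr 1
  exact Finset.sum_congr rfl fun x _ => by ring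

/-- The coefficient of the leading power of `ε` in `kernelExpansion`, for functionals of leading
degrees `a` and `c` that respect parity. -/
noncomputable def leadingCoeff (b : ℕ → ℝ) (a c : ℕ) : ℝ :=
  if Even (a + c) then b ((a + c) / 2) * (a + c).choose a else 0

/-- A term of degrees `(x₁, x₂)` survives only if `x₁ ≥ a`, `x₂ ≥ c` with the parities of `a` and
`c`, while `x₁ + x₂ = 2 q`. Thus everything vanishes if `a + c` is odd, and otherwise the lowest
power comes from `(a, c)` alone. The exponent `⌈a/2⌉ + ⌊c/2⌋` equals `(a + c) / 2` in the even case;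
being a function of `a` plus a function of `c`, it can be scaled out of rows and columns. -/
theorem kernelExpansion_leading (b : ℕ → ℝ) {Q a c : ℕ} {p s : ℕ → ℝ}
    (hQ : (a + 1) / 2 + c / 2 < Q) (hp : ∀ i, i < a ∨ ¬ Even (a + i) → p i = 0) (hs : ∀ i, i < c ∨ ¬ Even (c + i) → s i = 0) :
    (fun ε => kernelExpansion b Q p s ε -
      leadingCoeff b a c * p a * s c * ε ^ ((a + 1) / 2 + c / 2)) =O[𝓝 0] fun ε => ε ^ ((a + 1) / 2 + c / 2 + 1) := by
  set e := (a + 1) / 2 + c / 2 with he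
  set S : ℕ → ℝ := fun q =>
    ∑ x ∈ Finset.HasAntidiagonal.antidiagonal (2 * q), ((2 * q).choose x.1 : ℝ) * p x.1 * s x.2 with hS
  have hS0 : ∀ q, q < e ∨ ¬ Even (a + c) → S q = 0 := by
    intro q hq
    refine Finset.sum_eq_zero fun x hx => ?_
    rw [Finset.HasAntidiagonal.mem_antidiagonal] at hx
    by_contra hne
    have h1 : ¬ (x.1 < a ∨ ¬ Even (a + x.1)) := fun h => hne (by simp [hp _ h])
    have h2 : ¬ (x.2 < c ∨ ¬ Even (c + x.2)) := fun h => hne (by simp [hs _ h])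
    push Not at h1 h2
    simp only [Nat.even_iff] at *
    omega
  have hSe : b e * S e = leadingCoeff b a c * p a * s c := by
    by_cases hac : Even (a + c)
    · have hq : 2 * e = a + c := by rw [Nat.even_iff] at hac; omega
      rw [leadingCoeff, if_pos hac, hS]
      simp only [hq]
      rw [Finset.sum_eq_single (a, c)]
      · rw [← hq, Nat.mul_div_cancel_left _ two_pos]; ring
      · intro x hx hne
        rw [Finset.HasAntidiagonal.mem_antidiagonal] at hx
        by_contra h0
        have h1 : ¬ (x.1 < a ∨ ¬ Even (a + x.1)) := fun h => h0 (by simp [hp _ h])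
        have h2 : ¬ (x.2 < c ∨ ¬ Even (c + x.2)) := fun h => h0 (by simp [hs _ h])
        exact hne (Prod.ext (by simp only; omega) (by simp only; omega))
      · intro h; simp at h
    · rw [hS0 e (Or.inr hac), leadingCoeff, if_neg hac]; ring
  have hsum : ∀ ε, kernelExpansion b Q p s ε -
      leadingCoeff b a c * p a * s c * ε ^ e =
      ∑ q ∈ Finset.range Q, if e < q then b q * S q * ε ^ q else 0 := by
    intro ε
    have h2 : leadingCoeff b a c * p a * s c * ε ^ e =
        ∑ q ∈ Finset.range Q, if q = e then b q * S q * ε ^ q else 0 := by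
      rw [Finset.sum_ite_eq' (Finset.range Q) e]
      simp only [Finset.mem_range, hSe, if_pos hQ]
    rw [h2, kernelExpansion, ← Finset.sum_sub_distrib]
    refine Finset.sum_congr rfl fun q _ => ?_
    change b q * ε ^ q * S q - _ = _
    rcases lt_trichotomy q e with h | h | h
    · rw [hS0 q (Or.inl h), if_neg h.ne, if_neg (by omega)]; ring
    · subst h; simp; ring
    · rw [if_neg h.ne', if_pos h]; ring
  simp only [hsum]
  refine IsBigO.fun_sum fun q _ => ?_
  split_ifs with h
  · exact (isBigO_pow_pow_nhds_zero h).const_mul_left _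
  · exact isBigO_zero _ _

/-! ### Unisolvent symmetric functionals and their dual basis. -/

/-- Values on monomials of `m` functionals that are unisolvent for polynomials of degree `< m` and
are permuted by the reflection. -/
structure SymmetricMoments {m : ℕ} (ℓ : Fin m → ℕ → ℝ) : Prop where
  det_ne_zero : (Matrix.of fun l i : Fin m => ℓ l i).det ≠ 0
  rev : ∀ l i, ℓ l.rev i = (-1) ^ i * ℓ l i

/-- Values on monomials of the functionals dual to `1, t, …, t ^ (m - 1)`. -/
noncomputable def dualMoments {m : ℕ} (ℓ : Fin m → ℕ → ℝ) (i : Fin m) (j : ℕ) : ℝ :=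
  ∑ l, (Matrix.of fun l i : Fin m => ℓ l i)⁻¹ i l * ℓ l j

theorem dualMoments_of_lt {m : ℕ} {ℓ : Fin m → ℕ → ℝ} (h : SymmetricMoments ℓ) (i j : Fin m) :
    dualMoments ℓ i j = if i = j then 1 else 0 := by
  have := congrFun (congrFun (Matrix.nonsing_inv_mul (Matrix.of fun l i : Fin m => ℓ l i)
    (isUnit_iff_ne_zero.2 h.det_ne_zero)) i) j
  simpa [Matrix.mul_apply, Matrix.one_apply, dualMoments] using this

/-- Each functional is the combination of the dual ones with its own low moments as coefficients.
This is an identity of functionals, so it holds at every degree `j`, not only for `j < m`. -/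
theorem sum_mul_dualMoments {m : ℕ} {ℓ : Fin m → ℕ → ℝ} (h : SymmetricMoments ℓ) (l : Fin m)
    (j : ℕ) : ∑ i : Fin m, ℓ l i * dualMoments ℓ i j = ℓ l j := by
  have := congrArg (fun M => (M *ᵥ fun l => ℓ l j) l)
    (Matrix.mul_nonsing_inv (Matrix.of fun l i : Fin m => ℓ l i)
    (isUnit_iff_ne_zero.2 h.det_ne_zero))
  simp only [← Matrix.mulVec_mulVec, Matrix.one_mulVec] at this
  simpa [Matrix.mulVec, dotProduct, dualMoments] using this

/-- Reflection permutes the functionals, so it preserves their span. The reflected dual functional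
of index `i` agrees with `(-1) ^ i` times the original in all degrees below `m`, hence in all
degrees. -/
theorem dualMoments_of_not_even {m : ℕ} {ℓ : Fin m → ℕ → ℝ} (h : SymmetricMoments ℓ) (i : Fin m)
    {j : ℕ} (hij : ¬ Even ((i : ℕ) + j)) : dualMoments ℓ i j = 0 := by
  set P := (Matrix.of fun l i : Fin m => ℓ l i)⁻¹ with hP
  have h1 : ∑ l, P i l * ℓ l.rev j = (-1) ^ j * dualMoments ℓ i j := by
    rw [dualMoments, Finset.mul_sum]
    exact Finset.sum_congr rfl fun l _ => by rw [h.rev]; ring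
  have h2 : ∑ l, P i l * ℓ l.rev j = (-1) ^ (i : ℕ) * dualMoments ℓ i j := by
    have : ∀ l, P i l * ℓ l.rev j =
        ∑ i' : Fin m, (-1) ^ (i' : ℕ) * dualMoments ℓ i' j * (P i l * ℓ l i') := fun l => by
      rw [← sum_mul_dualMoments h, Finset.mul_sum]
      exact Finset.sum_congr rfl fun i' _ => by rw [h.rev]; ring
    simp only [this]
    rw [Finset.sum_comm]
    simp only [← Finset.mul_sum]
    have h3 : ∀ i' : Fin m, ∑ l, P i l * ℓ l i' = if i = i' then 1 else 0 := fun i' =>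
      dualMoments_of_lt h i i'
    simp [h3]
  have h4 := h1.symm.trans h2
  rw [Nat.not_even_iff_odd, Nat.odd_add] at hij
  by_cases hi : Odd (i : ℕ)
  · rw [hi.neg_one_pow, (hij.1 hi).neg_one_pow] at h4; linarith
  · have hj : Odd j := by rw [← Nat.not_even_iff_odd]; exact fun hj => hi (hij.2 hj)
    rw [hj.neg_one_pow, (Nat.not_odd_iff_even.1 hi).neg_one_pow] at h4; linarith

theorem dualMoments_eq_zero {m : ℕ} {ℓ : Fin m → ℕ → ℝ} (h : SymmetricMoments ℓ) (i : Fin m)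
    (j : ℕ) (hj : j < i ∨ ¬ Even ((i : ℕ) + j)) : dualMoments ℓ i j = 0 := by
  rcases hj with hj | hj
  · have := dualMoments_of_lt h i ⟨j, hj.trans i.2⟩
    rwa [if_neg (by intro h; rw [h] at hj; exact lt_irrefl _ hj)] at this
  · exact dualMoments_of_not_even h i hj

/-! ### Asymptotics of the scaled collocation system. -/

/-- Inversion of a matrix and a right hand side that are known up to `O(ε)`. -/
theorem isBigO_vecMul_inv {m : ℕ} {B : ℝ → Matrix (Fin m) (Fin m) ℝ}
    {H : Matrix (Fin m) (Fin m) ℝ} {ρ : ℝ → Fin m → ℝ} {ρ₀ : Fin m → ℝ} (hH : H.det ≠ 0)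
    (hB : ∀ i j, (fun ε => B ε i j - H i j) =O[𝓝[≠] 0] fun ε => ε)
    (hρ : ∀ j, (fun ε => ρ ε j - ρ₀ j) =O[𝓝[≠] 0] fun ε => ε) :
    (∀ᶠ ε in 𝓝[≠] 0, (B ε).det ≠ 0) ∧
      ∀ i, (fun ε => (ρ ε ᵥ* (B ε)⁻¹) i - (ρ₀ ᵥ* H⁻¹) i) =O[𝓝[≠] 0] fun ε => ε := by
  have hid : Tendsto (fun ε : ℝ => ε) (𝓝[≠] 0) (𝓝 0) := tendsto_id.mono_left nhdsWithin_le_nhds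
  have hBt : Tendsto B (𝓝[≠] 0) (𝓝 H) := by
    refine tendsto_pi_nhds.2 fun i => tendsto_pi_nhds.2 fun j => ?_
    simpa using ((hB i j).trans_tendsto hid).add_const (H i j)
  have hdet : Tendsto (fun ε => (B ε).det) (𝓝[≠] 0) (𝓝 H.det) :=
    (continuous_id.matrix_det.tendsto H).comp hBt
  have hne : ∀ᶠ ε in 𝓝[≠] 0, (B ε).det ≠ 0 := hdet.eventually_ne hH
  have hinv : ∀ i j, (fun ε => (B ε)⁻¹ i j) =O[𝓝[≠] 0] fun _ => (1 : ℝ) := by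
    intro i j
    have hadj : Tendsto (fun ε => (B ε).adjugate) (𝓝[≠] 0) (𝓝 H.adjugate) :=
      (continuous_id.matrix_adjugate.tendsto H).comp hBt
    have : Tendsto (fun ε => (B ε).det⁻¹ * (B ε).adjugate i j) (𝓝[≠] 0)
        (𝓝 (H.det⁻¹ * H.adjugate i j)) :=
      (hdet.inv₀ hH).mul ((tendsto_pi_nhds.1 (tendsto_pi_nhds.1 hadj i)) j)
    refine (this.isBigO_one ℝ).congr_left fun ε => ?_
    simp [Matrix.inv_def]
  refine ⟨hne, fun i => ?_⟩
  set ζ₀ := ρ₀ ᵥ* H⁻¹ with hζ₀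
  have hζH : ζ₀ ᵥ* H = ρ₀ := by
    rw [hζ₀, Matrix.vecMul_vecMul, Matrix.nonsing_inv_mul _ (isUnit_iff_ne_zero.2 hH),
      Matrix.vecMul_one]
  -- The difference of the two solutions is `(ρ - ζ₀ B) B⁻¹`: a residual of size `O(ε)` times a
  -- bounded inverse.
  have hres : ∀ j, (fun ε => (ρ ε - ζ₀ ᵥ* B ε) j) =O[𝓝[≠] 0] fun ε => ε := by
    intro j
    have h1 : (fun ε => ∑ i, ζ₀ i * (B ε i j - H i j)) =O[𝓝[≠] 0] fun ε => ε :=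
      IsBigO.fun_sum fun i _ => (hB i j).const_mul_left _
    refine ((hρ j).sub h1).congr_left fun ε => ?_
    have h2 := congrFun hζH j
    simp only [Matrix.vecMul, dotProduct] at h2
    simp only [Pi.sub_apply, Matrix.vecMul, dotProduct, mul_sub, Finset.sum_sub_distrib, h2]
    ring
  have hfin : (fun ε => ((ρ ε - ζ₀ ᵥ* B ε) ᵥ* (B ε)⁻¹) i) =O[𝓝[≠] 0] fun ε => ε := by
    simp only [Matrix.vecMul, dotProduct]
    refine IsBigO.fun_sum fun j _ => ?_
    simpa [Matrix.vecMul, dotProduct] using (hres j).mul (hinv j i)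
  refine hfin.congr' ?_ EventuallyEq.rfl
  filter_upwards [hne] with ε hε
  rw [Matrix.sub_vecMul, Matrix.vecMul_vecMul,
    Matrix.mul_nonsing_inv _ (isUnit_iff_ne_zero.2 hε), Matrix.vecMul_one, Pi.sub_apply]

theorem sum_range_of_parity {n v : ℕ} (hv : v ≤ 1) {f : ℕ → ℝ} (hf : ∀ i, ¬ Even (i + v) → f i = 0) :
    ∑ i ∈ Finset.range (2 * n + v), f i = ∑ k ∈ Finset.range n, f (2 * k + v) := by
  induction n with
  | zero =>
    interval_cases v
    · simp
    · simpa using hf 0 (by decide)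
  | succ n ih =>
    rw [show 2 * (n + 1) + v = 2 * n + v + 1 + 1 by ring, Finset.sum_range_succ,
      Finset.sum_range_succ, ih, Finset.sum_range_succ]
    interval_cases v
    · rw [hf (2 * n + 0 + 1) (by rw [Nat.even_iff]; omega)]; ring
    · rw [hf (2 * n + 1 + 1) (by rw [Nat.even_iff]; omega)]; ring

theorem isBigO_div_pow_sub {f : ℝ → ℝ} {c : ℝ} {e : ℕ}
    (h : (fun ε => f ε - c * ε ^ e) =O[𝓝 0] fun ε => ε ^ (e + 1)) :
    (fun ε => f ε / ε ^ e - c) =O[𝓝[≠] 0] fun ε => ε := by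
  refine ((h.mono nhdsWithin_le_nhds).mul (isBigO_refl (fun ε : ℝ => (ε ^ e)⁻¹) (𝓝[≠] 0))).congr'
    ?_ ?_
  · filter_upwards [self_mem_nhdsWithin] with ε hε
    have : ε ^ e ≠ 0 := pow_ne_zero _ hε
    field_simp
  · filter_upwards [self_mem_nhdsWithin] with ε hε
    have : ε ^ e ≠ 0 := pow_ne_zero _ hε
    rw [pow_succ']
    field_simp

/-- The expansion at `ε = 0` of the entries of a collocation matrix in dual bases. -/
theorem dual_matrix_leading {m : ℕ} {b : ℕ → ℝ} {ℓ σ : Fin m → ℕ → ℝ} (hℓ : SymmetricMoments ℓ)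
    (hσ : SymmetricMoments σ) {A : ℝ → Matrix (Fin m) (Fin m) ℝ}
    (hA : ∀ l k Q, (fun ε => A ε l k - kernelExpansion b Q (ℓ l) (σ k) ε) =O[𝓝 0] fun ε => ε ^ Q)
    (i j : Fin m) :
    (fun ε => ((Matrix.of fun l i : Fin m => ℓ l i)⁻¹ * A ε *
        (Matrix.of fun l i : Fin m => σ l i)⁻¹ᵀ) i j -
      leadingCoeff b i j * ε ^ (((i : ℕ) + 1) / 2 + (j : ℕ) / 2))
      =O[𝓝 0] fun ε => ε ^ (((i : ℕ) + 1) / 2 + (j : ℕ) / 2 + 1) := by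
  set P := (Matrix.of fun l i : Fin m => ℓ l i)⁻¹ with hP
  set S := (Matrix.of fun l i : Fin m => σ l i)⁻¹ with hS
  set e := ((i : ℕ) + 1) / 2 + (j : ℕ) / 2 with he
  have h1 := kernelExpansion_leading b (Q := e + 1) (Nat.lt_succ_self _)
    (fun i' => dualMoments_eq_zero hℓ i i') (fun j' => dualMoments_eq_zero hσ j j')
  have h2 : (fun ε => ∑ k, (∑ l, P i l * (A ε l k - kernelExpansion b (e + 1) (ℓ l) (σ k) ε)) * S j k)
      =O[𝓝 0] fun ε => ε ^ (e + 1) := by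
    refine IsBigO.fun_sum fun k _ => ?_
    simp_rw [mul_comm _ (S j k)]
    refine IsBigO.const_mul_left (IsBigO.fun_sum fun l _ => ?_) _
    exact (hA l k (e + 1)).const_mul_left _
  refine (h2.add h1).congr_left fun ε => ?_
  have h3 : kernelExpansion b (e + 1) (dualMoments ℓ i) (dualMoments σ j) ε =
      ∑ k, (∑ l, P i l * kernelExpansion b (e + 1) (ℓ l) (σ k) ε) * S j k := by
    change kernelExpansion b (e + 1) (fun i' => ∑ l, P i l * ℓ l i')
      (fun j' => ∑ k, S j k * σ k j') ε = _
    rw [kernelExpansion_sum_right]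
    refine Finset.sum_congr rfl fun k _ => ?_
    rw [kernelExpansion_sum_left, mul_comm]
  rw [h3, dualMoments_of_lt hℓ, dualMoments_of_lt hσ]
  simp only [mul_sub, Finset.sum_sub_distrib, sub_mul, Matrix.mul_apply, Matrix.transpose_apply,
    if_true]
  ring

/-- The same expansion for the defect of the dual functional of index `v` as a replacement for the
functional that reads off the coefficient of `t ^ v`. -/
theorem dual_defect_leading {m v : ℕ} (hvm : v < m) (hpar : Even (m + v)) {b : ℕ → ℝ}
    {ℓ σ : Fin m → ℕ → ℝ} (hℓ : SymmetricMoments ℓ)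
    (hσ : SymmetricMoments σ) {A : ℝ → Matrix (Fin m) (Fin m) ℝ} {r : ℝ → Fin m → ℝ}
    (hA : ∀ l k Q, (fun ε => A ε l k - kernelExpansion b Q (ℓ l) (σ k) ε) =O[𝓝 0] fun ε => ε ^ Q)
    (hr : ∀ k Q, (fun ε => r ε k - kernelExpansion b Q (fun i => if i = v then 1 else 0) (σ k) ε)
      =O[𝓝 0] fun ε => ε ^ Q) (j : Fin m) :
    (fun ε => ((r ε ᵥ* (Matrix.of fun l i : Fin m => σ l i)⁻¹ᵀ) j -
        ((Matrix.of fun l i : Fin m => ℓ l i)⁻¹ * A ε *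
        (Matrix.of fun l i : Fin m => σ l i)⁻¹ᵀ) ⟨v, hvm⟩ j) -
      (- dualMoments ℓ ⟨v, hvm⟩ m * leadingCoeff b m j) * ε ^ ((m + 1) / 2 + (j : ℕ) / 2))
      =O[𝓝 0] fun ε => ε ^ ((m + 1) / 2 + (j : ℕ) / 2 + 1) := by
  set P := (Matrix.of fun l i : Fin m => ℓ l i)⁻¹ with hP
  set S := (Matrix.of fun l i : Fin m => σ l i)⁻¹ with hS
  set e := (m + 1) / 2 + (j : ℕ) / 2 with he
  -- Reading off the coefficient of `t ^ v` and applying the dual functional of index `v` agree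
  -- below degree `m`. Their difference therefore has leading degree `m` and respects parity,
  -- because `m` and `v` have the same parity.
  have hvan : ∀ i, i < m ∨ ¬ Even (m + i) →
      (if i = v then (1 : ℝ) else 0) - dualMoments ℓ ⟨v, hvm⟩ i = 0 := by
    intro i hi
    by_cases him : i < m
    · have := dualMoments_of_lt hℓ ⟨v, hvm⟩ ⟨i, him⟩
      rw [show dualMoments ℓ ⟨v, hvm⟩ i = _ from this]
      simp [Fin.ext_iff, eq_comm]
    · rw [if_neg (by omega), dualMoments_of_not_even hℓ, sub_zero]
      have hi := hi.resolve_left him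
      simp only [Nat.even_iff] at *
      omega
  have h1 := kernelExpansion_leading b (Q := e + 1) (Nat.lt_succ_self _) hvan
    (fun j' => dualMoments_eq_zero hσ j j')
  have h2 : (fun ε => ∑ k, (∑ l, P ⟨v, hvm⟩ l *
        (A ε l k - kernelExpansion b (e + 1) (ℓ l) (σ k) ε)) * S j k)
      =O[𝓝 0] fun ε => ε ^ (e + 1) := by
    refine IsBigO.fun_sum fun k _ => ?_
    simp_rw [mul_comm _ (S j k)]
    refine IsBigO.const_mul_left (IsBigO.fun_sum fun l _ => ?_) _
    exact (hA l k (e + 1)).const_mul_left _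
  have h4 : (fun ε => ∑ k, S j k * (r ε k -
        kernelExpansion b (e + 1) (fun i => if i = v then 1 else 0) (σ k) ε))
      =O[𝓝 0] fun ε => ε ^ (e + 1) :=
    IsBigO.fun_sum fun k _ => (hr k (e + 1)).const_mul_left _
  refine ((h4.sub h2).add h1).congr_left fun ε => ?_
  have h3 : kernelExpansion b (e + 1) (dualMoments ℓ ⟨v, hvm⟩) (dualMoments σ j) ε =
      ∑ k, (∑ l, P ⟨v, hvm⟩ l * kernelExpansion b (e + 1) (ℓ l) (σ k) ε) * S j k := by
    change kernelExpansion b (e + 1) (fun i' => ∑ l, P ⟨v, hvm⟩ l * ℓ l i')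
      (fun j' => ∑ k, S j k * σ k j') ε = _
    rw [kernelExpansion_sum_right]
    refine Finset.sum_congr rfl fun k _ => ?_
    rw [kernelExpansion_sum_left, mul_comm]
  have h5 : kernelExpansion b (e + 1) (fun i => if i = v then 1 else 0) (dualMoments σ j) ε =
      ∑ k, S j k * kernelExpansion b (e + 1) (fun i => if i = v then 1 else 0) (σ k) ε := by
    change kernelExpansion b (e + 1) _ (fun j' => ∑ k, S j k * σ k j') ε = _
    rw [kernelExpansion_sum_right]
  rw [kernelExpansion_sub_left, h3, h5, dualMoments_of_lt hσ, if_neg (by omega : m ≠ v)]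
  simp only [mul_sub, Finset.sum_sub_distrib, sub_mul, Matrix.mul_apply, Matrix.transpose_apply,
    if_true, Matrix.vecMul, dotProduct]
  simp only [mul_comm (r ε _)]
  ring

/-- The moments `w L` solve `(w L) B = r Sᵀ`. Subtracting the unit vector at `v` leaves the defect
on the right, which is of higher order in `ε`; after scaling, the system converges to one with the
nonsingular matrix `H`. The hypothesis `hnz` concerns the interpolant of `t ^ m`: its coefficient at
`t ^ v` becomes `γ n` up to a factorial. -/
theorem exists_moment_expansion {n v m : ℕ} (hn : 1 ≤ n) (hv : v ≤ 1) (hm : m = 2 * n + v)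
    {b : ℕ → ℝ} (hH : (Matrix.of fun i j : Fin m => leadingCoeff b i j).det ≠ 0)
    {ℓ σ : Fin m → ℕ → ℝ} (hℓ : SymmetricMoments ℓ) (hσ : SymmetricMoments σ)
    (hnz : ∀ a : Fin m → ℝ, (∀ l, ℓ l m = ∑ i : Fin m, ℓ l i * a i) → a ⟨v, by omega⟩ ≠ 0)
    {A : ℝ → Matrix (Fin m) (Fin m) ℝ} {r : ℝ → Fin m → ℝ}
    (hA : ∀ l k Q, (fun ε => A ε l k - kernelExpansion b Q (ℓ l) (σ k) ε) =O[𝓝 0] fun ε => ε ^ Q)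
    (hr : ∀ k Q, (fun ε => r ε k - kernelExpansion b Q (fun i => if i = v then 1 else 0) (σ k) ε)
      =O[𝓝 0] fun ε => ε ^ Q)
    (hArev : ∀ ε l k, A ε l.rev k.rev = A ε l k) (hrrev : ∀ ε k, r ε k.rev = (-1) ^ v * r ε k) :
    ∃ γ : ℕ → ℝ, γ n ≠ 0 ∧
      (∀ l < n, ∑ k ∈ Finset.range (n + 1),
        γ k * ((2 * (k + l + v)).factorial * b (k + l + v)) = 0) ∧
      (∀ᶠ ε in 𝓝[≠] 0, (A ε).det ≠ 0) ∧
      (∀ l, (fun ε => (r ε ᵥ* (A ε)⁻¹) l) =O[𝓝[≠] 0] fun _ => (1 : ℝ)) ∧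
      (∀ᶠ ε in 𝓝[≠] 0, ∀ i, ¬ Even (i + v) → ∑ l, (r ε ᵥ* (A ε)⁻¹) l * ℓ l i = 0) ∧
      ∀ k ≤ n, (fun ε => ∑ l, (r ε ᵥ* (A ε)⁻¹) l * ℓ l (2 * k + v) - (if k = 0 then 1 else 0) -
        (2 * k + v).factorial * γ k * ε ^ (n - k)) =O[𝓝[≠] 0] fun ε => ε ^ (n - k + 1) := by
  have hvm : v < m := by omega
  have hpar : Even (m + v) := by rw [Nat.even_iff]; omega
  set L := Matrix.of fun l i : Fin m => ℓ l i with hL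
  set P := L⁻¹ with hP
  set S := (Matrix.of fun l i : Fin m => σ l i)⁻¹ with hS
  have hPL : P * L = 1 := Matrix.nonsing_inv_mul _ (isUnit_iff_ne_zero.2 hℓ.det_ne_zero)
  have hLP : L * P = 1 := Matrix.mul_nonsing_inv _ (isUnit_iff_ne_zero.2 hℓ.det_ne_zero)
  set w : ℝ → Fin m → ℝ := fun ε => r ε ᵥ* (A ε)⁻¹ with hw
  set H := Matrix.of fun i j : Fin m => leadingCoeff b i j with hHdef
  set B : ℝ → Matrix (Fin m) (Fin m) ℝ := fun ε => P * A ε * Sᵀ with hB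
  set D : ℝ → Fin m → ℝ := fun ε j => (r ε ᵥ* Sᵀ) j - B ε ⟨v, hvm⟩ j with hD
  set Bh : ℝ → Matrix (Fin m) (Fin m) ℝ := fun ε =>
    Matrix.of fun i j => B ε i j / ε ^ (((i : ℕ) + 1) / 2 + (j : ℕ) / 2) with hBh
  set ρ : ℝ → Fin m → ℝ := fun ε j => D ε j / ε ^ ((m + 1) / 2 + (j : ℕ) / 2) with hρ
  set ρ₀ : Fin m → ℝ := fun j => - dualMoments ℓ ⟨v, hvm⟩ m * leadingCoeff b m j with hρ₀
  obtain ⟨hdet, hζ⟩ := isBigO_vecMul_inv (B := Bh) (ρ := ρ) (ρ₀ := ρ₀) hH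
    (fun i j => isBigO_div_pow_sub (dual_matrix_leading hℓ hσ hA i j))
    (fun j => isBigO_div_pow_sub (dual_defect_leading hvm hpar hℓ hσ hA hr j))
  set ζ₀ := ρ₀ ᵥ* H⁻¹ with hζ₀
  have hζH : ζ₀ ᵥ* H = ρ₀ := by
    rw [hζ₀, Matrix.vecMul_vecMul, Matrix.nonsing_inv_mul _ (isUnit_iff_ne_zero.2 hH),
      Matrix.vecMul_one]
  have hm2 : (m + 1) / 2 = n + v := by omega
  -- the collocation matrix is nonsingular
  have hAdet : ∀ᶠ ε in 𝓝[≠] 0, (A ε).det ≠ 0 := by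
    filter_upwards [hdet, self_mem_nhdsWithin] with ε hε hε0 hA0
    have hBfac : B ε = Matrix.diagonal (fun i : Fin m => ε ^ (((i : ℕ) + 1) / 2)) * Bh ε *
        Matrix.diagonal (fun j : Fin m => ε ^ ((j : ℕ) / 2)) := by
      ext i j
      rw [Matrix.mul_diagonal, Matrix.diagonal_mul]
      simp only [hBh, Matrix.of_apply, pow_add]
      have h1 : ε ^ (((i : ℕ) + 1) / 2) ≠ 0 := pow_ne_zero _ hε0
      have h2 : ε ^ ((j : ℕ) / 2) ≠ 0 := pow_ne_zero _ hε0
      field_simp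
    have h1 : (B ε).det ≠ 0 := by
      rw [hBfac, Matrix.det_mul, Matrix.det_mul, Matrix.det_diagonal, Matrix.det_diagonal]
      exact mul_ne_zero (mul_ne_zero (Finset.prod_ne_zero_iff.2 fun i _ => pow_ne_zero _ hε0) hε)
        (Finset.prod_ne_zero_iff.2 fun i _ => pow_ne_zero _ hε0)
    apply h1
    simp only [hB, Matrix.det_mul, hA0, mul_zero, zero_mul]
  -- the moments of degree less than `m`
  have hmom : ∀ᶠ ε in 𝓝[≠] 0, ∀ i : Fin m, ∑ l, w ε l * ℓ l i =
      (if i = ⟨v, hvm⟩ then 1 else 0) +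
        ε ^ (n + v - ((i : ℕ) + 1) / 2) * (ρ ε ᵥ* (Bh ε)⁻¹) i := by
    filter_upwards [hdet, hAdet, self_mem_nhdsWithin] with ε hε hAε hε0
    have hwA : w ε ᵥ* A ε = r ε := by
      simp only [hw]
      rw [Matrix.vecMul_vecMul, Matrix.nonsing_inv_mul _ (isUnit_iff_ne_zero.2 hAε),
        Matrix.vecMul_one]
    have hMB : (w ε ᵥ* L) ᵥ* B ε = r ε ᵥ* Sᵀ := by
      simp only [hB]
      rw [Matrix.vecMul_vecMul, ← Matrix.mul_assoc, ← Matrix.mul_assoc, hLP, Matrix.one_mul,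
        ← Matrix.vecMul_vecMul, hwA]
    -- The unknown is the deviation of the moments from the unit vector, multiplied by the row
    -- scaling `ε ^ ⌈i/2⌉`; it then solves a system with the convergent matrix `Bh ε`.
    set x : Fin m → ℝ := fun i =>
      ((w ε ᵥ* L) i - if i = ⟨v, hvm⟩ then 1 else 0) * ε ^ (((i : ℕ) + 1) / 2) with hx
    have hxB : x ᵥ* Bh ε = ε ^ (n + v) • ρ ε := by
      ext j
      have h1 := congrFun hMB j
      have hj : ε ^ ((j : ℕ) / 2) ≠ 0 := pow_ne_zero _ hε0
      have hnv : ε ^ (n + v) ≠ 0 := pow_ne_zero _ hε0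
      simp only [Pi.smul_apply, smul_eq_mul, hρ, hD, hm2, ← h1, pow_add _ (n + v)]
      have h2 : (x ᵥ* Bh ε) j =
          (∑ i, ((w ε ᵥ* L) i - if i = ⟨v, hvm⟩ then 1 else 0) * B ε i j) / ε ^ ((j : ℕ) / 2) := by
        rw [Matrix.vecMul, dotProduct, Finset.sum_div]
        refine Finset.sum_congr rfl fun i _ => ?_
        have hi : ε ^ (((i : ℕ) + 1) / 2) ≠ 0 := pow_ne_zero _ hε0
        simp only [hx, hBh, Matrix.of_apply, pow_add]
        field_simp
      rw [h2]
      simp only [sub_mul, Finset.sum_sub_distrib, ite_mul, one_mul, zero_mul, Finset.sum_ite_eq',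
        Finset.mem_univ, if_true]
      rw [Matrix.vecMul, dotProduct]
      field_simp
    have hxe : x = ε ^ (n + v) • (ρ ε ᵥ* (Bh ε)⁻¹) := by
      rw [← Matrix.smul_vecMul, ← hxB, Matrix.vecMul_vecMul,
        Matrix.mul_nonsing_inv _ (isUnit_iff_ne_zero.2 hε), Matrix.vecMul_one]
    intro i
    have h1 := congrFun hxe i
    have hi : ε ^ (((i : ℕ) + 1) / 2) ≠ 0 := pow_ne_zero _ hε0
    have hile : ((i : ℕ) + 1) / 2 ≤ n + v := by omega
    simp only [hx, Pi.smul_apply, smul_eq_mul] at h1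
    rw [← Nat.sub_add_cancel hile, pow_add] at h1
    have h2 : (w ε ᵥ* L) i = ∑ l, w ε l * ℓ l i := rfl
    rw [← h2]
    have h3 : ((w ε ᵥ* L) i - if i = ⟨v, hvm⟩ then 1 else 0) =
        ε ^ (n + v - ((i : ℕ) + 1) / 2) * (ρ ε ᵥ* (Bh ε)⁻¹) i := by
      apply mul_right_cancel₀ hi
      rw [h1]; ring
    linarith
  have hodd : ∀ᶠ ε in 𝓝[≠] 0, ∀ i, ¬ Even (i + v) → ∑ l, w ε l * ℓ l i = 0 := by
    filter_upwards [hAdet] with ε hAε i hi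
    have hwA : w ε ᵥ* A ε = r ε := by
      simp only [hw]
      rw [Matrix.vecMul_vecMul, Matrix.nonsing_inv_mul _ (isUnit_iff_ne_zero.2 hAε),
        Matrix.vecMul_one]
    -- Reflected weights solve the same nonsingular system, so they coincide with `w ε`.
    have hw' : (fun l => (-1) ^ v * w ε l.rev) = w ε := by
      have : (fun l => (-1) ^ v * w ε l.rev) ᵥ* A ε = r ε := by
        ext k
        have h1 := congrFun hwA k.rev
        rw [hrrev] at h1
        have h2 : r ε k = (-1) ^ v * (w ε ᵥ* A ε) k.rev := by
          rw [h1, ← mul_assoc, ← pow_add, Even.neg_one_pow ⟨v, rfl⟩, one_mul]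
        rw [h2, Matrix.vecMul, Matrix.vecMul, dotProduct, dotProduct, Finset.mul_sum,
          ← Equiv.sum_comp Fin.revPerm]
        refine Finset.sum_congr rfl fun l _ => ?_
        simp only [Fin.revPerm_apply, Fin.rev_rev]
        rw [← hArev ε l k.rev, Fin.rev_rev]
        ring
      calc _ = (fun l => (-1) ^ v * w ε l.rev) ᵥ* A ε ᵥ* (A ε)⁻¹ := by
            rw [Matrix.vecMul_vecMul, Matrix.mul_nonsing_inv _ (isUnit_iff_ne_zero.2 hAε),
              Matrix.vecMul_one]
        _ = w ε := by rw [this]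
    have h1 : ∑ l, w ε l * ℓ l i = (-1) ^ (i + v) * ∑ l, w ε l * ℓ l i := by
      conv_lhs => rw [← hw']
      rw [← Equiv.sum_comp Fin.revPerm, Finset.mul_sum]
      refine Finset.sum_congr rfl fun l _ => ?_
      simp only [Fin.revPerm_apply, Fin.rev_rev]
      rw [hℓ.rev]
      ring
    rw [(Nat.not_even_iff_odd.1 hi).neg_one_pow] at h1
    linarith
  have hid1 : (fun ε : ℝ => ε) =O[𝓝[≠] 0] fun _ => (1 : ℝ) := by
    simpa using (isBigO_pow_pow_nhds_zero (zero_le_one)).mono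
      (nhdsWithin_le_nhds (a := (0 : ℝ)) (s := {0}ᶜ))
  have hζO : ∀ i, (fun ε => (ρ ε ᵥ* (Bh ε)⁻¹) i) =O[𝓝[≠] 0] fun _ => (1 : ℝ) := fun i => by
    simpa using ((hζ i).trans hid1).add (isBigO_const_const (ζ₀ i) one_ne_zero (𝓝[≠] (0 : ℝ)))
  have hpowO : ∀ k : ℕ, (fun ε : ℝ => ε ^ k) =O[𝓝[≠] 0] fun _ => (1 : ℝ) := fun k => by
    simpa using (isBigO_pow_pow_nhds_zero (Nat.zero_le k)).mono
      (nhdsWithin_le_nhds (a := (0 : ℝ)) (s := {0}ᶜ))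
  have hbdd : ∀ l, (fun ε => w ε l) =O[𝓝[≠] 0] fun _ => (1 : ℝ) := by
    intro l
    have h1 : (fun ε => ∑ i : Fin m, ((if i = ⟨v, hvm⟩ then 1 else 0) +
        ε ^ (n + v - ((i : ℕ) + 1) / 2) * (ρ ε ᵥ* (Bh ε)⁻¹) i) * P i l)
        =O[𝓝[≠] 0] fun _ => (1 : ℝ) := by
      refine IsBigO.fun_sum fun i _ => ?_
      simp_rw [mul_comm _ (P i l)]
      refine IsBigO.const_mul_left (IsBigO.add (isBigO_const_const _ one_ne_zero _) ?_) _
      simpa using (hpowO (n + v - ((i : ℕ) + 1) / 2)).mul (hζO i)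
    refine h1.congr' ?_ EventuallyEq.rfl
    filter_upwards [hmom] with ε hε
    simp only [← hε]
    have h2 : ((w ε ᵥ* L) ᵥ* P) l = w ε l := by
      rw [Matrix.vecMul_vecMul, hLP, Matrix.vecMul_one]
    exact h2
  have hvnz : dualMoments ℓ ⟨v, hvm⟩ m ≠ 0 :=
    hnz (fun i => dualMoments ℓ i m) fun l => (sum_mul_dualMoments hℓ l m).symm
  -- For `k < n` the constant is the limit of a scaled solved moment. The moment of degree `m = 2 n
  -- + v` lies outside the system, and its limit is the moment of the dual functional.
  set γ : ℕ → ℝ := fun k => if h : k < n then ζ₀ ⟨2 * k + v, by omega⟩ / (2 * k + v).factorial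
    else dualMoments ℓ ⟨v, hvm⟩ m / m.factorial with hγ
  have hfac : ∀ k : ℕ, (k.factorial : ℝ) ≠ 0 := fun k => by exact_mod_cast k.factorial_ne_zero
  have hγn : γ n = dualMoments ℓ ⟨v, hvm⟩ m / m.factorial := by simp [hγ]
  refine ⟨γ, ?_, ?_, hAdet, hbdd, hodd, ?_⟩
  · rw [hγn]
    exact div_ne_zero hvnz (hfac m)
  · intro l hl
    -- With the binomial written in factorials, the column `2 l + v` of `ζ₀ H = ρ₀` becomes the
    -- Hankel relation; the right-hand side supplies its term `k = n`.
    have hlead : ∀ k, leadingCoeff b (2 * k + v) (2 * l + v) =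
        (2 * (k + l + v)).factorial * b (k + l + v) /
          ((2 * k + v).factorial * (2 * l + v).factorial) := by
      intro k
      have h1 : 2 * k + v + (2 * l + v) = 2 * (k + l + v) := by ring
      have h2 := Nat.add_choose_mul_factorial_mul_factorial (2 * l + v) (2 * k + v)
      rw [leadingCoeff, if_pos (by rw [h1]; exact even_two_mul _), h1,
        Nat.mul_div_cancel_left _ two_pos]
      rw [add_comm (2 * l + v), h1] at h2
      rw [eq_div_iff (mul_ne_zero (hfac _) (hfac _)), ← h2]
      push_cast
      ring
    have h1 := congrFun hζH ⟨2 * l + v, by omega⟩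
    have h2 : (ζ₀ ᵥ* H) ⟨2 * l + v, by omega⟩ =
        ∑ k ∈ Finset.range n, γ k * (2 * k + v).factorial * leadingCoeff b (2 * k + v) (2 * l + v) := by
      set f : ℕ → ℝ := fun i => if h : i < m then ζ₀ ⟨i, h⟩ * leadingCoeff b i (2 * l + v) else 0
        with hf
      have hf1 : (ζ₀ ᵥ* H) ⟨2 * l + v, by omega⟩ = ∑ i : Fin m, f i := by
        rw [Matrix.vecMul, dotProduct]
        refine Finset.sum_congr rfl fun i _ => ?_
        simp [hf, hHdef]
      rw [hf1, Fin.sum_univ_eq_sum_range, hm, sum_range_of_parity hv]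
      · refine Finset.sum_congr rfl fun k hk => ?_
        have hk := Finset.mem_range.1 hk
        simp only [hf, hγ, dif_pos hk, dif_pos (show 2 * k + v < m by omega)]
        rw [div_mul_cancel₀ _ (hfac _)]
      · intro i hi
        simp only [hf]
        split_ifs
        · rw [leadingCoeff, if_neg, mul_zero]
          rw [Nat.even_iff] at *
          omega
        · rfl
    rw [h2] at h1
    simp only [hρ₀] at h1
    have h3 : dualMoments ℓ ⟨v, hvm⟩ m = γ n * (2 * n + v).factorial := by
      rw [hγn, ← hm, div_mul_cancel₀ _ (hfac _)]
    have h4 : leadingCoeff b m (2 * l + v) = leadingCoeff b (2 * n + v) (2 * l + v) := by rw [hm]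
    rw [h3, h4] at h1
    have h5 : ∑ k ∈ Finset.range (n + 1),
        γ k * (2 * k + v).factorial * leadingCoeff b (2 * k + v) (2 * l + v) = 0 := by
      rw [Finset.sum_range_succ, h1]; ring
    have h6 : ∑ k ∈ Finset.range (n + 1), γ k * ((2 * (k + l + v)).factorial * b (k + l + v)) =
        (2 * l + v).factorial * ∑ k ∈ Finset.range (n + 1),
        γ k * (2 * k + v).factorial * leadingCoeff b (2 * k + v) (2 * l + v) := by
      rw [Finset.mul_sum]
      refine Finset.sum_congr rfl fun k _ => ?_
      rw [hlead]
      have := hfac (2 * k + v)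
      have := hfac (2 * l + v)
      field_simp
    rw [h6, h5, mul_zero]
  · intro k hk
    rcases hk.lt_or_eq with hk | rfl
    · have h1 := ((isBigO_refl (fun ε : ℝ => ε ^ (n - k)) (𝓝[≠] 0)).mul
        (hζ ⟨2 * k + v, by omega⟩))
      refine h1.congr' ?_ ?_
      · filter_upwards [hmom] with ε hε
        have h2 := hε ⟨2 * k + v, by omega⟩
        simp only at h2
        rw [show n + v - (2 * k + v + 1) / 2 = n - k by omega] at h2
        rw [h2]
        simp only [Fin.mk.injEq, hγ, dif_pos hk]
        rw [mul_div_cancel₀ _ (hfac _)]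
        by_cases hk0 : k = 0
        · rw [if_pos (by omega), if_pos hk0]; ring
        · rw [if_neg (by omega), if_neg hk0]; ring
      · filter_upwards with ε
        rw [pow_succ]
    -- For `k = n` the functionals at degree `m` are expanded in the dual ones. The unit vector
    -- contributes the limit; the rest carries a positive power of `ε`, since only `i < m` of the
    -- parity of `m` contribute.
    · have h1 : (fun ε => ∑ i : Fin m, (ε ^ (k + v - ((i : ℕ) + 1) / 2) * (ρ ε ᵥ* (Bh ε)⁻¹) i) *
          dualMoments ℓ i m) =O[𝓝[≠] 0] fun ε => ε := by
        refine IsBigO.fun_sum fun i _ => ?_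
        by_cases hi : Even ((i : ℕ) + m)
        · simp_rw [mul_comm _ (dualMoments ℓ i m)]
          refine IsBigO.const_mul_left ?_ _
          have he : 1 ≤ k + v - ((i : ℕ) + 1) / 2 := by
            rw [Nat.even_iff] at hi; omega
          simpa using ((isBigO_pow_pow_nhds_zero he).mono
            (nhdsWithin_le_nhds (a := (0 : ℝ)) (s := {0}ᶜ))).mul (hζO i)
        · simp only [dualMoments_of_not_even hℓ i hi, mul_zero]
          exact isBigO_zero _ _
      refine h1.congr' ?_ ?_
      · filter_upwards [hmom] with ε hε
        rw [hγn, ← hm, mul_div_cancel₀ _ (hfac _), if_neg (by omega : k ≠ 0), Nat.sub_self,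
          pow_zero, mul_one, sub_zero]
        have h2 : ∑ l, w ε l * ℓ l m = ∑ i : Fin m, (∑ l, w ε l * ℓ l i) * dualMoments ℓ i m := by
          simp only [Finset.sum_mul]
          rw [Finset.sum_comm]
          refine Finset.sum_congr rfl fun l _ => ?_
          rw [← sum_mul_dualMoments hℓ l m, Finset.mul_sum]
          exact Finset.sum_congr rfl fun i _ => by ring
        rw [h2]
        simp only [hε, add_mul, Finset.sum_add_distrib, ite_mul, one_mul, zero_mul,
          Finset.sum_ite_eq', Finset.mem_univ, if_true]
        ring
      · filter_upwards with ε
        simp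

/-! ### The two reconstructions on the unit grid. -/

/-- Taylor coefficients at `0`. -/
noncomputable def taylorCoeffZero (Φ : ℝ → ℝ) (q : ℕ) : ℝ := iteratedDeriv q Φ 0 / q.factorial

/-- Because `choose (i + j) i = (i + j)! / (i! j!)`, this is the Hankel matrix of the derivatives of
`φ` at `0`, multiplied on both sides by the diagonal matrix of the `1 / i!`. -/
theorem det_leadingCoeff_ne_zero {Φ : ℝ → ℝ} (hΦ : IsSmoothRBF Φ) {m : ℕ} (hm : 1 ≤ m) :
    (Matrix.of fun i j : Fin m => leadingCoeff (taylorCoeffZero Φ) i j).det ≠ 0 := by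
  obtain ⟨m, rfl⟩ := Nat.exists_eq_add_of_le' hm
  have hfac : ∀ k : ℕ, (k.factorial : ℝ) ≠ 0 := fun k => by exact_mod_cast k.factorial_ne_zero
  have h : (Matrix.of fun i j : Fin (m + 1) => leadingCoeff (taylorCoeffZero Φ) i j) =
      Matrix.diagonal (fun i : Fin (m + 1) => ((i : ℕ).factorial : ℝ)⁻¹) *
      (Matrix.of fun i j : Fin (m + 1) =>
        iteratedDeriv ((i : ℕ) + (j : ℕ)) (radial Φ 1) 0) *
      Matrix.diagonal (fun i : Fin (m + 1) => ((i : ℕ).factorial : ℝ)⁻¹) := by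
    ext i j
    rw [Matrix.mul_diagonal, Matrix.diagonal_mul, Matrix.of_apply, Matrix.of_apply,
      iteratedDeriv_radial_one hΦ.smooth, leadingCoeff]
    split_ifs
    · have h2 := Nat.add_choose_mul_factorial_mul_factorial (i : ℕ) (j : ℕ)
      rw [← h2, Nat.choose_symm_add]
      have := hfac i
      have := hfac j
      push_cast
      simp only [taylorCoeffZero]
      field_simp
    · simp
  rw [h, Matrix.det_mul, Matrix.det_mul, Matrix.det_diagonal]
  have hp := Finset.prod_ne_zero_iff.2 fun (i : Fin (m + 1)) (_ : i ∈ Finset.univ) =>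
    inv_ne_zero (hfac i)
  exact mul_ne_zero (mul_ne_zero hp (hΦ.nondegenerate m)) hp

theorem kernelExpansion_pow (b : ℕ → ℝ) (Q : ℕ) (t s ε : ℝ) :
    kernelExpansion b Q (fun i => t ^ i) (fun j => s ^ j) ε =
      ∑ q ∈ Finset.range Q, b q * (ε * (t + s) ^ 2) ^ q := by
  refine Finset.sum_congr rfl fun q _ => ?_
  rw [mul_pow, ← pow_mul, (Commute.all t s).add_pow', mul_assoc]
  congr 2
  exact Finset.sum_congr rfl fun x _ => by rw [nsmul_eq_mul]; ring

theorem radial_expansion {Φ : ℝ → ℝ} (hΦ : ContDiffAt ℝ ∞ Φ 0) (t s : ℝ) (Q : ℕ) :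
    (fun ε => radial Φ ε (t + s) -
      kernelExpansion (taylorCoeffZero Φ) Q (fun i => t ^ i) (fun j => s ^ j) ε)
      =O[𝓝 0] fun ε => ε ^ Q := by
  have ht : Tendsto (fun ε : ℝ => ε * (t + s) ^ 2) (𝓝 0) (𝓝 0) := by
    simpa using (continuous_mul_const ((t + s) ^ 2)).tendsto (0 : ℝ)
  have h := (hΦ.taylor_isBigO Q).comp_tendsto ht
  have h2 : ((fun r : ℝ => r ^ Q) ∘ fun ε : ℝ => ε * (t + s) ^ 2) =O[𝓝 0] fun ε => ε ^ Q := by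
    simp only [Function.comp_def, mul_pow _ _ Q]
    simp_rw [mul_comm _ (((t + s) ^ 2) ^ Q)]
    exact (isBigO_refl _ _).const_mul_left _
  refine (h.trans h2).congr_left fun ε => ?_
  rw [kernelExpansion_pow]
  rfl

theorem deriv_radial_expansion {Φ : ℝ → ℝ} (hΦ : ContDiffAt ℝ ∞ Φ 0) (s : ℝ) (Q : ℕ) :
    (fun ε => deriv (radial Φ ε) s -
      kernelExpansion (taylorCoeffZero Φ) Q (fun i => if i = 1 then 1 else 0) (fun j => s ^ j) ε)
      =O[𝓝 0] fun ε => ε ^ Q := by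
  have hinner : ∀ q : ℕ, ∑ x ∈ Finset.HasAntidiagonal.antidiagonal (2 * q),
      ((2 * q).choose x.1 : ℝ) * (if x.1 = 1 then 1 else 0) * s ^ x.2 =
      if q = 0 then 0 else 2 * q * s ^ (2 * q - 1) := by
    intro q
    split_ifs with hq
    · subst hq; simp
    · rw [Finset.sum_eq_single (1, 2 * q - 1)]
      · simp
      · intro x hx hne
        rw [Finset.HasAntidiagonal.mem_antidiagonal] at hx
        rw [if_neg (fun h => hne (Prod.ext h (by simp only; omega)))]
        ring
      · intro h
        exact absurd (Finset.HasAntidiagonal.mem_antidiagonal.2 (by simp only; omega)) h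
  -- The chain rule yields a factor `ε`, so expanding `Φ'` to order `Q` gives order `Q + 1`. The
  -- case of order `0` follows because the term `q = 0` vanishes.
  have key : ∀ Q : ℕ, (fun ε => deriv (radial Φ ε) s - kernelExpansion (taylorCoeffZero Φ) (Q + 1)
      (fun i => if i = 1 then 1 else 0) (fun j => s ^ j) ε) =O[𝓝 0] fun ε => ε ^ (Q + 1) := by
    intro Q
    have hdΦ : ContDiffAt ℝ ∞ (deriv Φ) 0 := by
      have h1 : ContDiffAt ℝ ∞ (fderiv ℝ Φ) 0 := hΦ.fderiv_right (by simp)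
      exact (h1.clm_apply contDiffAt_const).congr_of_eventuallyEq (f₁ := deriv Φ)
        (f := fun x => fderiv ℝ Φ x 1) (by filter_upwards with x; simp)
    have ht : Tendsto (fun ε : ℝ => ε * s ^ 2) (𝓝 0) (𝓝 0) := by
      simpa using (continuous_mul_const (s ^ 2)).tendsto (0 : ℝ)
    have h := (hdΦ.taylor_isBigO Q).comp_tendsto ht
    have h2 : ((fun r : ℝ => r ^ Q) ∘ fun ε : ℝ => ε * s ^ 2) =O[𝓝 0] fun ε => ε ^ Q := by
      simp only [Function.comp_def, mul_pow _ _ Q]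
      simp_rw [mul_comm _ ((s ^ 2) ^ Q)]
      exact (isBigO_refl _ _).const_mul_left _
    have h3 := (h.trans h2).mul (((isBigO_refl (fun ε : ℝ => ε) (𝓝 0)).const_mul_left (2 * s)))
    refine h3.congr' ?_ (by filter_upwards with ε; rw [pow_succ])
    have hdiff : ∀ᶠ r in 𝓝 (0 : ℝ), DifferentiableAt ℝ Φ r := by
      have h1 : ContDiffAt ℝ (1 : ℕ) Φ 0 := hΦ.of_le (by exact_mod_cast le_top)
      filter_upwards [h1.eventually (by simp)] with r hr
      exact hr.differentiableAt (by simp)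
    filter_upwards [ht.eventually hdiff] with ε hε
    have hd : HasDerivAt (radial Φ ε) (deriv Φ (ε * s ^ 2) * (ε * (2 * s))) s := by
      have h4 : HasDerivAt (fun x : ℝ => ε * x ^ 2) (ε * (2 * s)) s := by
        simpa using (hasDerivAt_pow 2 s).const_mul ε
      exact hε.hasDerivAt.comp s h4
    rw [hd.deriv, kernelExpansion, Finset.sum_range_succ']
    rw [hinner 0, if_pos rfl, mul_zero, add_zero]
    simp only [hinner, Function.comp, sub_mul, Finset.sum_mul, Nat.succ_ne_zero, if_false]
    congr 1
    · ring
    · refine Finset.sum_congr rfl fun q _ => ?_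
      have hfac : (q.factorial : ℝ) ≠ 0 := by exact_mod_cast q.factorial_ne_zero
      rw [← iteratedDeriv_succ', taylorCoeffZero, Nat.factorial_succ,
        show 2 * (q + 1) - 1 = 2 * q + 1 by omega]
      push_cast
      field_simp
      ring
  rcases Q with _ | Q
  · refine ((key 0).trans (isBigO_pow_pow_nhds_zero (Nat.zero_le _))).congr_left fun ε => ?_
    simp [kernelExpansion]
  · exact key Q

theorem symmetricMoments_pow {m : ℕ} {τ : Fin m → ℝ} (hinj : Function.Injective τ)
    (hrev : ∀ l, τ l.rev = - τ l) : SymmetricMoments fun l i => τ l ^ i where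
  det_ne_zero := Matrix.det_vandermonde_ne_zero_iff.2 hinj
  rev l i := by rw [hrev, neg_pow]

/-- A polynomial of degree at most `2 n + 1` that vanishes at `-n, …, n` and has a double root at `0`
is zero. -/
theorem polynomial_eq_zero_of_double_root {n : ℕ} {F : Polynomial ℝ} (hdeg : F.natDegree ≤ 2 * n + 1)
    (hroot : ∀ i : Fin (2 * n + 1), F.eval ((i : ℝ) - n) = 0) (h1 : F.coeff 1 = 0) : F = 0 := by
  have h0 : F.coeff 0 = 0 := by
    have := hroot ⟨n, by omega⟩
    simpa [Polynomial.coeff_zero_eq_eval_zero] using this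
  obtain ⟨G, rfl⟩ : Polynomial.X ^ 2 ∣ F := Polynomial.X_pow_dvd_iff.2 fun d hd => by
    interval_cases d <;> assumption
  by_cases hG : G = 0
  · simp [hG]
  have hGdeg : G.natDegree + 2 ≤ 2 * n + 1 := by
    rw [Polynomial.natDegree_mul (by simp) hG, Polynomial.natDegree_X_pow] at hdeg
    omega
  exfalso
  apply hG
  refine Polynomial.eq_zero_of_natDegree_lt_card_of_eval_eq_zero G
    (ι := {i : Fin (2 * n + 1) // (i : ℕ) ≠ n}) (f := fun i => ((i.1 : ℕ) : ℝ) - n) ?_ ?_ ?_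
  · intro i j hij
    have : ((i.1 : ℕ) : ℝ) = ((j.1 : ℕ) : ℝ) := by simpa using hij
    exact Subtype.ext (Fin.ext (by exact_mod_cast this))
  · rintro ⟨i, hi⟩
    have h2 := hroot i
    rw [Polynomial.eval_mul, Polynomial.eval_pow, Polynomial.eval_X] at h2
    refine (mul_eq_zero.1 h2).resolve_left (pow_ne_zero _ ?_)
    rw [sub_ne_zero]
    exact_mod_cast hi
  · have : Fintype.card {i : Fin (2 * n + 1) // (i : ℕ) ≠ n} = 2 * n := by
      have h3 := Fintype.card_subtype_compl (fun i : Fin (2 * n + 1) => (i : ℕ) = n)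
      have h4 : Fintype.card {i : Fin (2 * n + 1) // (i : ℕ) = n} = 1 := by
        rw [Fintype.card_eq_one_iff]
        exact ⟨⟨⟨n, by omega⟩, rfl⟩, fun y => Subtype.ext (Fin.ext y.2)⟩
      rw [h4] at h3
      simpa using h3
    rw [this]
    omega

theorem eventually_continuousAt_of_contDiffAt {Φ : ℝ → ℝ} (hΦ : ContDiffAt ℝ ∞ Φ 0) :
    ∀ᶠ r in 𝓝 (0 : ℝ), ContinuousAt Φ r := by
  have h1 : ContDiffAt ℝ (1 : ℕ) Φ 0 := hΦ.of_le (by exact_mod_cast le_top)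
  filter_upwards [h1.eventually (by simp)] with r hr
  exact hr.continuousAt

/-- For small `ε` the scaled profile is continuous on a given bounded interval. -/
theorem exists_continuousOn_radial {Φ : ℝ → ℝ} (hΦ : ContDiffAt ℝ ∞ Φ 0) (R : ℝ) :
    ∀ᶠ ε in 𝓝 (0 : ℝ), ContinuousOn (radial Φ ε) (Set.Icc (-R) R) := by
  obtain ⟨δ, hδ, h⟩ := Metric.eventually_nhds_iff.1 (eventually_continuousAt_of_contDiffAt hΦ)
  have ht : Tendsto (fun ε : ℝ => |ε| * R ^ 2) (𝓝 0) (𝓝 0) := by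
    have : Continuous fun ε : ℝ => |ε| * R ^ 2 := by fun_prop
    simpa using this.tendsto 0
  filter_upwards [ht.eventually (gt_mem_nhds hδ)] with ε hε x hx
  refine ContinuousAt.continuousWithinAt ?_
  refine ContinuousAt.comp (g := Φ) (f := fun x : ℝ => ε * x ^ 2) (h ?_) (by fun_prop)
  rw [Real.dist_eq, sub_zero, abs_mul, abs_pow]
  refine lt_of_le_of_lt ?_ hε
  gcongr
  exact abs_le.2 hx

/-- The pointwise Taylor estimate is uniform on the bounded interval of integration and can be
integrated; small `ε` keeps the argument of `Φ` in the neighbourhood where `Φ` is controlled. -/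
theorem integral_radial_expansion {Φ : ℝ → ℝ} (hΦ : ContDiffAt ℝ ∞ Φ 0) (a c s : ℝ) (Q : ℕ) :
    (fun ε => (∫ t in a..c, radial Φ ε (t + s)) - kernelExpansion (taylorCoeffZero Φ) Q
      (fun i => ∫ t in a..c, t ^ i) (fun j => s ^ j) ε) =O[𝓝 0] fun ε => ε ^ Q := by
  set R := |a| + |c| + |s| with hR
  have hmem : ∀ t ∈ Set.uIcc a c, t + s ∈ Set.Icc (-R) R := by
    intro t ht
    have h1 : |t| ≤ |a| + |c| := by
      have h2 := abs_nonneg a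
      have h3 := abs_nonneg c
      have h4 := abs_le.1 (le_refl |a|)
      have h5 := abs_le.1 (le_refl |c|)
      rw [abs_le]
      rcases Set.mem_uIcc.1 ht with ⟨h, h'⟩ | ⟨h, h'⟩ <;> constructor <;> linarith
    rw [Set.mem_Icc, ← abs_le]
    exact (abs_add_le t s).trans (by linarith)
  obtain ⟨C, hC⟩ := (hΦ.taylor_isBigO Q).bound
  obtain ⟨δ, hδ, hT⟩ := Metric.eventually_nhds_iff.1 hC
  have ht : Tendsto (fun ε : ℝ => |ε| * R ^ 2) (𝓝 0) (𝓝 0) := by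
    have : Continuous fun ε : ℝ => |ε| * R ^ 2 := by fun_prop
    simpa using this.tendsto 0
  refine IsBigO.of_bound (|C| * (R ^ 2) ^ Q * |c - a|) ?_
  filter_upwards [ht.eventually (gt_mem_nhds hδ), exists_continuousOn_radial hΦ R] with ε hε hcont
  have hK : kernelExpansion (taylorCoeffZero Φ) Q (fun i => ∫ t in a..c, t ^ i) (fun j => s ^ j) ε =
      ∫ t in a..c, kernelExpansion (taylorCoeffZero Φ) Q (fun i => t ^ i) (fun j => s ^ j) ε := by
    simp only [kernelExpansion]
    rw [intervalIntegral.integral_finsetSum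
      (fun q _ => Continuous.intervalIntegrable (by fun_prop) _ _)]
    refine Finset.sum_congr rfl fun q _ => ?_
    rw [intervalIntegral.integral_const_mul, intervalIntegral.integral_finsetSum
      (fun x _ => Continuous.intervalIntegrable (by fun_prop) _ _)]
    congr 1
    refine Finset.sum_congr rfl fun x _ => ?_
    rw [intervalIntegral.integral_mul_const, intervalIntegral.integral_const_mul]
  rw [hK, ← intervalIntegral.integral_sub]
  · refine (intervalIntegral.norm_integral_le_of_norm_le_const (C := |C| * (R ^ 2) ^ Q * |ε| ^ Q)
      fun t ht' => ?_).trans (by rw [norm_pow, Real.norm_eq_abs]; exact le_of_eq (by ring))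
    have hts := hmem t (Set.uIoc_subset_uIcc ht')
    have habs : |ε * (t + s) ^ 2| ≤ |ε| * R ^ 2 := by
      rw [abs_mul, abs_pow]
      gcongr
      exact abs_le.2 hts
    have h1 := hT (y := ε * (t + s) ^ 2) (by rw [Real.dist_eq, sub_zero]; exact habs.trans_lt hε)
    rw [kernelExpansion_pow]
    refine (h1.trans ?_)
    rw [norm_pow, Real.norm_eq_abs]
    calc C * |ε * (t + s) ^ 2| ^ Q ≤ |C| * (|ε| * R ^ 2) ^ Q := by gcongr; exact le_abs_self C
      _ = _ := by rw [mul_pow]; ring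
  · refine ContinuousOn.intervalIntegrable ?_
    exact hcont.comp (by fun_prop) hmem
  · refine Continuous.intervalIntegrable ?_ _ _
    simp only [kernelExpansion]
    fun_prop

/-- Collocation matrix of the primitive-function reconstruction on the unit grid. -/
noncomputable def primitiveMatrix (Φ : ℝ → ℝ) (n : ℕ) (ε : ℝ) :
    Matrix (Fin (2 * n + 1)) (Fin (2 * n + 1)) ℝ :=
  Matrix.of fun i k => radial Φ ε (((i : ℝ) - n) + -((k : ℝ) - n))

noncomputable def primitiveRow (Φ : ℝ → ℝ) (n : ℕ) (ε : ℝ) (k : Fin (2 * n + 1)) : ℝ :=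
  deriv (radial Φ ε) (-((k : ℝ) - n))

/-- Collocation matrix of the direct reconstruction on the unit grid. -/
noncomputable def directMatrix (Φ : ℝ → ℝ) (n : ℕ) (ε : ℝ) :
    Matrix (Fin (2 * n)) (Fin (2 * n)) ℝ :=
  Matrix.of fun l k => ∫ t in ((l : ℝ) - n)..((l : ℝ) + 1 - n),
    radial Φ ε (t + -((k : ℝ) - n + 1 / 2))

noncomputable def directRow (Φ : ℝ → ℝ) (n : ℕ) (ε : ℝ) (k : Fin (2 * n)) : ℝ :=
  radial Φ ε (-((k : ℝ) - n + 1 / 2))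

noncomputable def cellMoment (n : ℕ) (l : Fin (2 * n)) (i : ℕ) : ℝ :=
  ∫ t in ((l : ℝ) - n)..((l : ℝ) + 1 - n), t ^ i

theorem radial_neg (Φ : ℝ → ℝ) (ε x : ℝ) : radial Φ ε (-x) = radial Φ ε x := by
  simp [radial]

theorem deriv_radial_neg (Φ : ℝ → ℝ) (ε x : ℝ) :
    deriv (radial Φ ε) (-x) = - deriv (radial Φ ε) x := by
  have h := deriv_comp_neg (radial Φ ε) x
  rw [show (fun x => radial Φ ε (-x)) = radial Φ ε from funext (radial_neg Φ ε)] at h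
  linarith

theorem cast_rev_interface {n : ℕ} (l : Fin (2 * n + 1)) :
    ((l.rev : ℕ) : ℝ) - n = -((l : ℝ) - n) := by
  rw [Fin.val_rev, Nat.cast_sub (by omega)]
  push_cast
  ring

theorem cast_rev_cell {n : ℕ} (l : Fin (2 * n)) :
    ((l.rev : ℕ) : ℝ) = 2 * n - 1 - l := by
  rw [Fin.val_rev, Nat.cast_sub (by omega)]
  push_cast
  ring

theorem cellMoment_eq (n : ℕ) (l : Fin (2 * n)) (i : ℕ) :
    cellMoment n l i = (((l : ℝ) + 1 - n) ^ (i + 1) - ((l : ℝ) - n) ^ (i + 1)) / (i + 1) := by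
  rw [cellMoment, integral_pow]

/-- The primitive with zero constant term of the polynomial `∑ i < D, c i t ^ i`. -/
noncomputable def primitivePoly (D : ℕ) (c : ℕ → ℝ) : Polynomial ℝ :=
  ∑ i ∈ Finset.range D, Polynomial.C (c i / (i + 1)) * Polynomial.X ^ (i + 1)

theorem coeff_primitivePoly_succ {D : ℕ} {c : ℕ → ℝ} {j : ℕ} (hj : j < D) :
    (primitivePoly D c).coeff (j + 1) = c j / (j + 1) := by
  rw [primitivePoly, Polynomial.finsetSum_coeff, Finset.sum_eq_single j]
  · simp
  · intro b _ hb
    rw [Polynomial.coeff_C_mul_X_pow, if_neg (by omega)]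
  · intro h; exact absurd (Finset.mem_range.2 hj) h

theorem natDegree_primitivePoly_le (D : ℕ) (c : ℕ → ℝ) : (primitivePoly D c).natDegree ≤ D :=
  Polynomial.natDegree_sum_le_of_forall_le _ _ fun _ hi =>
    (Polynomial.natDegree_C_mul_X_pow_le _ _).trans (Finset.mem_range.1 hi)

/-- Each vanishing cell average is a difference of the primitive at neighbouring interfaces. The
primitive is thus constant on the interfaces, and it is zero at the central one. -/
theorem eval_primitivePoly_eq_zero {n D : ℕ} {c : ℕ → ℝ}
    (h : ∀ l : Fin (2 * n), ∑ i ∈ Finset.range D, c i * cellMoment n l i = 0)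
    (j : Fin (2 * n + 1)) : (primitivePoly D c).eval ((j : ℝ) - n) = 0 := by
  have hstep : ∀ j : ℕ, j ≤ 2 * n →
      (primitivePoly D c).eval ((j : ℝ) - n) = (primitivePoly D c).eval (-(n : ℝ)) := by
    intro j
    induction j with
    | zero => intro _; simp
    | succ j ih =>
      intro hj
      rw [← ih (by omega), ← sub_eq_zero, ← h ⟨j, by omega⟩]
      simp only [primitivePoly, Polynomial.eval_finsetSum, Polynomial.eval_mul, Polynomial.eval_C,
        Polynomial.eval_pow, Polynomial.eval_X, ← Finset.sum_sub_distrib, cellMoment_eq]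
      refine Finset.sum_congr rfl fun i _ => ?_
      push_cast
      ring
  rw [hstep j (by omega), ← hstep n (by omega)]
  simp [primitivePoly, Polynomial.eval_finsetSum]

/-- If a polynomial of degree below `2 n` has zero averages, its primitive has degree at most `2 n`
and `2 n + 1` zeros at the interfaces. -/
theorem symmetricMoments_cellMoment (n : ℕ) : SymmetricMoments (cellMoment n) where
  det_ne_zero := by
    intro h0
    obtain ⟨a, ha, hM⟩ := Matrix.exists_mulVec_eq_zero_iff.2 h0
    apply ha
    set c : ℕ → ℝ := fun i => if h : i < 2 * n then a ⟨i, h⟩ else 0 with hc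
    have hF : primitivePoly (2 * n) c = 0 := by
      refine Polynomial.eq_zero_of_natDegree_lt_card_of_eval_eq_zero _
        (f := fun j : Fin (2 * n + 1) => (j : ℝ) - n) ?_ (eval_primitivePoly_eq_zero fun l => ?_) ?_
      · intro i j hij
        exact Fin.ext (by exact_mod_cast (by simpa using hij : ((i : ℕ) : ℝ) = (j : ℕ)))
      · have h1 := congrFun hM l
        simp only [Matrix.mulVec, dotProduct, Matrix.of_apply, Pi.zero_apply] at h1
        rw [← Fin.sum_univ_eq_sum_range (fun i => c i * cellMoment n l i), ← h1]
        refine Finset.sum_congr rfl fun i _ => ?_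
        simp only [hc, dif_pos i.2]
        ring
      · have := natDegree_primitivePoly_le (2 * n) c
        simp only [Fintype.card_fin]
        omega
    ext i
    have h1 := coeff_primitivePoly_succ (c := c) i.2
    rw [hF, Polynomial.coeff_zero] at h1
    have h2 : ((i : ℕ) : ℝ) + 1 ≠ 0 := by positivity
    rw [eq_comm, div_eq_zero_iff, or_iff_left h2] at h1
    simpa [hc] using h1
  rev l i := by
    rw [cellMoment_eq, cellMoment_eq, cast_rev_cell]
    rw [show (2 * (n : ℝ) - 1 - l + 1 - n) = -(l - n) by ring,
      show (2 * (n : ℝ) - 1 - l - n) = -(l + 1 - n) by ring, neg_pow, neg_pow ((l : ℝ) + 1 - n),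
      pow_succ (-1 : ℝ)]
    ring

/-- What the two reconstructions share: weights with the moments of a formula that is exact up to
`γ k ε ^ (n - k)`. -/
structure MomentExpansion {m : ℕ} (n v : ℕ) (b : ℕ → ℝ) (ℓ : Fin m → ℕ → ℝ)
    (A : ℝ → Matrix (Fin m) (Fin m) ℝ) (r : ℝ → Fin m → ℝ) (γ : ℕ → ℝ) : Prop where
  ne_zero : γ n ≠ 0
  hankel : ∀ l < n, ∑ k ∈ Finset.range (n + 1),
    γ k * ((2 * (k + l + v)).factorial * b (k + l + v)) = 0
  det : ∀ᶠ ε in 𝓝[≠] 0, (A ε).det ≠ 0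
  bounded : ∀ l, (fun ε => (r ε ᵥ* (A ε)⁻¹) l) =O[𝓝[≠] 0] fun _ => (1 : ℝ)
  odd : ∀ᶠ ε in 𝓝[≠] 0, ∀ i, ¬ Even (i + v) → ∑ l, (r ε ᵥ* (A ε)⁻¹) l * ℓ l i = 0
  even : ∀ k ≤ n, (fun ε => ∑ l, (r ε ᵥ* (A ε)⁻¹) l * ℓ l (2 * k + v) - (if k = 0 then 1 else 0) -
    (2 * k + v).factorial * γ k * ε ^ (n - k)) =O[𝓝[≠] 0] fun ε => ε ^ (n - k + 1)

theorem exists_momentExpansion_direct {Φ : ℝ → ℝ} (hΦ : IsSmoothRBF Φ) {n : ℕ} (hn : 1 ≤ n) :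
    ∃ γ, MomentExpansion n 0 (taylorCoeffZero Φ) (cellMoment n) (directMatrix Φ n) (directRow Φ n)
      γ := by
  have hrevnode : ∀ k : Fin (2 * n), -(((k.rev : ℕ) : ℝ) - n + 1 / 2) = -(-((k : ℝ) - n + 1 / 2)) :=
    fun k => by rw [cast_rev_cell]; ring
  refine Exists.imp (fun γ ⟨h1, h2, h3, h4, h5, h6⟩ => ⟨h1, h2, h3, h4, h5, h6⟩)
    (exists_moment_expansion (n := n) (v := 0) (m := 2 * n) hn
    zero_le_one rfl (det_leadingCoeff_ne_zero hΦ (by omega)) (symmetricMoments_cellMoment n)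
    (σ := fun k j => (-((k : ℝ) - n + 1 / 2)) ^ j)
    (symmetricMoments_pow (fun i j hij =>
      Fin.ext (by exact_mod_cast (by simpa using hij : ((i : ℕ) : ℝ) = (j : ℕ)))) hrevnode)
    (A := directMatrix Φ n) (r := directRow Φ n) ?_
    (fun l k Q => integral_radial_expansion hΦ.smooth _ _ _ Q) ?_ ?_ ?_)
  · intro a ha ha0
    -- These are the coefficients of the interpolant minus `t ^ (2 n)`, which has zero cell
    -- averages. If its constant term vanished, its primitive would have a double root at `0`.
    set c : ℕ → ℝ := fun i => if h : i < 2 * n then a ⟨i, h⟩ else -1 with hc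
    have hF : primitivePoly (2 * n + 1) c = 0 := by
      refine polynomial_eq_zero_of_double_root (natDegree_primitivePoly_le _ _)
        (eval_primitivePoly_eq_zero fun l => ?_) ?_
      · rw [Finset.sum_range_succ, ← Fin.sum_univ_eq_sum_range (fun i => c i * cellMoment n l i)]
        have : ∑ i : Fin (2 * n), c i * cellMoment n l i = cellMoment n l (2 * n) := by
          rw [ha l]
          refine Finset.sum_congr rfl fun i _ => ?_
          simp only [hc, dif_pos i.2]
          ring
        rw [this]
        simp [hc]
      · rw [coeff_primitivePoly_succ (by omega : 0 < 2 * n + 1)]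
        simp only [hc, dif_pos (show 0 < 2 * n by omega), ha0]
        simp
    have h1 := coeff_primitivePoly_succ (c := c) (Nat.lt_succ_self (2 * n))
    rw [hF, Polynomial.coeff_zero] at h1
    have h2 : ((2 * n : ℕ) : ℝ) + 1 ≠ 0 := by positivity
    rw [eq_comm, div_eq_zero_iff, or_iff_left h2] at h1
    simp [hc] at h1
  · intro k Q
    refine (radial_expansion hΦ.smooth 0 (-((k : ℝ) - n + 1 / 2)) Q).congr_left fun ε => ?_
    simp only [zero_add, directRow, zero_pow_eq]
  · intro ε l k
    simp only [directMatrix, Matrix.of_apply]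
    rw [hrevnode, cast_rev_cell, show (2 * (n : ℝ) - 1 - l + 1 - n) = -(l - n) by ring,
      show (2 * (n : ℝ) - 1 - l - n) = -(l + 1 - n) by ring, ← intervalIntegral.integral_comp_neg]
    refine intervalIntegral.integral_congr fun t _ => ?_
    rw [← neg_add, radial_neg]
  · intro ε k
    simp only [directRow, hrevnode, radial_neg, pow_zero, one_mul]

theorem exists_momentExpansion_primitive {Φ : ℝ → ℝ} (hΦ : IsSmoothRBF Φ) {n : ℕ} (hn : 1 ≤ n) :
    ∃ γ, MomentExpansion n 1 (taylorCoeffZero Φ)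
      (fun (i : Fin (2 * n + 1)) j => ((i : ℝ) - n) ^ j) (primitiveMatrix Φ n)
      (primitiveRow Φ n) γ := by
  have hinj : Function.Injective fun i : Fin (2 * n + 1) => ((i : ℝ) - n) := fun i j hij =>
    Fin.ext (by exact_mod_cast (by simpa using hij : ((i : ℕ) : ℝ) = (j : ℕ)))
  refine Exists.imp (fun γ ⟨h1, h2, h3, h4, h5, h6⟩ => ⟨h1, h2, h3, h4, h5, h6⟩)
    (exists_moment_expansion (n := n) (v := 1) (m := 2 * n + 1) hn
    le_rfl rfl (det_leadingCoeff_ne_zero hΦ (by omega))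
    (symmetricMoments_pow hinj cast_rev_interface)
    (σ := fun k j => (-((k : ℝ) - n)) ^ j)
    (symmetricMoments_pow (fun i j hij => hinj (neg_injective hij))
      (fun l => by rw [cast_rev_interface]))
    (A := primitiveMatrix Φ n) (r := primitiveRow Φ n) ?_
    (fun l k Q => radial_expansion hΦ.smooth _ _ Q)
    (fun k Q => deriv_radial_expansion hΦ.smooth _ Q) ?_ ?_)
  · intro a ha ha0
    -- The interpolant minus `t ^ (2 n + 1)` vanishes at every interface; `a 1 = 0` makes its root
    -- at `0` double.
    set F : Polynomial ℝ := ∑ i : Fin (2 * n + 1), Polynomial.C (a i) * Polynomial.X ^ (i : ℕ) -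
      Polynomial.X ^ (2 * n + 1) with hF
    have hcoeff : ∀ j : Fin (2 * n + 1), F.coeff j = a j := by
      intro j
      rw [hF, Polynomial.coeff_sub, Polynomial.finsetSum_coeff, Finset.sum_eq_single j]
      · rw [Polynomial.coeff_X_pow, if_neg (by omega)]; simp
      · intro b _ hb
        rw [Polynomial.coeff_C_mul_X_pow, if_neg (fun h => hb (Fin.ext h.symm))]
      · simp
    have hF0 : F = 0 := by
      refine polynomial_eq_zero_of_double_root (n := n) ?_ (fun i => ?_) ?_
      · refine (Polynomial.natDegree_sub_le _ _).trans (max_le ?_ (by simp))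
        exact Polynomial.natDegree_sum_le_of_forall_le _ _ fun i _ =>
          (Polynomial.natDegree_C_mul_X_pow_le _ _).trans i.2.le
      · simp only [hF, Polynomial.eval_sub, Polynomial.eval_finsetSum, Polynomial.eval_mul,
          Polynomial.eval_C, Polynomial.eval_pow, Polynomial.eval_X]
        rw [ha i, sub_eq_zero]
        exact Finset.sum_congr rfl fun j _ => mul_comm _ _
      · exact (hcoeff ⟨1, by omega⟩).trans ha0
    have h1 : F.coeff (2 * n + 1) = -1 := by
      rw [hF, Polynomial.coeff_sub, Polynomial.finsetSum_coeff, Finset.sum_eq_zero]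
      · simp
      · intro i _
        rw [Polynomial.coeff_C_mul_X_pow, if_neg (by omega)]
    rw [hF0, Polynomial.coeff_zero] at h1
    norm_num at h1
  · intro ε l k
    simp only [primitiveMatrix, Matrix.of_apply, cast_rev_interface]
    rw [← neg_add, radial_neg]
  · intro ε k
    simp only [primitiveRow, cast_rev_interface, deriv_radial_neg _ _ (-((k : ℝ) - n)), pow_one]
    ring

/-! ### From moments to the error of the formula. -/

theorem MomentExpansion.exists_bounds {m n v : ℕ} {b : ℕ → ℝ} {ℓ : Fin m → ℕ → ℝ}
    {A : ℝ → Matrix (Fin m) (Fin m) ℝ} {r : ℝ → Fin m → ℝ} {γ : ℕ → ℝ}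
    (h : MomentExpansion n v b ℓ A r γ) :
    ∃ C ε₀ : ℝ, 0 ≤ C ∧ 0 < ε₀ ∧ ∀ ε : ℝ, ε ≠ 0 → |ε| < ε₀ → (A ε).det ≠ 0 ∧
      (∀ l, |(r ε ᵥ* (A ε)⁻¹) l| ≤ C) ∧
      (∀ i, ¬ Even (i + v) → ∑ l, (r ε ᵥ* (A ε)⁻¹) l * ℓ l i = 0) ∧
      ∀ k ≤ n, |∑ l, (r ε ᵥ* (A ε)⁻¹) l * ℓ l (2 * k + v) - (if k = 0 then 1 else 0) -
        (2 * k + v).factorial * γ k * ε ^ (n - k)| ≤ C * |ε| ^ (n - k + 1) := by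
  choose C₁ hC₁ using fun l => (h.bounded l).bound
  choose C₂ hC₂ using fun k : Fin (n + 1) => (h.even k (Nat.le_of_lt_succ k.2)).bound
  have hev := (h.det.and (eventually_all.2 hC₁)).and (h.odd.and (eventually_all.2 hC₂))
  rw [eventually_nhdsWithin_iff] at hev
  obtain ⟨ε₀, hε₀, hε⟩ := Metric.eventually_nhds_iff.1 hev
  have hle₁ : ∀ l, C₁ l ≤ ∑ l, |C₁ l| + ∑ k, |C₂ k| := fun l =>
    (le_abs_self _).trans ((Finset.single_le_sum (f := fun l => |C₁ l|) (fun _ _ => abs_nonneg _)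
      (Finset.mem_univ l)).trans (le_add_of_nonneg_right (by positivity)))
  have hle₂ : ∀ k, C₂ k ≤ ∑ l, |C₁ l| + ∑ k, |C₂ k| := fun k =>
    (le_abs_self _).trans ((Finset.single_le_sum (f := fun k => |C₂ k|) (fun _ _ => abs_nonneg _)
      (Finset.mem_univ k)).trans (le_add_of_nonneg_left (by positivity)))
  refine ⟨∑ l, |C₁ l| + ∑ k, |C₂ k|, ε₀, by positivity, hε₀, fun ε hne hlt => ?_⟩
  obtain ⟨⟨h1, h2⟩, h3, h4⟩ := hε (y := ε) (by simpa using hlt) hne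
  refine ⟨h1, fun l => ?_, h3, fun k hk => ?_⟩
  · have := h2 l
    simp only [Real.norm_eq_abs, abs_one, mul_one] at this
    exact this.trans (hle₁ l)
  · have := h4 ⟨k, Nat.lt_succ_of_le hk⟩
    simp only [Real.norm_eq_abs, abs_pow] at this
    refine this.trans ?_
    gcongr
    exact hle₂ _

/-- The error of a formula with a moment expansion, applied to data with Taylor coefficients `a`. -/
theorem MomentExpansion.exists_error_bound {m n v : ℕ} {b : ℕ → ℝ} {ℓ : Fin m → ℕ → ℝ}
    {A : ℝ → Matrix (Fin m) (Fin m) ℝ} {r : ℝ → Fin m → ℝ} {γ : ℕ → ℝ} (hv : v ≤ 1)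
    (hexp : MomentExpansion n v b ℓ A r γ) {M a₀ d₀ : ℝ} (hM : 0 ≤ M) (ha₀ : 0 ≤ a₀) :
    ∃ C h₀ : ℝ, 0 < h₀ ∧ ∀ h : ℝ, 0 < h → h < h₀ → ∀ μ : ℝ, μ ≠ 0 → |μ| ≤ M →
      (A (μ * h ^ 2)).det ≠ 0 ∧
      ∀ a : ℕ → ℝ, (∀ i ≤ 2 * n, |a i| ≤ a₀) → ∀ (κ : ℝ) (d : Fin m → ℝ), (v = 1 ∨ κ = 0) →
        (∀ l, |d l - (∑ i ∈ Finset.range (2 * n + 2),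
          a i * h ^ i / (i + v).factorial * ℓ l (i + v) + κ * ℓ l 0)| ≤ d₀ * h ^ (2 * n + 2)) →
        |∑ l, (r (μ * h ^ 2) ᵥ* (A (μ * h ^ 2))⁻¹) l * d l -
          (a 0 + h ^ (2 * n) * ∑ k ∈ Finset.range (n + 1), γ k * a (2 * k) * μ ^ (n - k))|
          ≤ C * h ^ (2 * n + 2) := by
  obtain ⟨C, ε₀, hC, hε₀, hb⟩ := hexp.exists_bounds
  refine ⟨m * (C * d₀) + ∑ k ∈ Finset.range (n + 1), a₀ * (C * M ^ (n - k + 1)),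
    -- With `h < 1` one has `|μ| h² ≤ M h < ε₀`.
    min 1 (ε₀ / (M + 1)), by positivity, fun h hh hlt μ hμ hμM => ?_⟩
  have hh1 : h < 1 := hlt.trans_le (min_le_left _ _)
  have hhε : h * (M + 1) < ε₀ := (lt_div_iff₀ (by positivity)).1 (hlt.trans_le (min_le_right _ _))
  set ε := μ * h ^ 2 with hε
  have hεabs : |ε| = |μ| * h ^ 2 := by rw [hε, abs_mul, abs_of_pos (pow_pos hh 2)]
  have hεlt : |ε| < ε₀ := by
    rw [hεabs]
    calc |μ| * h ^ 2 ≤ M * h := by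
          gcongr
          nlinarith
      _ ≤ h * (M + 1) := by nlinarith
      _ < ε₀ := hhε
  obtain ⟨hdet, hw, hodd, heven⟩ := hb ε (mul_ne_zero hμ (pow_ne_zero 2 hh.ne')) hεlt
  refine ⟨hdet, fun a ha κ d hκ hd => ?_⟩
  set w := r ε ᵥ* (A ε)⁻¹ with hwdef
  set e : Fin m → ℝ := fun l => d l - (∑ i ∈ Finset.range (2 * n + 2),
          a i * h ^ i / (i + v).factorial * ℓ l (i + v) + κ * ℓ l 0) with he
  set η : ℕ → ℝ := fun k => ∑ l, w l * ℓ l (2 * k + v) - (if k = 0 then 1 else 0) -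
        (2 * k + v).factorial * γ k * ε ^ (n - k) with hη
  have hfac : ∀ k : ℕ, (k.factorial : ℝ) ≠ 0 := fun k => by exact_mod_cast k.factorial_ne_zero
  -- The term `κ` is a constant of integration; for `v = 1` the moment of degree `0` has the wrong
  -- parity and vanishes.
  have hκ0 : κ * ∑ l, w l * ℓ l 0 = 0 := by
    rcases hκ with rfl | rfl
    · rw [hodd 0 (by simp), mul_zero]
    · rw [zero_mul]
  have hsum : ∑ l, w l * d l = ∑ l, w l * e l +
      ∑ i ∈ Finset.range (2 * n + 2), a i * h ^ i / (i + v).factorial * ∑ l, w l * ℓ l (i + v) := by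
    have h1 : ∀ l, w l * d l = w l * e l + (∑ i ∈ Finset.range (2 * n + 2),
        a i * h ^ i / (i + v).factorial * (w l * ℓ l (i + v)) + κ * (w l * ℓ l 0)) := by
      intro l
      have h2 : ∑ i ∈ Finset.range (2 * n + 2), a i * h ^ i / (i + v).factorial *
          (w l * ℓ l (i + v)) = w l * ∑ i ∈ Finset.range (2 * n + 2),
          a i * h ^ i / (i + v).factorial * ℓ l (i + v) := by
        rw [Finset.mul_sum]
        exact Finset.sum_congr rfl fun i _ => by ring
      rw [h2]
      simp only [he]
      ring
    simp only [h1, Finset.sum_add_distrib, ← Finset.mul_sum, hκ0, add_zero]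
    rw [Finset.sum_comm]
    simp only [← Finset.mul_sum]
  have hpar : ∑ i ∈ Finset.range (2 * n + 2), a i * h ^ i / (i + v).factorial *
      ∑ l, w l * ℓ l (i + v) = ∑ k ∈ Finset.range (n + 1),
      a (2 * k) * h ^ (2 * k) / (2 * k + v).factorial * ∑ l, w l * ℓ l (2 * k + v) := by
    have := sum_range_of_parity (n := n + 1) (v := 0) zero_le_one (f := fun i =>
      a i * h ^ i / (i + v).factorial * ∑ l, w l * ℓ l (i + v)) (fun i hi => by
        rw [hodd (i + v) (by
          rw [Nat.even_iff] at *
          omega), mul_zero])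
    simpa [mul_add] using this
  -- After cancellation of the leading terms only the errors `e` of the data and `η` of the moments
  -- remain; each contributes `O(h ^ (2 n + 2))`.
  have hmain : ∑ l, w l * d l -
      (a 0 + h ^ (2 * n) * ∑ k ∈ Finset.range (n + 1), γ k * a (2 * k) * μ ^ (n - k)) =
      ∑ l, w l * e l + ∑ k ∈ Finset.range (n + 1),
        a (2 * k) * h ^ (2 * k) / (2 * k + v).factorial * η k := by
    rw [hsum, hpar]
    have h1 : a 0 = ∑ k ∈ Finset.range (n + 1),
        a (2 * k) * h ^ (2 * k) / (2 * k + v).factorial * if k = 0 then 1 else 0 := by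
      simp only [mul_ite, mul_one, mul_zero, Finset.sum_ite_eq', Finset.mem_range,
        if_pos (Nat.succ_pos n), pow_zero]
      interval_cases v <;> simp
    have h2 : h ^ (2 * n) * ∑ k ∈ Finset.range (n + 1), γ k * a (2 * k) * μ ^ (n - k) =
        ∑ k ∈ Finset.range (n + 1), a (2 * k) * h ^ (2 * k) / (2 * k + v).factorial *
          ((2 * k + v).factorial * γ k * ε ^ (n - k)) := by
      rw [Finset.mul_sum]
      refine Finset.sum_congr rfl fun k hk => ?_
      have hk : k ≤ n := Nat.le_of_lt_succ (Finset.mem_range.1 hk)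
      have h3 : h ^ (2 * n) = h ^ (2 * k) * (h ^ 2) ^ (n - k) := by
        rw [← pow_mul, ← pow_add]
        congr 1
        omega
      have := hfac (2 * k + v)
      rw [h3, hε, mul_pow]
      field_simp
    rw [h2]
    conv_lhs => rw [h1]
    rw [add_sub_assoc, ← Finset.sum_add_distrib, ← Finset.sum_sub_distrib]
    congr 1
    refine Finset.sum_congr rfl fun k _ => ?_
    simp only [hη]
    ring
  rw [hmain]
  refine (abs_add_le _ _).trans ?_
  rw [add_mul]
  refine add_le_add ?_ ?_
  · refine (Finset.abs_sum_le_sum_abs _ _).trans ?_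
    refine (Finset.sum_le_card_nsmul _ _ (C * (d₀ * h ^ (2 * n + 2))) fun l _ => ?_).trans ?_
    · rw [abs_mul]
      exact mul_le_mul (hw l) (hd l) (abs_nonneg _) hC
    · simp only [Finset.card_univ, Fintype.card_fin, nsmul_eq_mul]
      exact le_of_eq (by ring)
  · rw [Finset.sum_mul]
    refine (Finset.abs_sum_le_sum_abs _ _).trans (Finset.sum_le_sum fun k hk => ?_)
    have hk : k ≤ n := Nat.le_of_lt_succ (Finset.mem_range.1 hk)
    have h1 : (1 : ℝ) ≤ (2 * k + v).factorial := by
      exact_mod_cast Nat.one_le_iff_ne_zero.2 (Nat.factorial_ne_zero _)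
    have h2 : |a (2 * k) * h ^ (2 * k) / (2 * k + v).factorial| ≤ a₀ * h ^ (2 * k) := by
      rw [abs_div, abs_mul, Nat.abs_cast, abs_of_pos (pow_pos hh _)]
      refine (div_le_self (by positivity) h1).trans ?_
      gcongr
      exact ha _ (by omega)
    have h3 : |η k| ≤ C * (M ^ (n - k + 1) * (h ^ 2) ^ (n - k + 1)) := by
      refine (heven k hk).trans ?_
      rw [hεabs, mul_pow]
      gcongr
    rw [abs_mul]
    refine (mul_le_mul h2 h3 (abs_nonneg _) (by positivity)).trans (le_of_eq ?_)
    have h4 : h ^ (2 * n + 2) = h ^ (2 * k) * (h ^ 2) ^ (n - k + 1) := by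
      rw [← pow_mul, ← pow_add]
      congr 1
      omega
    rw [h4]
    ring

/-! ### Reduction to the unit grid and expansion of the data. -/

theorem existsUnique_mulVec {m : ℕ} {A : Matrix (Fin m) (Fin m) ℝ} (hA : A.det ≠ 0)
    (d : Fin m → ℝ) : ∃! α, A *ᵥ α = d := by
  refine ⟨A⁻¹ *ᵥ d, ?_, fun α hα => ?_⟩
  · simp only [Matrix.mulVec_mulVec, Matrix.mul_nonsing_inv _ (isUnit_iff_ne_zero.2 hA),
      Matrix.one_mulVec]
  · rw [← hα, Matrix.mulVec_mulVec, Matrix.nonsing_inv_mul _ (isUnit_iff_ne_zero.2 hA),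
      Matrix.one_mulVec]

theorem dotProduct_eq_of_mulVec_eq {m : ℕ} {A : Matrix (Fin m) (Fin m) ℝ} (hA : A.det ≠ 0)
    {α d : Fin m → ℝ} (r : Fin m → ℝ) (h : A *ᵥ α = d) :
    ∑ k, α k * r k = ∑ l, (r ᵥ* A⁻¹) l * d l := by
  have : (r ᵥ* A⁻¹) ⬝ᵥ d = r ⬝ᵥ α := by
    rw [← h, Matrix.dotProduct_mulVec, Matrix.vecMul_vecMul,
      Matrix.nonsing_inv_mul _ (isUnit_iff_ne_zero.2 hA), Matrix.vecMul_one]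
  change _ = (r ᵥ* A⁻¹) ⬝ᵥ d
  rw [this, dotProduct]
  exact Finset.sum_congr rfl fun k _ => mul_comm _ _

theorem radial_scale (Φ : ℝ → ℝ) (μ h t : ℝ) : radial Φ μ (h * t) = radial Φ (μ * h ^ 2) t := by
  simp only [radial]
  congr 1
  ring

theorem deriv_radial_scale (Φ : ℝ → ℝ) (μ h t : ℝ) :
    h * deriv (radial Φ μ) (h * t) = deriv (radial Φ (μ * h ^ 2)) t := by
  have h1 := deriv_comp_mul_left h (radial Φ μ) t
  rw [show (fun t => radial Φ μ (h * t)) = radial Φ (μ * h ^ 2) from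
    funext fun t => radial_scale Φ μ h t] at h1
  rw [h1, smul_eq_mul]

theorem isSolution_primitive_iff {Φ : ℝ → ℝ} {μ x h : ℝ} {n : ℕ} {ubar : Fin (2 * n) → ℝ}
    {α : Fin (2 * n + 1) → ℝ} : Reconstruction.primitive.IsSolution Φ μ x h n ubar α ↔
      primitiveMatrix Φ n (μ * h ^ 2) *ᵥ α = fun i : Fin (2 * n + 1) => primitiveData h n ubar i := by
  rw [funext_iff]
  refine forall_congr' fun i => ?_
  rw [show (primitiveMatrix Φ n (μ * h ^ 2) *ᵥ α) i =
    rbfSum Φ μ (fun k : Fin (2 * n + 1) => interface x h n k) α (interface x h n i) from ?_]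
  rw [rbfSum, Matrix.mulVec, dotProduct]
  refine Finset.sum_congr rfl fun k _ => ?_
  rw [primitiveMatrix, Matrix.of_apply, ← radial_scale, mul_comm]
  congr 2
  simp only [interface]
  ring

theorem value_primitive {Φ : ℝ → ℝ} {μ x h : ℝ} (hh : h ≠ 0) {n : ℕ} (α : Fin (2 * n + 1) → ℝ) :
    Reconstruction.primitive.value Φ μ x h n α =
      (∑ k, α k * primitiveRow Φ n (μ * h ^ 2) k) / h := by
  change rbfDerivSum Φ μ (fun k : Fin (2 * n + 1) => interface x h n k) α x = _
  rw [rbfDerivSum, Finset.sum_div]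
  refine Finset.sum_congr rfl fun k _ => ?_
  rw [primitiveRow, ← deriv_radial_scale, show x - interface x h n k = h * -((k : ℝ) - n) by
    simp only [interface]; ring]
  field_simp

theorem value_direct {Φ : ℝ → ℝ} {μ x h : ℝ} {n : ℕ} (α : Fin (2 * n) → ℝ) :
    Reconstruction.direct.value Φ μ x h n α = ∑ k, α k * directRow Φ n (μ * h ^ 2) k := by
  change rbfSum Φ μ (fun k : Fin (2 * n) => cellCenter x h n k) α x = _
  refine Finset.sum_congr rfl fun k _ => ?_
  rw [directRow, ← radial_scale]
  congr 2
  simp only [cellCenter]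
  ring

theorem cellAvg_eq_integral {f : ℝ → ℝ} {x h : ℝ} (hh : h ≠ 0) (n l : ℕ) :
    cellAvg f x h n l = ∫ t in ((l : ℝ) - n)..((l : ℝ) + 1 - n), f (x + h * t) := by
  rw [intervalIntegral.integral_comp_add_mul _ hh, cellAvg, one_div, smul_eq_mul]
  congr 2
  · simp only [interface]; ring
  · simp only [interface]; push_cast; ring

theorem abs_le_of_mem_cell {n : ℕ} {l : ℕ} (hl : l < 2 * n) {t : ℝ}
    (ht : t ∈ Set.uIcc ((l : ℝ) - n) ((l : ℝ) + 1 - n)) : |t| ≤ n := by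
  rw [Set.uIcc_of_le (by linarith)] at ht
  have h1 : (l : ℝ) + 1 ≤ 2 * n := by exact_mod_cast hl
  have h2 : (0 : ℝ) ≤ l := Nat.cast_nonneg l
  rw [abs_le]
  exact ⟨by linarith [ht.1], by linarith [ht.2]⟩

/-- Exchanging sum and integral requires integrability, and `Φ` is regular only near `0` in general.
Points of cells lie in `[-n, n]` and so do the centres, hence continuity on `[-2 n, 2 n]` suffices.
-/
theorem isSolution_direct_iff {Φ : ℝ → ℝ} {μ x h : ℝ} (hh : h ≠ 0) {n : ℕ}
    {ubar : Fin (2 * n) → ℝ}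
    (hcont : ContinuousOn (radial Φ (μ * h ^ 2)) (Set.Icc (-(2 * n)) (2 * n)))
    {α : Fin (2 * n) → ℝ} : Reconstruction.direct.IsSolution Φ μ x h n ubar α ↔
      directMatrix Φ n (μ * h ^ 2) *ᵥ α = ubar := by
  rw [funext_iff]
  refine forall_congr' fun l => ?_
  rw [show cellAvg (rbfSum Φ μ (fun k : Fin (2 * n) => cellCenter x h n k) α) x h n l =
    (directMatrix Φ n (μ * h ^ 2) *ᵥ α) l from ?_]
  have hmem : ∀ k : Fin (2 * n), ∀ t ∈ Set.uIcc ((l : ℝ) - n) ((l : ℝ) + 1 - n),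
      t + -((k : ℝ) - n + 1 / 2) ∈ Set.Icc (-(2 * (n : ℝ))) (2 * n) := by
    intro k t ht
    have h1 := abs_le.1 (abs_le_of_mem_cell l.2 ht)
    have h2 : (k : ℝ) + 1 ≤ 2 * n := by exact_mod_cast k.2
    have h3 : (0 : ℝ) ≤ (k : ℕ) := Nat.cast_nonneg _
    constructor <;> linarith [h1.1, h1.2]
  have hterm : ∀ (k : Fin (2 * n)) (t : ℝ), radial Φ μ (x + h * t - cellCenter x h n k) =
      radial Φ (μ * h ^ 2) (t + -((k : ℝ) - n + 1 / 2)) := by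
    intro k t
    rw [← radial_scale]
    congr 1
    simp only [cellCenter]
    ring
  rw [cellAvg_eq_integral hh]
  simp only [rbfSum, hterm]
  have hint : ∀ k : Fin (2 * n), IntervalIntegrable (fun t =>
      α k * radial Φ (μ * h ^ 2) (t + -((k : ℝ) - n + 1 / 2))) MeasureTheory.volume
      ((l : ℝ) - n) ((l : ℝ) + 1 - n) := fun k =>
    (ContinuousOn.intervalIntegrable (hcont.comp (by fun_prop) (hmem k))).const_mul _
  rw [intervalIntegral.integral_finsetSum fun k _ => hint k]
  simp only [intervalIntegral.integral_const_mul, Matrix.mulVec, dotProduct, directMatrix,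
    Matrix.of_apply]
  exact Finset.sum_congr rfl fun k _ => mul_comm _ _

/-- Cell averages of a smooth function, expanded about the central interface. -/
theorem exists_cellAvg_bound {Ω K : Set ℝ} {u : ℝ → ℝ} (n : ℕ) (hΩ : IsOpen Ω)
    (hu : ContDiffOn ℝ ∞ u Ω) (hK : IsCompact K) (hKΩ : K ⊆ Ω) :
    ∃ C h₀ : ℝ, 0 ≤ C ∧ 0 < h₀ ∧ ∀ x ∈ K, ∀ h : ℝ, 0 < h → h < h₀ →
      Set.Icc (x - n * h) (x + n * h) ⊆ Ω ∧ ∀ l : Fin (2 * n),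
        |cellAvg u x h n l - ∑ i ∈ Finset.range (2 * n + 2),
          iteratedDeriv i u x * h ^ i / i.factorial * cellMoment n l i| ≤ C * h ^ (2 * n + 2) := by
  obtain ⟨C, δ, hC, hδ, hT⟩ := exists_uniform_taylor_bound (2 * n + 1) hΩ
    (contDiffOn_infty.1 hu _) hK hKΩ
  -- The power of `n` comes from `|t| ≤ n` on the stencil; the bound on `h` gives `n h ≤ δ`.
  refine ⟨C * n ^ (2 * n + 2), δ / (n + 1), by positivity, by positivity, fun x hx h hh hlt => ?_⟩
  obtain ⟨hsub, hT⟩ := hT x hx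
  have hnh : n * h ≤ δ := by
    rw [lt_div_iff₀ (by positivity)] at hlt
    nlinarith
  have hsub' : Set.Icc (x - n * h) (x + n * h) ⊆ Set.Icc (x - δ) (x + δ) :=
    Set.Icc_subset_Icc (by linarith) (by linarith)
  refine ⟨hsub'.trans hsub, fun l => ?_⟩
  have hmem : ∀ t ∈ Set.uIcc ((l : ℝ) - n) ((l : ℝ) + 1 - n), x + h * t ∈
      Set.Icc (x - n * h) (x + n * h) := by
    intro t ht
    have h1 := abs_le.1 (abs_le_of_mem_cell l.2 ht)
    constructor <;> nlinarith [h1.1, h1.2]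
  rw [cellAvg_eq_integral hh.ne']
  have hpoly : ∑ i ∈ Finset.range (2 * n + 2),
      iteratedDeriv i u x * h ^ i / i.factorial * cellMoment n l i =
      ∫ t in ((l : ℝ) - n)..((l : ℝ) + 1 - n), ∑ i ∈ Finset.range (2 * n + 2),
        iteratedDeriv i u x / i.factorial * (x + h * t - x) ^ i := by
    rw [intervalIntegral.integral_finsetSum
      fun i _ => Continuous.intervalIntegrable (by fun_prop) _ _]
    refine Finset.sum_congr rfl fun i _ => ?_
    rw [cellMoment, ← intervalIntegral.integral_const_mul]
    refine intervalIntegral.integral_congr fun t _ => ?_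
    simp only [add_sub_cancel_left, mul_pow]
    ring
  rw [hpoly, ← intervalIntegral.integral_sub, ← Real.norm_eq_abs]
  · refine (intervalIntegral.norm_integral_le_of_norm_le_const
      (C := C * n ^ (2 * n + 2) * h ^ (2 * n + 2)) fun t ht => ?_).trans (le_of_eq ?_)
    · have ht' := Set.uIoc_subset_uIcc ht
      refine (hT _ (hsub' (hmem t ht'))).trans ?_
      rw [add_sub_cancel_left, abs_mul, abs_of_pos hh, mul_comm h, mul_pow, ← mul_assoc]
      gcongr
      exact abs_le_of_mem_cell l.2 ht'
    · rw [show (l : ℝ) + 1 - n - (l - n) = 1 by ring]; simp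
  · refine ContinuousOn.intervalIntegrable ?_
    exact (hu.continuousOn.mono (hsub'.trans hsub)).comp (by fun_prop) hmem
  · exact Continuous.intervalIntegrable (by fun_prop) _ _

theorem sum_cellMoment_lt (n : ℕ) (j : ℕ) {i : ℕ} (hi : i ≤ 2 * n) :
    (∑ l : Fin (2 * n), if (l : ℕ) < i then cellMoment n l j else 0) =
      (((i : ℝ) - n) ^ (j + 1) - (-(n : ℝ)) ^ (j + 1)) / (j + 1) := by
  set f : ℕ → ℝ := fun l => (((l : ℝ) + 1 - n) ^ (j + 1) - ((l : ℝ) - n) ^ (j + 1)) / (j + 1)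
  have h1 : (∑ l : Fin (2 * n), if (l : ℕ) < i then cellMoment n l j else 0) =
      ∑ l ∈ Finset.range (2 * n), if l < i then f l else 0 := by
    rw [← Fin.sum_univ_eq_sum_range (fun l => if l < i then f l else 0)]
    exact Finset.sum_congr rfl fun l _ => by rw [cellMoment_eq]
  rw [h1, ← Finset.sum_filter, show (Finset.range (2 * n)).filter (· < i) = Finset.range i by
    ext l; simp only [Finset.mem_filter, Finset.mem_range]; omega]
  have := Finset.sum_range_sub (fun l : ℕ => ((l : ℝ) - n) ^ (j + 1) / (j + 1)) i
  simp only [Nat.cast_zero, zero_sub] at this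
  rw [sub_div, ← this]
  refine Finset.sum_congr rfl fun l _ => ?_
  simp only [f]
  push_cast
  rw [sub_div]

/-- Partial sums of cell moments telescope to values of the monomial primitives. Moving the base
point to `x - h`, that is `t = -1`, adds a term independent of the interface. Each of the two
partial sums contains at most `2 n` cell errors, whence `4 n E`. -/
theorem primitiveData_error {n : ℕ} (hn : 1 ≤ n) {h E : ℝ} (hh : h ≠ 0) {a : ℕ → ℝ} {D : ℕ}
    {ubar : Fin (2 * n) → ℝ}
    (hE : ∀ l, |ubar l - ∑ j ∈ Finset.range D, a j * h ^ j / j.factorial * cellMoment n l j| ≤ E)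
    (i : Fin (2 * n + 1)) :
    |primitiveData h n ubar i / h - (∑ j ∈ Finset.range D,
      a j * h ^ j / (j + 1).factorial * ((i : ℝ) - n) ^ (j + 1) +
      -∑ j ∈ Finset.range D, a j * h ^ j / (j + 1).factorial * (-1) ^ (j + 1))| ≤ 4 * n * E := by
  set e : Fin (2 * n) → ℝ := fun l =>
    ubar l - ∑ j ∈ Finset.range D, a j * h ^ j / j.factorial * cellMoment n l j with he
  have hsum : ∀ i : ℕ, i ≤ 2 * n → (∑ l : Fin (2 * n), if (l : ℕ) < i then ubar l else 0) =
      (∑ l : Fin (2 * n), if (l : ℕ) < i then e l else 0) + ∑ j ∈ Finset.range D,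
        a j * h ^ j / (j + 1).factorial * (((i : ℝ) - n) ^ (j + 1) - (-(n : ℝ)) ^ (j + 1)) := by
    intro i hi
    have h1 : ∀ j : ℕ, a j * h ^ j / (j + 1).factorial *
        (((i : ℝ) - n) ^ (j + 1) - (-(n : ℝ)) ^ (j + 1)) = a j * h ^ j / j.factorial *
        ∑ l : Fin (2 * n), if (l : ℕ) < i then cellMoment n l j else 0 := by
      intro j
      have : (j.factorial : ℝ) ≠ 0 := by exact_mod_cast j.factorial_ne_zero
      rw [sum_cellMoment_lt n j hi, Nat.factorial_succ]
      push_cast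
      field_simp
    simp only [h1, Finset.mul_sum]
    rw [Finset.sum_comm, ← Finset.sum_add_distrib]
    refine Finset.sum_congr rfl fun l _ => ?_
    split_ifs
    · simp [he]
    · simp
  have hbound : ∀ i : ℕ, |∑ l : Fin (2 * n), if (l : ℕ) < i then e l else 0| ≤ 2 * n * E := by
    intro i
    refine (Finset.abs_sum_le_sum_abs _ _).trans
      ((Finset.sum_le_card_nsmul _ _ E fun l _ => ?_).trans (by simp))
    split_ifs
    · exact hE l
    · rw [abs_zero]; exact (abs_nonneg _).trans (hE l)
  have hn1 : (((n - 1 : ℕ) : ℝ) - n) = -1 := by rw [Nat.cast_sub hn]; simp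
  have hcond : (∑ l : Fin (2 * n), if (l : ℕ) + 1 < n then ubar l else 0) =
      ∑ l : Fin (2 * n), if (l : ℕ) < n - 1 then ubar l else 0 :=
    Finset.sum_congr rfl fun l _ => if_congr (by omega) rfl rfl
  rw [primitiveData, mul_div_cancel_left₀ _ hh, hcond, hsum i (by omega), hsum (n - 1) (by omega), hn1]
  simp only [mul_sub, Finset.sum_sub_distrib]
  have h1 := abs_le.1 (hbound i)
  have h2 := abs_le.1 (hbound (n - 1))
  rw [abs_le]
  constructor <;> linarith [h1.1, h1.2, h2.1, h2.2]

/-! ### Error expansion and tuned shape parameters. -/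

/-- Order of the derivative of the approximant that is the reconstructed value. -/
def Reconstruction.derivOrder : Reconstruction → ℕ
  | .direct => 0
  | .primitive => 1

/-- The expansion of the reconstructed value, uniformly for `x ∈ K` and `|μ| ≤ M`. -/
def Reconstruction.HasErrorExpansion (A : Reconstruction) (Φ : ℝ → ℝ) (n : ℕ) (γ : ℕ → ℝ)
    (Ω : Set ℝ) (u : ℝ → ℝ) (K : Set ℝ) (M : ℝ) : Prop :=
  ∃ C h₀ : ℝ, 0 < h₀ ∧ ∀ x ∈ K, ∀ h : ℝ, 0 < h → h < h₀ → ∀ μ : ℝ, μ ≠ 0 → |μ| ≤ M →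
    Set.Icc (x - n * h) (x + n * h) ⊆ Ω ∧
    A.IsAccurate Φ μ x h n u (u x + h ^ (2 * n) * errorCoeff γ n u x μ) (C * h ^ (2 * n + 2))

theorem hasErrorExpansion_direct {Φ : ℝ → ℝ} (hΦ : IsSmoothRBF Φ) {n : ℕ} {γ : ℕ → ℝ}
    (hγ : MomentExpansion n 0 (taylorCoeffZero Φ) (cellMoment n) (directMatrix Φ n) (directRow Φ n) γ)
    {Ω : Set ℝ} {u : ℝ → ℝ} {K : Set ℝ} (hΩ : IsOpen Ω) (hu : ContDiffOn ℝ ∞ u Ω)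
    (hK : IsCompact K) (hKΩ : K ⊆ Ω) (M : ℝ) :
    Reconstruction.direct.HasErrorExpansion Φ n γ Ω u K M := by
  obtain ⟨C₁, h₁, -, hh₁, hcell⟩ := exists_cellAvg_bound n hΩ hu hK hKΩ
  obtain ⟨B, hB0, hB⟩ := exists_abs_iteratedDeriv_le hΩ (contDiffOn_infty.1 hu (2 * n)) hK hKΩ
  obtain ⟨C, h₂, hh₂, herr⟩ := hγ.exists_error_bound zero_le_one (M := |M|) (a₀ := B) (d₀ := C₁)
    (abs_nonneg M) hB0
  obtain ⟨δ, hδ, hcont⟩ := Metric.eventually_nhds_iff.1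
    (exists_continuousOn_radial hΦ.smooth (2 * n))
  -- The last two bounds make `|μ| h² < δ`, so that the scaled profile is continuous on the range of
  -- the arguments.
  refine ⟨C, min (min h₁ h₂) (min 1 (δ / (|M| + 1))), by positivity,
    fun x hx h hh hlt μ hμ hμM => ?_⟩
  simp only [lt_min_iff] at hlt
  obtain ⟨⟨hlt₁, hlt₂⟩, hlt3, hlt4⟩ := hlt
  rw [lt_div_iff₀ (by positivity)] at hlt4
  have hμM' : |μ| ≤ |M| := hμM.trans (le_abs_self M)
  obtain ⟨hsub, hav⟩ := hcell x hx h hh hlt₁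
  obtain ⟨hdet, herr⟩ := herr h hh hlt₂ μ hμ hμM'
  have hε : dist (μ * h ^ 2) 0 < δ := by
    rw [Real.dist_eq, sub_zero, abs_mul, abs_of_pos (pow_pos hh 2)]
    have : |μ| * h ^ 2 ≤ |M| * h := by
      gcongr
      nlinarith
    nlinarith
  refine ⟨hsub, ?_, fun α hα => ?_⟩
  · exact (existsUnique_congr fun α => isSolution_direct_iff hh.ne' (hcont hε)).2
      (existsUnique_mulVec hdet _)
  · rw [value_direct (n := n) α, dotProduct_eq_of_mulVec_eq hdet _
      ((isSolution_direct_iff hh.ne' (hcont hε)).1 hα)]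
    have := herr (fun i => iteratedDeriv i u x) (fun i hi => hB i hi x hx) 0 _ (Or.inr rfl)
      (fun l => by simpa using hav l)
    simpa only [iteratedDeriv_zero, errorCoeff] using this

theorem hasErrorExpansion_primitive {Φ : ℝ → ℝ} {n : ℕ} (hn : 1 ≤ n) {γ : ℕ → ℝ}
    (hγ : MomentExpansion n 1 (taylorCoeffZero Φ)
      (fun (i : Fin (2 * n + 1)) j => ((i : ℝ) - n) ^ j) (primitiveMatrix Φ n)
      (primitiveRow Φ n) γ)
    {Ω : Set ℝ} {u : ℝ → ℝ} {K : Set ℝ} (hΩ : IsOpen Ω) (hu : ContDiffOn ℝ ∞ u Ω)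
    (hK : IsCompact K) (hKΩ : K ⊆ Ω) (M : ℝ) :
    Reconstruction.primitive.HasErrorExpansion Φ n γ Ω u K M := by
  obtain ⟨C₁, h₁, -, hh₁, hcell⟩ := exists_cellAvg_bound n hΩ hu hK hKΩ
  obtain ⟨B, hB0, hB⟩ := exists_abs_iteratedDeriv_le hΩ (contDiffOn_infty.1 hu (2 * n)) hK hKΩ
  obtain ⟨C, h₂, hh₂, herr⟩ := hγ.exists_error_bound le_rfl (M := |M|) (a₀ := B)
    (d₀ := 4 * n * C₁) (abs_nonneg M) hB0
  refine ⟨C, min h₁ h₂, by positivity, fun x hx h hh hlt μ hμ hμM => ?_⟩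
  simp only [lt_min_iff] at hlt
  obtain ⟨hlt₁, hlt₂⟩ := hlt
  obtain ⟨hsub, hav⟩ := hcell x hx h hh hlt₁
  obtain ⟨hdet, herr⟩ := herr h hh hlt₂ μ hμ (hμM.trans (le_abs_self M))
  refine ⟨hsub, ?_, fun α hα => ?_⟩
  · exact (existsUnique_congr fun α => isSolution_primitive_iff).2 (existsUnique_mulVec hdet _)
  · rw [value_primitive hh.ne' (n := n) α, dotProduct_eq_of_mulVec_eq hdet _
      (isSolution_primitive_iff.1 hα), Finset.sum_div]
    simp only [mul_div_assoc]
    -- Here `κ` is minus the scaled Taylor primitive at the base point `t = -1`.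
    have := herr (fun i => iteratedDeriv i u x) (fun i hi => hB i hi x hx)
      (-∑ j ∈ Finset.range (2 * n + 2),
        iteratedDeriv j u x * h ^ j / (j + 1).factorial * (-1) ^ (j + 1))
      (fun i => primitiveData h n (fun l => cellAvg u x h n l) i / h) (Or.inl rfl)
      (fun i => by
        have := primitiveData_error hn hh.ne' hav i
        rw [mul_assoc (4 * (n : ℝ)), pow_zero, mul_one]
        exact this)
    simpa only [iteratedDeriv_zero, errorCoeff] using this

/-- The Hankel relations are kept alongside the expansion because they identify the coefficients for
the Gaussian later. -/
theorem exists_errorExpansion {Φ : ℝ → ℝ} (hΦ : IsSmoothRBF Φ) (A : Reconstruction) {n : ℕ}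
    (hn : 1 ≤ n) : ∃ γ : ℕ → ℝ, γ n ≠ 0 ∧
      (∀ l < n, ∑ k ∈ Finset.range (n + 1), γ k * ((2 * (k + l + A.derivOrder)).factorial *
        taylorCoeffZero Φ (k + l + A.derivOrder)) = 0) ∧
      ∀ (Ω : Set ℝ) (u : ℝ → ℝ) (K : Set ℝ), IsOpen Ω → ContDiffOn ℝ ∞ u Ω → IsCompact K →
        K ⊆ Ω → ∀ M, A.HasErrorExpansion Φ n γ Ω u K M := by
  cases A with
  | direct =>
    obtain ⟨γ, hγ⟩ := exists_momentExpansion_direct hΦ hn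
    exact ⟨γ, hγ.ne_zero, hγ.hankel, fun Ω u K hΩ hu hK hKΩ =>
      hasErrorExpansion_direct hΦ hγ hΩ hu hK hKΩ⟩
  | primitive =>
    obtain ⟨γ, hγ⟩ := exists_momentExpansion_primitive hΦ hn
    exact ⟨γ, hγ.ne_zero, hγ.hankel, fun Ω u K hΩ hu hK hKΩ =>
      hasErrorExpansion_primitive hn hγ hΩ hu hK hKΩ⟩

theorem exists_errorCoeff_lipschitz (γ : ℕ → ℝ) (n : ℕ) {u : ℝ → ℝ} {K : Set ℝ} {B M : ℝ}
    (hB0 : 0 ≤ B) (hM : 0 ≤ M) (hB : ∀ i ≤ 2 * n, ∀ x ∈ K, |iteratedDeriv i u x| ≤ B) :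
    ∃ L : ℝ, 0 ≤ L ∧ ∀ x ∈ K, ∀ μ μ₀ : ℝ, |μ| ≤ M → |μ₀| ≤ M →
      |errorCoeff γ n u x μ - errorCoeff γ n u x μ₀| ≤ L * |μ - μ₀| := by
  refine ⟨∑ k ∈ Finset.range (n + 1), |γ k| * B * ((n - k : ℕ) * M ^ (n - k - 1)), by positivity,
    fun x hx μ μ₀ hμ hμ₀ => ?_⟩
  rw [errorCoeff, errorCoeff, ← Finset.sum_sub_distrib, Finset.sum_mul]
  refine (Finset.abs_sum_le_sum_abs _ _).trans (Finset.sum_le_sum fun k hk => ?_)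
  have hk := Finset.mem_range.1 hk
  rw [← mul_sub, abs_mul, abs_mul, mul_assoc _ _ |μ - μ₀|]
  gcongr
  · exact hB _ (by omega) x hx
  · refine (abs_pow_sub_pow_le μ μ₀ (n - k)).trans ?_
    rw [mul_assoc, mul_comm]
    gcongr
    exact max_le hμ hμ₀

/-- A shape parameter within `O(h ^ p)` of a root of the leading error coefficient raises the order
by `p`. -/
theorem order_of_near_root {A : Reconstruction} {Φ : ℝ → ℝ} {n : ℕ} {γ : ℕ → ℝ} {Ω : Set ℝ}
    {u : ℝ → ℝ} {K : Set ℝ} (hΩ : IsOpen Ω) (hu : ContDiffOn ℝ ∞ u Ω) (hK : IsCompact K)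
    (hKΩ : K ⊆ Ω) (hexp : ∀ M, A.HasErrorExpansion Φ n γ Ω u K M) (M : ℝ) {p : ℝ} (hp0 : 0 ≤ p)
    (hp2 : p ≤ 2) (c : ℝ) : ∃ C h₀ : ℝ, 0 < h₀ ∧ ∀ x ∈ K, ∀ h : ℝ, 0 < h → h < h₀ →
      ∀ μ μ₀ : ℝ, μ ≠ 0 → |μ₀| ≤ M → errorCoeff γ n u x μ₀ = 0 → |μ - μ₀| ≤ c * h ^ p →
        Set.Icc (x - n * h) (x + n * h) ⊆ Ω ∧
        A.IsAccurate Φ μ x h n u (u x) (C * h ^ (2 * (n : ℝ) + p)) := by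
  obtain ⟨B, hB0, hB⟩ := exists_abs_iteratedDeriv_le hΩ (contDiffOn_infty.1 hu (2 * n)) hK hKΩ
  -- For `h < 1` a parameter within `c h ^ p` of a root bounded by `M` is itself bounded by `|M| +
  -- |c|`.
  obtain ⟨C, h₀, hh₀, hexp⟩ := hexp (|M| + |c|)
  obtain ⟨L, hL0, hL⟩ := exists_errorCoeff_lipschitz γ n hB0
    (M := |M| + |c|) (by positivity) hB
  refine ⟨|C| + L * |c|, min h₀ 1, by positivity, fun x hx h hh hlt μ μ₀ hμ hμ₀ hroot hnear => ?_⟩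
  obtain ⟨hlt, hlt1⟩ := lt_min_iff.1 hlt
  have hhp : h ^ p ≤ 1 := Real.rpow_le_one hh.le hlt1.le hp0
  have hhp0 : 0 < h ^ p := Real.rpow_pos_of_pos hh p
  have hch : c * h ^ p ≤ |c| * h ^ p := by gcongr; exact le_abs_self c
  have hμ₀' : |μ₀| ≤ |M| + |c| := by linarith [le_abs_self M, abs_nonneg c]
  have hμ' : |μ| ≤ |M| + |c| := by
    have h1 : |μ| ≤ |μ₀| + |μ - μ₀| := by
      have := abs_add_le μ₀ (μ - μ₀)
      rwa [add_sub_cancel] at this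
    have h2 : |c| * h ^ p ≤ |c| := mul_le_of_le_one_right (abs_nonneg c) hhp
    linarith [le_abs_self M]
  obtain ⟨hsub, hex, hval⟩ := hexp x hx h hh hlt μ hμ hμ'
  refine ⟨hsub, hex, fun α hα => ?_⟩
  have h1 := hval α hα
  have h2 : |errorCoeff γ n u x μ| ≤ L * (|c| * h ^ p) := by
    have := hL x hx μ μ₀ hμ' hμ₀'
    rw [hroot, sub_zero] at this
    refine this.trans ?_
    gcongr
    exact hnear.trans hch
  have hpow : h ^ (2 * (n : ℝ) + p) = h ^ (2 * n) * h ^ p := by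
    rw [Real.rpow_add hh]
    congr 1
    exact_mod_cast Real.rpow_natCast h (2 * n)
  have hpow2 : h ^ (2 * n + 2) ≤ h ^ (2 * n) * h ^ p := by
    rw [pow_add]
    gcongr
    have := Real.rpow_le_rpow_of_exponent_ge hh hlt1.le hp2
    rwa [Real.rpow_two] at this
  have h3 : |A.value Φ μ x h n α - u x| ≤ C * h ^ (2 * n + 2) +
      h ^ (2 * n) * |errorCoeff γ n u x μ| := by
    have := abs_add_le (A.value Φ μ x h n α - (u x + h ^ (2 * n) * errorCoeff γ n u x μ))
      (h ^ (2 * n) * errorCoeff γ n u x μ)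
    rw [abs_mul, abs_of_pos (pow_pos hh _)] at this
    rw [show A.value Φ μ x h n α - u x = A.value Φ μ x h n α -
      (u x + h ^ (2 * n) * errorCoeff γ n u x μ) + h ^ (2 * n) * errorCoeff γ n u x μ by ring]
    linarith
  have hpos : 0 < h ^ (2 * n) := pow_pos hh _
  calc |A.value Φ μ x h n α - u x| ≤ |C| * (h ^ (2 * n) * h ^ p) +
        h ^ (2 * n) * (L * (|c| * h ^ p)) := by
        refine h3.trans (add_le_add ?_ ?_)
        · refine (mul_le_mul_of_nonneg_right (le_abs_self C) (by positivity)).trans ?_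
          gcongr
        · gcongr
    _ = (|C| + L * |c|) * h ^ (2 * (n : ℝ) + p) := by rw [hpow]; ring

/-! ### The Gaussian: unique solvability and positive definiteness. -/

theorem radial_gaussianProfile (ε y : ℝ) : radial gaussianProfile ε y = Real.exp (-(ε * y ^ 2)) := rfl

theorem continuous_radial_gaussianProfile (ε : ℝ) : Continuous (radial gaussianProfile ε) := by
  simp only [funext (radial_gaussianProfile ε)]
  fun_prop

/-- A combination of `N` equispaced Gaussians of the same shape with `N` zeros is trivial. -/
theorem gaussian_sum_eq_zero {N : ℕ} {ε a : ℝ} (hε : ε ≠ 0) {α t : Fin N → ℝ}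
    (ht : Function.Injective t)
    (h : ∀ i, ∑ k : Fin N, α k * radial gaussianProfile ε (t i + -((k : ℝ) - a)) = 0) : α = 0 := by
  have hinj : Function.Injective fun i => Real.exp (2 * ε * t i) := fun i j hij =>
    ht (mul_left_cancel₀ (mul_ne_zero two_ne_zero hε) (Real.exp_injective hij))
  -- Expanding the square leaves a factor that depends on `t i` only, one that depends on `k` only,
  -- and `exp (2 ε t i) ^ k`: a Vandermonde system with distinct nodes.
  have hβ : (fun k : Fin N => α k * Real.exp (-(ε * ((k : ℝ) - a) ^ 2))) = 0 := by
    refine Matrix.eq_zero_of_forall_index_sum_pow_mul_eq_zero hinj fun i => ?_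
    have h1 : ∀ k : Fin N, α k * radial gaussianProfile ε (t i + -((k : ℝ) - a)) =
        Real.exp (-(ε * t i ^ 2) - 2 * ε * t i * a) *
        (Real.exp (2 * ε * t i) ^ (k : ℕ) * (α k * Real.exp (-(ε * ((k : ℝ) - a) ^ 2)))) := by
      intro k
      rw [radial_gaussianProfile, ← Real.exp_nat_mul, mul_left_comm _ (α k), mul_left_comm _ (α k),
        ← Real.exp_add, ← Real.exp_add]
      congr 2
      ring
    have h2 := h i
    simp only [h1, ← Finset.mul_sum] at h2
    exact (mul_eq_zero.1 h2).resolve_left (Real.exp_ne_zero _)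
  ext k
  exact (mul_eq_zero.1 (congrFun hβ k)).resolve_right (Real.exp_ne_zero _)

theorem det_primitiveMatrix_gaussian_ne_zero (n : ℕ) {ε : ℝ} (hε : ε ≠ 0) :
    (primitiveMatrix gaussianProfile n ε).det ≠ 0 := by
  intro h0
  obtain ⟨α, hα, hM⟩ := Matrix.exists_mulVec_eq_zero_iff.2 h0
  refine hα (gaussian_sum_eq_zero (a := n) (t := fun i : Fin (2 * n + 1) => (i : ℝ) - n) hε
    (fun i j hij => Fin.ext (by exact_mod_cast (by simpa using hij : ((i : ℕ) : ℝ) = (j : ℕ))))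
    fun i => ?_)
  rw [← show (primitiveMatrix gaussianProfile n ε *ᵥ α) i = 0 from congrFun hM i]
  exact Finset.sum_congr rfl fun k _ => mul_comm _ _

theorem exists_eq_zero_of_integral_eq_zero {f : ℝ → ℝ} (hf : Continuous f) {a b : ℝ} (hab : a < b)
    (h : ∫ t in a..b, f t = 0) : ∃ t ∈ Set.Ioo a b, f t = 0 := by
  have hd : ∀ t, HasDerivAt (fun t => ∫ s in a..t, f s) (f t) t := fun t =>
    intervalIntegral.integral_hasDerivAt_right (hf.intervalIntegrable _ _)
      (hf.stronglyMeasurableAtFilter _ _) hf.continuousAt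
  exact exists_hasDerivAt_eq_zero hab (fun t _ => (hd t).continuousAt.continuousWithinAt)
    (by simp [h]) fun t _ => hd t

/-- A combination with zero averages on all cells has a zero inside each open cell. These are `2 n`
distinct zeros of a combination of `2 n` Gaussians. -/
theorem det_directMatrix_gaussian_ne_zero (n : ℕ) {ε : ℝ} (hε : ε ≠ 0) :
    (directMatrix gaussianProfile n ε).det ≠ 0 := by
  intro h0
  obtain ⟨α, hα, hM⟩ := Matrix.exists_mulVec_eq_zero_iff.2 h0
  set f : ℝ → ℝ := fun t => ∑ k : Fin (2 * n), α k *
    radial gaussianProfile ε (t + -((k : ℝ) - (n - 1 / 2))) with hf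
  have hcont := continuous_radial_gaussianProfile ε
  have hzero : ∀ l : Fin (2 * n), ∃ t ∈ Set.Ioo ((l : ℝ) - n) ((l : ℝ) + 1 - n), f t = 0 := by
    intro l
    refine exists_eq_zero_of_integral_eq_zero ?_ (by linarith) ?_
    · simp only [hf]
      fun_prop
    · simp only [hf]
      rw [intervalIntegral.integral_finsetSum
        fun k _ => Continuous.intervalIntegrable (by fun_prop) _ _]
      rw [← show (directMatrix gaussianProfile n ε *ᵥ α) l = 0 from congrFun hM l]
      refine Finset.sum_congr rfl fun k _ => ?_
      rw [intervalIntegral.integral_const_mul, mul_comm]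
      simp only [directMatrix, Matrix.of_apply, sub_sub_eq_add_sub, sub_add_eq_add_sub]
  choose t ht hft using hzero
  refine hα (gaussian_sum_eq_zero (a := n - 1 / 2) (t := t) hε (fun i j hij => ?_) hft)
  have hi := ht i
  have hj := ht j
  rw [hij] at hi
  have h1 : (i : ℝ) < (j : ℝ) + 1 := by linarith [hi.1, hj.2]
  have h2 : (j : ℝ) < (i : ℝ) + 1 := by linarith [hj.1, hi.2]
  have h1' : (i : ℕ) < (j : ℕ) + 1 := by exact_mod_cast h1
  have h2' : (j : ℕ) < (i : ℕ) + 1 := by exact_mod_cast h2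
  exact Fin.ext (by omega)

theorem existsUnique_isSolution_gaussian (A : Reconstruction) (n : ℕ) {μ x h : ℝ} (hμ : μ ≠ 0)
    (hh : h ≠ 0) (ubar : Fin (2 * n) → ℝ) :
    ∃! α, A.IsSolution gaussianProfile μ x h n ubar α := by
  have hε : μ * h ^ 2 ≠ 0 := mul_ne_zero hμ (pow_ne_zero 2 hh)
  cases A with
  | direct =>
    exact (existsUnique_congr fun α => isSolution_direct_iff hh
      (continuous_radial_gaussianProfile _).continuousOn).2
      (existsUnique_mulVec (det_directMatrix_gaussian_ne_zero n hε) _)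
  | primitive =>
    exact (existsUnique_congr fun α => isSolution_primitive_iff).2
      (existsUnique_mulVec (det_primitiveMatrix_gaussian_ne_zero n hε) _)

/-- Writing `exp (-(x - y)²)` as `exp (-x²) exp (-y²) exp (2 x y)` and expanding the last factor
turns the form into a series of weighted squares of moments; at distinct points these moments cannot
all vanish unless the coefficients do. -/
theorem isPositiveDefinite_gaussian : IsPositiveDefinite (radial gaussianProfile 1) := by
  refine ⟨continuous_radial_gaussianProfile 1, fun N x hx α hα => ?_⟩
  set β : Fin N → ℝ := fun i => α i * Real.exp (-x i ^ 2) with hβ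
  have hterm : ∀ i j, HasSum (fun k : ℕ => 2 ^ k / (k.factorial : ℝ) *
      ((β i * x i ^ k) * (β j * x j ^ k)))
      (α i * α j * radial gaussianProfile 1 (x i - x j)) := by
    intro i j
    have h1 := (NormedSpace.expSeries_div_hasSum_exp (2 * (x i * x j) : ℝ)).mul_left (β i * β j)
    rw [← Real.exp_eq_exp_ℝ] at h1
    have h2 : α i * α j * radial gaussianProfile 1 (x i - x j) =
        β i * β j * Real.exp (2 * (x i * x j)) := by
      rw [radial_gaussianProfile, show -(1 * (x i - x j) ^ 2) = -x i ^ 2 + -x j ^ 2 +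
        2 * (x i * x j) by ring, Real.exp_add, Real.exp_add]
      simp only [hβ]
      ring
    rw [h2]
    refine h1.congr_fun fun k => ?_
    rw [mul_pow, mul_pow]
    ring
  have hsum : HasSum (fun k : ℕ => 2 ^ k / (k.factorial : ℝ) * (∑ i, β i * x i ^ k) ^ 2)
      (∑ i, ∑ j, α i * α j * radial gaussianProfile 1 (x i - x j)) := by
    refine (hasSum_sum fun i _ => hasSum_sum fun j _ => hterm i j).congr_fun fun k => ?_
    rw [sq, Finset.sum_mul_sum, Finset.mul_sum]
    exact Finset.sum_congr rfl fun i _ => Finset.mul_sum _ _ _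
  obtain ⟨k, hk⟩ : ∃ k : ℕ, ∑ i, β i * x i ^ k ≠ 0 := by
    by_contra! h0
    have hβ0 := Matrix.eq_zero_of_forall_pow_sum_mul_pow_eq_zero hx fun i => h0 i
    apply hα
    ext i
    exact (mul_eq_zero.1 (congrFun hβ0 i)).resolve_right (Real.exp_ne_zero _)
  rw [← hsum.tsum_eq]
  exact hsum.summable.tsum_pos (fun k => by positivity) k (by positivity)

/-! ### Positive definite functions have nonsingular Hankel matrices. -/

/-- Weights of numerical differentiation. -/
theorem exists_dual_weights (m : ℕ) : ∃ (τ : Fin (m + 1) → ℝ) (dual : ℕ → Fin (m + 1) → ℝ),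
    Function.Injective τ ∧
    ∀ i j, i ≤ m → j ≤ m → ∑ a, dual j a * τ a ^ i = if i = j then 1 else 0 := by
  set τ : Fin (m + 1) → ℝ := fun a => (a : ℕ) with hτ
  have hinj : Function.Injective τ := fun a b hab => Fin.ext (by simpa [hτ] using hab)
  have hdet := Matrix.det_vandermonde_ne_zero_iff.2 hinj
  refine ⟨τ, fun j a => if h : j < m + 1 then (Matrix.vandermonde τ)⁻¹ ⟨j, h⟩ a else 0, hinj,
    fun i j hi hj => ?_⟩
  have h1 := congrFun (congrFun (Matrix.nonsing_inv_mul _ (isUnit_iff_ne_zero.2 hdet))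
    ⟨j, Nat.lt_succ_of_le hj⟩) ⟨i, Nat.lt_succ_of_le hi⟩
  rw [Matrix.mul_apply, Matrix.one_apply] at h1
  simp only [Fin.mk.injEq] at h1
  simp only [dif_pos (Nat.lt_succ_of_le hj), eq_comm (a := i)]
  exact h1

/-- Families of weights `W δ a` at the nodes `δ τ a` that approximate the differential operator
`∑ j ≤ m, c j ∂ ^ j` at `0` as `δ → 0`. -/
structure ApproximatesDerivation {m : ℕ} (c : ℕ → ℝ) (τ : Fin (m + 1) → ℝ)
    (W : ℝ → Fin (m + 1) → ℝ) : Prop where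
  moment : ∀ i, Tendsto (fun δ => ∑ a, W δ a * (δ * τ a) ^ i) (𝓝[≠] 0)
    (𝓝 (if i ≤ m then c i * i.factorial else 0))
  bounded : ∀ a, (fun δ => δ ^ m * W δ a) =O[𝓝[≠] 0] fun _ => (1 : ℝ)

theorem isBigO_pow_one_nhdsNE (k : ℕ) : (fun δ : ℝ => δ ^ k) =O[𝓝[≠] 0] fun _ => (1 : ℝ) := by
  simpa using (isBigO_pow_pow_nhds_zero (Nat.zero_le k)).mono
    (nhdsWithin_le_nhds (a := (0 : ℝ)) (s := {0}ᶜ))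

/-- Scaled difference quotients: the weights for `∂ ^ j` are `j! δ ^ (-j)` times the dual weights.
Moments up to degree `m` are then exact, and higher ones carry a positive power of `δ`. -/
theorem exists_approximatesDerivation (m : ℕ) (c : ℕ → ℝ) :
    ∃ (τ : Fin (m + 1) → ℝ) (W : ℝ → Fin (m + 1) → ℝ), Function.Injective τ ∧
      ApproximatesDerivation c τ W := by
  obtain ⟨τ, dual, hinj, hdual⟩ := exists_dual_weights m
  have hWm : ∀ (a : Fin (m + 1)) (δ : ℝ), δ ≠ 0 →
      δ ^ m * ∑ j ∈ Finset.range (m + 1), c j * j.factorial * (δ ^ j)⁻¹ * dual j a =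
      ∑ j ∈ Finset.range (m + 1), c j * j.factorial * dual j a * δ ^ (m - j) := by
    intro a δ hδ
    rw [Finset.mul_sum]
    refine Finset.sum_congr rfl fun j hj => ?_
    have hj := Nat.le_of_lt_succ (Finset.mem_range.1 hj)
    rw [pow_sub₀ _ hδ hj]
    ring
  refine ⟨τ, fun δ a => ∑ j ∈ Finset.range (m + 1), c j * j.factorial * (δ ^ j)⁻¹ * dual j a, hinj,
    fun i => ?_, fun a => ?_⟩
  · have hsum : ∀ δ : ℝ, ∑ a, (∑ j ∈ Finset.range (m + 1), c j * j.factorial * (δ ^ j)⁻¹ * dual j a) *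
        (δ * τ a) ^ i = ∑ j ∈ Finset.range (m + 1), c j * j.factorial * ((δ ^ j)⁻¹ * δ ^ i) *
          ∑ a, dual j a * τ a ^ i := by
      intro δ
      simp only [Finset.sum_mul, Finset.mul_sum]
      rw [Finset.sum_comm]
      refine Finset.sum_congr rfl fun j _ => Finset.sum_congr rfl fun a _ => ?_
      rw [mul_pow]
      ring
    simp only [hsum]
    split_ifs with hi
    · refine tendsto_const_nhds.congr' ?_
      filter_upwards [self_mem_nhdsWithin] with δ hδ
      rw [Finset.sum_eq_single i]
      · rw [hdual i i hi hi, if_pos rfl, inv_mul_cancel₀ (pow_ne_zero _ hδ)]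
        ring
      · intro j hj hji
        rw [hdual i j hi (Nat.le_of_lt_succ (Finset.mem_range.1 hj)), if_neg (Ne.symm hji), mul_zero]
      · intro h
        exact absurd (Finset.mem_range.2 (Nat.lt_succ_of_le hi)) h
    · suffices key : ∀ j ∈ Finset.range (m + 1), Tendsto (fun δ => c j * j.factorial *
          ((δ ^ j)⁻¹ * δ ^ i) * ∑ a, dual j a * τ a ^ i) (𝓝[≠] 0) (𝓝 0) by
        have := tendsto_finsetSum _ key
        rwa [Finset.sum_const_zero] at this
      intro j hj
      have hj := Finset.mem_range.1 hj
      have h1 : Tendsto (fun δ : ℝ => δ ^ (i - j)) (𝓝[≠] 0) (𝓝 0) := by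
        have := ((continuous_pow (i - j)).tendsto (0 : ℝ)).mono_left
          (nhdsWithin_le_nhds (s := {0}ᶜ))
        rwa [zero_pow (by omega)] at this
      have h2 := (h1.const_mul (c j * j.factorial)).mul_const (∑ a, dual j a * τ a ^ i)
      rw [mul_zero, zero_mul] at h2
      refine h2.congr' ?_
      filter_upwards [self_mem_nhdsWithin] with δ hδ
      rw [pow_sub₀ _ hδ (by omega : j ≤ i), mul_comm (δ ^ i)]
  · have h1 : (fun δ : ℝ => ∑ j ∈ Finset.range (m + 1), c j * j.factorial * dual j a * δ ^ (m - j))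
        =O[𝓝[≠] 0] fun _ => (1 : ℝ) :=
      IsBigO.fun_sum fun j _ => (isBigO_pow_one_nhdsNE _).const_mul_left _
    refine h1.congr' ?_ EventuallyEq.rfl
    filter_upwards [self_mem_nhdsWithin] with δ hδ
    exact (hWm a δ hδ).symm

theorem tendsto_zero_of_isBigO_id {f : ℝ → ℝ} (h : f =O[𝓝[≠] 0] fun δ => δ) :
    Tendsto f (𝓝[≠] 0) (𝓝 0) :=
  h.trans_tendsto (tendsto_id.mono_left nhdsWithin_le_nhds)

/-- The weights are `O(δ ^ (-m))` and the Taylor remainder is `O(δ ^ (m + 1))`, so only the moments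
up to degree `m` count in the limit. -/
theorem ApproximatesDerivation.tendsto {m : ℕ} {c : ℕ → ℝ} {τ : Fin (m + 1) → ℝ}
    {W : ℝ → Fin (m + 1) → ℝ} (hW : ApproximatesDerivation c τ W) {g : ℝ → ℝ}
    (hg : ContDiff ℝ ∞ g) (x : ℝ) :
    Tendsto (fun δ => ∑ a, W δ a * g (x + δ * τ a)) (𝓝[≠] 0)
      (𝓝 (∑ j ∈ Finset.range (m + 1), c j * iteratedDeriv j g x)) := by
  have hT := ContDiffAt.taylor_isBigO (f := fun y => g (x + y))
    (hg.comp (contDiff_const.add contDiff_id)).contDiffAt (m + 1)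
  simp only [iteratedDeriv_comp_const_add, add_zero] at hT
  have hrem : Tendsto (fun δ => ∑ a, W δ a * (g (x + δ * τ a) - ∑ i ∈ Finset.range (m + 1),
      iteratedDeriv i g x / i.factorial * (δ * τ a) ^ i)) (𝓝[≠] 0) (𝓝 0) := by
    refine tendsto_zero_of_isBigO_id (IsBigO.fun_sum fun a _ => ?_)
    have ht : Tendsto (fun δ : ℝ => δ * τ a) (𝓝[≠] 0) (𝓝 0) := by
      have := ((continuous_mul_const (τ a)).tendsto (0 : ℝ)).mono_left
        (nhdsWithin_le_nhds (s := {0}ᶜ))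
      simpa using this
    have h1 := hT.comp_tendsto ht
    have h2 : ((fun y : ℝ => y ^ (m + 1)) ∘ fun δ => δ * τ a) =O[𝓝[≠] 0] fun δ => δ ^ m * δ := by
      simp only [Function.comp_def, mul_pow, ← pow_succ]
      simp_rw [mul_comm _ (τ a ^ (m + 1))]
      exact (isBigO_refl _ _).const_mul_left _
    have h3 := ((hW.bounded a).mul (isBigO_refl (fun δ : ℝ => (δ ^ m)⁻¹) (𝓝[≠] 0))).mul (h1.trans h2)
    refine h3.congr' ?_ ?_
    · filter_upwards [self_mem_nhdsWithin] with δ hδ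
      have : δ ^ m ≠ 0 := pow_ne_zero _ hδ
      simp only [Function.comp]
      field_simp
    · filter_upwards [self_mem_nhdsWithin] with δ hδ
      have : δ ^ m ≠ 0 := pow_ne_zero _ hδ
      field_simp
  have hmain : Tendsto (fun δ => ∑ i ∈ Finset.range (m + 1), iteratedDeriv i g x / i.factorial *
      ∑ a, W δ a * (δ * τ a) ^ i) (𝓝[≠] 0)
      (𝓝 (∑ j ∈ Finset.range (m + 1), c j * iteratedDeriv j g x)) := by
    refine tendsto_finsetSum _ fun i hi => ?_
    have h1 := (hW.moment i).const_mul (iteratedDeriv i g x / i.factorial)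
    rw [if_pos (Nat.le_of_lt_succ (Finset.mem_range.1 hi))] at h1
    have hfac : (i.factorial : ℝ) ≠ 0 := by exact_mod_cast i.factorial_ne_zero
    rwa [show iteratedDeriv i g x / i.factorial * (c i * i.factorial) = c i * iteratedDeriv i g x by
      field_simp] at h1
  have := hrem.add hmain
  rw [zero_add] at this
  refine this.congr fun δ => ?_
  simp only [mul_sub, Finset.sum_sub_distrib, Finset.mul_sum]
  rw [Finset.sum_comm (s := Finset.range (m + 1)), sub_add_eq_add_sub, add_sub_assoc,
    ← Finset.sum_sub_distrib, add_eq_left]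
  refine Finset.sum_eq_zero fun a _ => ?_
  rw [sub_eq_zero]
  exact Finset.sum_congr rfl fun i _ => by ring

/-- A product of two weights is `O(δ ^ (-2 m))`, so `φ` is expanded to degree `2 m`. Binomial
expansion of the differences splits the form into products of moments; the sign comes from the
second argument. -/
theorem ApproximatesDerivation.tendsto_quadratic {m : ℕ} {c : ℕ → ℝ} {τ : Fin (m + 1) → ℝ}
    {W : ℝ → Fin (m + 1) → ℝ} (hW : ApproximatesDerivation c τ W) {φ : ℝ → ℝ}
    (hφ : ContDiff ℝ ∞ φ) :
    Tendsto (fun δ => ∑ a, ∑ b, W δ a * W δ b * φ (δ * τ a - δ * τ b)) (𝓝[≠] 0)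
      (𝓝 (∑ i ∈ Finset.range (m + 1), ∑ j ∈ Finset.range (m + 1),
        (-1) ^ j * c i * c j * iteratedDeriv (i + j) φ 0)) := by
  have hT := hφ.contDiffAt.taylor_isBigO (2 * m + 1)
  have hrem : Tendsto (fun δ => ∑ a, ∑ b, W δ a * W δ b * (φ (δ * τ a - δ * τ b) -
      ∑ q ∈ Finset.range (2 * m + 1), iteratedDeriv q φ 0 / q.factorial *
        (δ * τ a - δ * τ b) ^ q)) (𝓝[≠] 0) (𝓝 0) := by
    refine tendsto_zero_of_isBigO_id (IsBigO.fun_sum fun a _ => IsBigO.fun_sum fun b _ => ?_)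
    have ht : Tendsto (fun δ : ℝ => δ * τ a - δ * τ b) (𝓝[≠] 0) (𝓝 0) := by
      have : Continuous fun δ : ℝ => δ * τ a - δ * τ b := by fun_prop
      have := (this.tendsto (0 : ℝ)).mono_left (nhdsWithin_le_nhds (s := {0}ᶜ))
      simpa using this
    have h1 := hT.comp_tendsto ht
    have h2 : ((fun y : ℝ => y ^ (2 * m + 1)) ∘ fun δ => δ * τ a - δ * τ b)
        =O[𝓝[≠] 0] fun δ => δ ^ m * δ ^ m * δ := by
      simp only [Function.comp_def, ← mul_sub, mul_pow, ← pow_add, ← two_mul, ← pow_succ]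
      simp_rw [mul_comm _ ((τ a - τ b) ^ (2 * m + 1))]
      exact (isBigO_refl _ _).const_mul_left _
    have h3 := (((hW.bounded a).mul (hW.bounded b)).mul
      (isBigO_refl (fun δ : ℝ => (δ ^ m * δ ^ m)⁻¹) (𝓝[≠] 0))).mul (h1.trans h2)
    refine h3.congr' ?_ ?_
    · filter_upwards [self_mem_nhdsWithin] with δ hδ
      have : δ ^ m ≠ 0 := pow_ne_zero _ hδ
      simp only [Function.comp]
      field_simp
    · filter_upwards [self_mem_nhdsWithin] with δ hδ
      have : δ ^ m ≠ 0 := pow_ne_zero _ hδ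
      field_simp
  set cc : ℕ → ℝ := fun i => if i ≤ m then c i * i.factorial else 0 with hcc
  have hmain : Tendsto (fun δ => ∑ q ∈ Finset.range (2 * m + 1), iteratedDeriv q φ 0 / q.factorial *
      ∑ x ∈ Finset.HasAntidiagonal.antidiagonal q, (q.choose x.1 : ℝ) * (-1) ^ x.2 *
        ((∑ a, W δ a * (δ * τ a) ^ x.1) * ∑ a, W δ a * (δ * τ a) ^ x.2)) (𝓝[≠] 0)
      (𝓝 (∑ q ∈ Finset.range (2 * m + 1), iteratedDeriv q φ 0 / q.factorial *
        ∑ x ∈ Finset.HasAntidiagonal.antidiagonal q, (q.choose x.1 : ℝ) * (-1) ^ x.2 *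
          (cc x.1 * cc x.2))) :=
    tendsto_finsetSum _ fun q _ => (tendsto_finsetSum _ fun x _ =>
      ((hW.moment x.1).mul (hW.moment x.2)).const_mul _).const_mul _
  have hval : ∑ q ∈ Finset.range (2 * m + 1), iteratedDeriv q φ 0 / q.factorial *
        ∑ x ∈ Finset.HasAntidiagonal.antidiagonal q, (q.choose x.1 : ℝ) * (-1) ^ x.2 *
          (cc x.1 * cc x.2) = ∑ i ∈ Finset.range (m + 1), ∑ j ∈ Finset.range (m + 1),
        (-1) ^ j * c i * c j * iteratedDeriv (i + j) φ 0 := by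
    rw [← Finset.sum_product', ← Finset.sum_fiberwise_of_maps_to (g := fun x : ℕ × ℕ => x.1 + x.2)
      (t := Finset.range (2 * m + 1)) (fun x hx => by
        simp only [Finset.mem_product, Finset.mem_range] at hx ⊢
        omega)]
    refine Finset.sum_congr rfl fun q _ => ?_
    rw [Finset.mul_sum]
    symm
    refine Finset.sum_subset_zero_on_sdiff (fun x hx => ?_) (fun x hx => ?_) fun x hx => ?_
    · exact Finset.HasAntidiagonal.mem_antidiagonal.2 (Finset.mem_filter.1 hx).2
    · simp only [Finset.mem_sdiff, Finset.HasAntidiagonal.mem_antidiagonal, Finset.mem_filter,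
        Finset.mem_product, Finset.mem_range, not_and] at hx
      have h1 : ¬ (x.1 ≤ m ∧ x.2 ≤ m) := fun h =>
        hx.2 ⟨Nat.lt_succ_of_le h.1, Nat.lt_succ_of_le h.2⟩ hx.1
      rw [not_and_or] at h1
      rcases h1 with h1 | h1 <;> simp [hcc, h1]
    · simp only [Finset.mem_filter, Finset.mem_product, Finset.mem_range] at hx
      obtain ⟨⟨h1, h2⟩, rfl⟩ := hx
      have h3 := Nat.add_choose_mul_factorial_mul_factorial x.1 x.2
      rw [← Nat.choose_symm_add] at h3
      have h4 : ((x.1 + x.2).factorial : ℝ) =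
        (x.1 + x.2).choose x.1 * x.1.factorial * x.2.factorial := by exact_mod_cast h3.symm
      have h5 : ((x.1 + x.2).factorial : ℝ) ≠ 0 := by exact_mod_cast Nat.factorial_ne_zero _
      simp only [hcc, if_pos (Nat.le_of_lt_succ h1), if_pos (Nat.le_of_lt_succ h2)]
      rw [div_mul_eq_mul_div, eq_div_iff h5]
      conv_lhs => rw [h4]
      ring
  rw [← hval]
  have := hrem.add hmain
  rw [zero_add] at this
  refine this.congr fun δ => ?_
  have hexp : ∑ q ∈ Finset.range (2 * m + 1), iteratedDeriv q φ 0 / q.factorial *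
      ∑ x ∈ Finset.HasAntidiagonal.antidiagonal q, (q.choose x.1 : ℝ) * (-1) ^ x.2 *
        ((∑ a, W δ a * (δ * τ a) ^ x.1) * ∑ a, W δ a * (δ * τ a) ^ x.2) =
      ∑ a, ∑ b, W δ a * W δ b * ∑ q ∈ Finset.range (2 * m + 1),
        iteratedDeriv q φ 0 / q.factorial * (δ * τ a - δ * τ b) ^ q := by
    have h1 : ∀ q, ∑ x ∈ Finset.HasAntidiagonal.antidiagonal q, (q.choose x.1 : ℝ) * (-1) ^ x.2 *
        ((∑ a, W δ a * (δ * τ a) ^ x.1) * ∑ a, W δ a * (δ * τ a) ^ x.2) =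
        ∑ a, ∑ b, W δ a * W δ b * (δ * τ a - δ * τ b) ^ q := by
      intro q
      simp only [Finset.sum_mul_sum]
      simp only [Finset.mul_sum]
      rw [Finset.sum_comm]
      refine Finset.sum_congr rfl fun a _ => ?_
      rw [Finset.sum_comm]
      refine Finset.sum_congr rfl fun b _ => ?_
      rw [sub_eq_add_neg, (Commute.all (δ * τ a) (-(δ * τ b))).add_pow', Finset.mul_sum]
      refine Finset.sum_congr rfl fun x _ => ?_
      rw [nsmul_eq_mul, neg_pow (δ * τ b)]
      ring
    simp only [h1]
    simp only [Finset.mul_sum]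
    rw [Finset.sum_comm]
    refine Finset.sum_congr rfl fun a _ => ?_
    rw [Finset.sum_comm]
    exact Finset.sum_congr rfl fun b _ => Finset.sum_congr rfl fun q _ => by ring
  rw [hexp, ← Finset.sum_add_distrib]
  refine Finset.sum_congr rfl fun a _ => ?_
  rw [← Finset.sum_add_distrib]
  exact Finset.sum_congr rfl fun b _ => by ring

theorem IsPositiveDefinite.zero_pos {φ : ℝ → ℝ} (hφ : IsPositiveDefinite φ) : 0 < φ 0 := by
  have := hφ.2 1 (fun _ => 0) (Function.injective_of_subsingleton _) (fun _ => 1)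
    (fun h => one_ne_zero (congrFun h 0))
  simpa using this

theorem IsPositiveDefinite.sum_nonneg {φ : ℝ → ℝ} (hφ : IsPositiveDefinite φ) {N : ℕ}
    {x : Fin N → ℝ} (hx : Function.Injective x) (α : Fin N → ℝ) :
    0 ≤ ∑ i, ∑ j, α i * α j * φ (x i - x j) := by
  rcases eq_or_ne α 0 with rfl | hα
  · simp
  · exact (hφ.2 N x hx α hα).le

/-- A differential operator whose symbol is in the kernel of the Hankel matrix of the derivatives at
`0` of a positive definite even function annihilates the function. -/
theorem IsPositiveDefinite.differential_equation {φ : ℝ → ℝ} (hφ : IsPositiveDefinite φ)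
    (hs : ContDiff ℝ ∞ φ) (heven : ∀ x, φ (-x) = φ x) {m : ℕ} {c : ℕ → ℝ}
    (hc : ∀ i ≤ m, ∑ j ∈ Finset.range (m + 1), c j * iteratedDeriv (i + j) φ 0 = 0) (t : ℝ) :
    ∑ j ∈ Finset.range (m + 1), c j * iteratedDeriv j φ t = 0 := by
  rcases eq_or_ne t 0 with rfl | ht
  · simpa using hc 0 (Nat.zero_le m)
  -- The operator and the point evaluation at `-t` are treated as vectors of the inner product
  -- defined by `φ`. The former has norm zero, by `hquad0`, so their inner product `f` must vanish.
  -- The weights realise this with finitely many points.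
  obtain ⟨τ, W, hτ, hW⟩ := exists_approximatesDerivation m c
  set f := ∑ j ∈ Finset.range (m + 1), c j * iteratedDeriv j φ t with hf
  have hlin := hW.tendsto hs t
  have hquad := hW.tendsto_quadratic hs
  have hquad0 : ∑ i ∈ Finset.range (m + 1), ∑ j ∈ Finset.range (m + 1),
        (-1) ^ j * c i * c j * iteratedDeriv (i + j) φ 0 = 0 := by
    rw [Finset.sum_comm]
    refine Finset.sum_eq_zero fun j hj => ?_
    have := hc j (Nat.le_of_lt_succ (Finset.mem_range.1 hj))
    refine Eq.trans ?_ ((congrArg (fun z => (-1) ^ j * c j * z) this).trans (mul_zero _))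
    simp only [Finset.mul_sum]
    exact Finset.sum_congr rfl fun i _ => by rw [add_comm i j]; ring
  rw [hquad0] at hquad
  have hev : ∀ᶠ δ in 𝓝[≠] (0 : ℝ), Function.Injective
      (Fin.cons (-t) (fun a => δ * τ a) : Fin (m + 1 + 1) → ℝ) := by
    have h1 : ∀ᶠ δ in 𝓝[≠] (0 : ℝ), ∀ a, δ * τ a ≠ -t := by
      refine eventually_all.2 fun a => ?_
      have : Tendsto (fun δ : ℝ => δ * τ a) (𝓝[≠] 0) (𝓝 0) := by
        simpa using ((continuous_mul_const (τ a)).tendsto (0 : ℝ)).mono_left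
          (nhdsWithin_le_nhds (s := {0}ᶜ))
      exact this.eventually_ne (neg_ne_zero.2 ht).symm
    filter_upwards [h1, self_mem_nhdsWithin] with δ hδ hδ0
    rw [Fin.cons_injective_iff]
    exact ⟨fun ⟨a, ha⟩ => hδ a ha, fun a b hab => hτ (mul_left_cancel₀ hδ0 hab)⟩
  have hform : ∀ s : ℝ, 0 ≤ s * s * φ 0 + 2 * s * f := by
    intro s
    have hlim := ((tendsto_const_nhds (x := s * s * φ 0)).add (hlin.const_mul (2 * s))).add hquad
    rw [add_zero] at hlim
    refine ge_of_tendsto hlim ?_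
    filter_upwards [hev] with δ hδ
    have h := hφ.sum_nonneg hδ (Fin.cons s (W δ))
    simp only [Fin.sum_univ_succ (n := m + 1), Fin.cons_zero, Fin.cons_succ, sub_self,
      Finset.sum_add_distrib] at h
    have h1 : ∑ b, s * W δ b * φ (-t - δ * τ b) = s * ∑ a, W δ a * φ (t + δ * τ a) := by
      rw [Finset.mul_sum]
      refine Finset.sum_congr rfl fun b _ => ?_
      rw [← heven, neg_sub, sub_neg_eq_add, add_comm (δ * τ b)]
      ring
    have h2 : ∑ a, W δ a * s * φ (δ * τ a - -t) = s * ∑ a, W δ a * φ (t + δ * τ a) := by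
      rw [Finset.mul_sum]
      refine Finset.sum_congr rfl fun b _ => ?_
      rw [sub_neg_eq_add, add_comm (δ * τ b)]
      ring
    rw [h1, h2] at h
    linarith
  have hφ0 := hφ.zero_pos
  -- This is the minimiser of the quadratic `s² φ 0 + 2 s f`.
  have h := hform (-f / φ 0)
  have h2 : -f / φ 0 * (-f / φ 0) * φ 0 + 2 * (-f / φ 0) * f = -(f ^ 2 / φ 0) := by
    field_simp
    ring
  rw [h2] at h
  have h3 : f ^ 2 / φ 0 = 0 := le_antisymm (by linarith) (by positivity)
  rw [div_eq_zero_iff, or_iff_left hφ0.ne'] at h3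
  exact pow_eq_zero_iff two_ne_zero |>.1 h3

theorem hasDerivAt_iteratedDeriv {g : ℝ → ℝ} (hg : ContDiff ℝ ∞ g) (j : ℕ) (t : ℝ) :
    HasDerivAt (iteratedDeriv j g) (iteratedDeriv (j + 1) g t) t := by
  rw [iteratedDeriv_succ]
  exact (hg.differentiable_iteratedDeriv j (by exact_mod_cast WithTop.coe_lt_top j)).differentiableAt.hasDerivAt

/-- Uniqueness for a scalar linear differential equation with constant coefficients. -/
theorem eq_zero_of_linear_ode {J : ℕ} {g : ℝ → ℝ} (hg : ContDiff ℝ ∞ g) (a : ℕ → ℝ)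
    (hode : ∀ t, iteratedDeriv J g t = ∑ j ∈ Finset.range J, a j * iteratedDeriv j g t)
    (h0 : ∀ j < J, iteratedDeriv j g 0 = 0) : g = 0 := by
  rcases Nat.eq_zero_or_pos J with rfl | hJ
  · ext t
    simpa using hode t
  set A : Matrix (Fin J) (Fin J) ℝ := Matrix.of fun i j =>
    if (i : ℕ) + 1 < J then (if (j : ℕ) = i + 1 then 1 else 0) else a j with hA
  set L : (Fin J → ℝ) →L[ℝ] (Fin J → ℝ) := LinearMap.toContinuousLinearMap A.mulVecLin with hL
  set Y : ℝ → Fin J → ℝ := fun t j => iteratedDeriv j g t with hY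
  have hYd : ∀ t, HasDerivAt Y (L (Y t)) t := by
    intro t
    rw [hasDerivAt_pi]
    intro i
    have h1 : L (Y t) i = iteratedDeriv (i + 1) g t := by
      simp only [hL, LinearMap.coe_toContinuousLinearMap', Matrix.mulVecLin_apply, Matrix.mulVec,
        dotProduct, hA, Matrix.of_apply, hY]
      split_ifs with hi
      · rw [Finset.sum_eq_single ⟨i + 1, hi⟩]
        · simp
        · intro j _ hj
          rw [if_neg (fun h => hj (Fin.ext h)), zero_mul]
        · simp
      · rw [show (i : ℕ) + 1 = J by omega, hode, Finset.sum_range]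
    rw [h1]
    exact hasDerivAt_iteratedDeriv hg i t
  have hY0 : Y = fun _ => 0 := by
    refine ODE_solution_unique_univ (v := fun _ => L) (s := fun _ => Set.univ) (K := ‖L‖₊) (t₀ := 0)
      (fun t => L.lipschitz.lipschitzOnWith) (fun t => ⟨hYd t, Set.mem_univ _⟩)
      (fun t => ⟨by simpa using hasDerivAt_const t (0 : Fin J → ℝ), Set.mem_univ _⟩) ?_
    ext j
    exact h0 j j.2
  ext t
  simpa [hY] using congrFun (congrFun hY0 t) ⟨0, hJ⟩

/-- A kernel vector yields a homogeneous constant-coefficient equation of some order `J` for `φ`.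
Its solution space has dimension at most `J`, so `J + 1` translates of `φ` are dependent, which
makes the positive form vanish on a nonzero vector. -/
theorem IsPositiveDefinite.hankel_det_ne_zero {φ : ℝ → ℝ} (hφ : IsPositiveDefinite φ)
    (hs : ContDiff ℝ ∞ φ) (heven : ∀ x, φ (-x) = φ x) (m : ℕ) :
    (Matrix.of fun i j : Fin (m + 1) => iteratedDeriv ((i : ℕ) + (j : ℕ)) φ 0).det ≠ 0 := by
  intro hdet
  obtain ⟨v, hv, hMv⟩ := Matrix.exists_mulVec_eq_zero_iff.2 hdet
  set c : ℕ → ℝ := fun j => if h : j < m + 1 then v ⟨j, h⟩ else 0 with hc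
  have hrow : ∀ i ≤ m, ∑ j ∈ Finset.range (m + 1), c j * iteratedDeriv (i + j) φ 0 = 0 := by
    intro i hi
    have h1 := congrFun hMv ⟨i, Nat.lt_succ_of_le hi⟩
    simp only [Matrix.mulVec, dotProduct, Matrix.of_apply, Pi.zero_apply] at h1
    rw [Finset.sum_range]
    refine Eq.trans ?_ h1
    refine Finset.sum_congr rfl fun j _ => ?_
    simp only [hc, dif_pos j.2]
    ring
  have hode := hφ.differential_equation hs heven hrow
  -- `J` is the actual order of the operator, so that the equation can be solved for the highest
  -- derivative.
  obtain ⟨J, hJm, hJ, hJmax⟩ : ∃ J < m + 1, c J ≠ 0 ∧ ∀ j, J < j → c j = 0 := by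
    obtain ⟨i₀, hi₀⟩ : ∃ i, v i ≠ 0 := Function.ne_iff.1 hv
    obtain ⟨J, hJ, hmax⟩ := Finset.exists_max_image (Finset.univ.filter fun i => v i ≠ 0)
      (fun i => (i : ℕ)) ⟨i₀, by simpa using hi₀⟩
    refine ⟨J, J.2, by simpa [hc, Nat.le_of_lt_succ J.2] using hJ, fun j hj => ?_⟩
    simp only [hc]
    split_ifs with h
    · by_contra hne
      have := hmax ⟨j, h⟩ (by simpa using hne)
      simp only at this
      omega
    · rfl
  have hode' : ∀ t, iteratedDeriv J φ t =
      ∑ j ∈ Finset.range J, -(c j / c J) * iteratedDeriv j φ t := by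
    intro t
    have h1 := hode t
    rw [← Finset.sum_subset (Finset.range_subset_range.2 (Nat.succ_le_of_lt hJm))
      (fun j _ hj => by
        rw [hJmax j (by rw [Finset.mem_range] at hj; omega), zero_mul]), Finset.sum_range_succ] at h1
    have h2 : ∑ j ∈ Finset.range J, -(c j / c J) * iteratedDeriv j φ t =
        -(∑ j ∈ Finset.range J, c j * iteratedDeriv j φ t) / c J := by
      rw [neg_div, Finset.sum_div, ← Finset.sum_neg_distrib]
      exact Finset.sum_congr rfl fun j _ => by ring
    rw [h2, eq_div_iff hJ]
    linarith
  -- a nontrivial combination of `J + 1` translates has zero initial data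
  obtain ⟨α, hα, hα0⟩ : ∃ α : Fin (J + 1) → ℝ, α ≠ 0 ∧
      ∀ j < J, ∑ i, α i * iteratedDeriv j φ (0 - (i : ℕ)) = 0 := by
    have hker : LinearMap.ker (Matrix.of fun (j : Fin J) (i : Fin (J + 1)) =>
        iteratedDeriv (j : ℕ) φ (0 - (i : ℕ))).mulVecLin ≠ ⊥ :=
      LinearMap.ker_ne_bot_of_finrank_lt (by simp)
    obtain ⟨α, hαk, hα⟩ := (Submodule.ne_bot_iff _).1 hker
    refine ⟨α, hα, fun j hj => ?_⟩
    refine Eq.trans ?_ (congrFun (LinearMap.mem_ker.1 hαk) ⟨j, hj⟩)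
    exact Finset.sum_congr rfl fun i _ => mul_comm _ _
  set g : ℝ → ℝ := fun t => ∑ i, α i * φ (t - (i : ℕ)) with hg
  have hshift : ∀ y : ℝ, ContDiff ℝ ∞ fun t => φ (t - y) := fun y =>
    hs.comp (contDiff_id.sub contDiff_const)
  have hgd : ∀ j t, iteratedDeriv j g t = ∑ i, α i * iteratedDeriv j φ (t - (i : ℕ)) := by
    intro j t
    simp only [hg]
    rw [iteratedDeriv_fun_sum fun i _ =>
      (contDiff_const.mul ((contDiff_infty.1 (hshift _)) j)).contDiffAt]
    refine Finset.sum_congr rfl fun i _ => ?_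
    rw [iteratedDeriv_const_mul_field, iteratedDeriv_comp_sub_const]
  have hg0 : g = 0 := by
    refine eq_zero_of_linear_ode (J := J)
      (ContDiff.sum fun i _ => contDiff_const.mul (hshift _)) (fun j => -(c j / c J)) (fun t => ?_)
      fun j hj => (hgd j 0).trans (hα0 j hj)
    simp only [hgd, hode', Finset.mul_sum]
    rw [Finset.sum_comm]
    exact Finset.sum_congr rfl fun j _ => Finset.sum_congr rfl fun i _ => by ring
  have hpos := hφ.2 (J + 1) (fun i => (i : ℕ))
    (fun i j hij => Fin.ext (by simpa using hij)) α hα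
  have hzero : ∑ i : Fin (J + 1), ∑ j : Fin (J + 1), α i * α j * φ ((i : ℕ) - (j : ℕ)) = 0 := by
    refine Finset.sum_eq_zero fun i _ => ?_
    have h1 : g (i : ℕ) = 0 := by rw [hg0]; rfl
    refine Eq.trans ?_ ((congrArg (fun z => α i * z) h1).trans (mul_zero _))
    simp only [hg, Finset.mul_sum]
    exact Finset.sum_congr rfl fun j _ => by ring
  exact hpos.ne' hzero

theorem IsPositiveDefinite.isSmoothRBF {Φ : ℝ → ℝ} (hΦ : ContDiffAt ℝ ∞ Φ 0)
    (hs : ContDiff ℝ ∞ (radial Φ 1)) (hφ : IsPositiveDefinite (radial Φ 1)) : IsSmoothRBF Φ :=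
  ⟨hΦ, hφ.hankel_det_ne_zero hs (radial_neg Φ 1)⟩

/-! ### The Gaussian: explicit roots of the error coefficient. -/

theorem contDiff_gaussianProfile : ContDiff ℝ ∞ gaussianProfile :=
  Real.contDiff_exp.comp contDiff_neg

theorem isSmoothRBF_gaussian : IsSmoothRBF gaussianProfile := by
  refine isPositiveDefinite_gaussian.isSmoothRBF contDiff_gaussianProfile.contDiffAt ?_
  exact contDiff_gaussianProfile.comp (contDiff_const.mul (contDiff_id.pow 2))

theorem taylorCoeffZero_gaussianProfile (q : ℕ) :
    taylorCoeffZero gaussianProfile q = (-1) ^ q / q.factorial := by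
  have h := iteratedDeriv_comp_neg q Real.exp 0
  rw [taylorCoeffZero, show iteratedDeriv q gaussianProfile 0 = _ from h]
  simp [iteratedDeriv_eq_iterate]

/-- For the Gaussian, a shape parameter near a continuous family of roots of the leading error
coefficient raises the order. -/
theorem gaussian_order_of_near_root (A : Reconstruction) {n : ℕ} (hn : 1 ≤ n) {Ω : Set ℝ}
    {u : ℝ → ℝ} {K : Set ℝ} (hΩ : IsOpen Ω) (hu : ContDiffOn ℝ ∞ u Ω) (hK : IsCompact K)
    (hKΩ : K ⊆ Ω) {p : ℝ} (hp0 : 0 ≤ p) (hp2 : p ≤ 2) (c : ℝ) {root : ℝ → ℝ} {P : ℝ → Prop}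
    (hcont : ContinuousOn root K)
    (hroot : ∀ γ : ℕ → ℝ, (∀ l < n, ∑ k ∈ Finset.range (n + 1), γ k *
      ((2 * (k + l + A.derivOrder)).factorial * taylorCoeffZero gaussianProfile
        (k + l + A.derivOrder)) = 0) → ∀ x ∈ K, P x → errorCoeff γ n u x (root x) = 0) :
    ∃ C h₀ : ℝ, 0 < h₀ ∧ ∀ x ∈ K, ∀ h : ℝ, 0 < h → h < h₀ → ∀ μ : ℝ, μ ≠ 0 → P x →
      |μ - root x| ≤ c * h ^ p →
        A.IsAccurate gaussianProfile μ x h n u (u x) (C * h ^ (2 * (n : ℝ) + p)) := by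
  obtain ⟨γ, -, hhankel, hexp⟩ := exists_errorExpansion isSmoothRBF_gaussian A hn
  -- Continuity on the compact set serves to bound the chosen roots uniformly in `x`.
  obtain ⟨M, hM⟩ := hK.exists_bound_of_continuousOn hcont
  obtain ⟨C, h₀, hh₀, h⟩ := order_of_near_root hΩ hu hK hKΩ (hexp Ω u K hΩ hu hK hKΩ) M hp0 hp2 c
  exact ⟨C, h₀, hh₀, fun x hx h' hh hlt μ hμ hP hnear =>
    (h x hx h' hh hlt μ (root x) hμ (hM x hx) (hroot γ hhankel x hx hP) hnear).2⟩

/-- The single Hankel relation reads `-2 γ 0 + 12 γ 1 = 0`, so the error coefficient is `γ 1 (6 u μ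
+ u'')`. -/
theorem errorCoeff_primitive_one {γ : ℕ → ℝ} {u : ℝ → ℝ} {x : ℝ} (hx : u x ≠ 0)
    (hγ : ∀ l < 1, ∑ k ∈ Finset.range (1 + 1), γ k * ((2 * (k + l + 1)).factorial *
      taylorCoeffZero gaussianProfile (k + l + 1)) = 0) :
    errorCoeff γ 1 u x (-(iteratedDeriv 2 u x) / (6 * u x)) = 0 := by
  have h0 := hγ 0 one_pos
  simp only [Finset.sum_range_succ, Finset.sum_range_zero, taylorCoeffZero_gaussianProfile] at h0
  norm_num [Nat.factorial] at h0
  simp only [errorCoeff, Finset.sum_range_succ, Finset.sum_range_zero, iteratedDeriv_zero, mul_zero,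
    Nat.sub_zero, Nat.sub_self, pow_one, pow_zero, mul_one, zero_add]
  have h1 : γ 0 = 6 * γ 1 := by linarith
  rw [h1]
  field_simp
  ring

/-- The single Hankel relation reads `γ 0 - 2 γ 1 = 0`, so the error coefficient is `γ 1 (2 u μ +
u'')`. -/
theorem errorCoeff_direct_one {γ : ℕ → ℝ} {u : ℝ → ℝ} {x : ℝ} (hx : u x ≠ 0)
    (hγ : ∀ l < 1, ∑ k ∈ Finset.range (1 + 1), γ k * ((2 * (k + l + 0)).factorial *
      taylorCoeffZero gaussianProfile (k + l + 0)) = 0) :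
    errorCoeff γ 1 u x (-(iteratedDeriv 2 u x) / (2 * u x)) = 0 := by
  have h0 := hγ 0 one_pos
  simp only [Finset.sum_range_succ, Finset.sum_range_zero, taylorCoeffZero_gaussianProfile] at h0
  norm_num [Nat.factorial] at h0
  simp only [errorCoeff, Finset.sum_range_succ, Finset.sum_range_zero, iteratedDeriv_zero, mul_zero,
    Nat.sub_zero, Nat.sub_self, pow_one, pow_zero, mul_one, zero_add]
  have h1 : γ 0 = 2 * γ 1 := by linarith
  rw [h1]
  field_simp
  ring

/-- The two Hankel relations give `γ 0 : γ 1 : γ 2 = 60 : 20 : 1`, and the values are the roots of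
`60 u μ² + 20 u'' μ + u⁽⁴⁾`. -/
theorem errorCoeff_primitive_two {γ : ℕ → ℝ} {u : ℝ → ℝ} {x σ : ℝ} (hx : u x ≠ 0)
    (hσ : σ = 1 ∨ σ = -1)
    (hdisc : 0 ≤ (1 / 9) * iteratedDeriv 2 u x ^ 2 - (1 / 15) * u x * iteratedDeriv 4 u x)
    (hγ : ∀ l < 2, ∑ k ∈ Finset.range (2 + 1), γ k * ((2 * (k + l + 1)).factorial *
      taylorCoeffZero gaussianProfile (k + l + 1)) = 0) :
    errorCoeff γ 2 u x ((-(1 / 3) * iteratedDeriv 2 u x +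
      σ * Real.sqrt ((1 / 9) * iteratedDeriv 2 u x ^ 2 - (1 / 15) * u x * iteratedDeriv 4 u x)) /
        (2 * u x)) = 0 := by
  have h0 := hγ 0 two_pos
  have h1 := hγ 1 one_lt_two
  simp only [Finset.sum_range_succ, Finset.sum_range_zero, taylorCoeffZero_gaussianProfile] at h0 h1
  norm_num [Nat.factorial] at h0 h1
  have hγ1 : γ 1 = 20 * γ 2 := by linarith
  have hγ0 : γ 0 = 60 * γ 2 := by linarith
  simp only [errorCoeff, Finset.sum_range_succ, Finset.sum_range_zero, iteratedDeriv_zero, mul_zero,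
    mul_one, Nat.sub_zero, Nat.sub_self, pow_zero, zero_add, hγ0, hγ1,
    show 2 * 2 = 4 from rfl, show 2 - 1 = 1 from rfl, pow_one]
  have hsq := Real.sq_sqrt hdisc
  set s := Real.sqrt ((1 / 9) * iteratedDeriv 2 u x ^ 2 - (1 / 15) * u x * iteratedDeriv 4 u x)
  have hσ2 : σ ^ 2 = 1 := by rcases hσ with rfl | rfl <;> norm_num
  set w := (-(1 / 3) * iteratedDeriv 2 u x + σ * s) / (2 * u x) with hw
  have hw' : 2 * u x * w = -(1 / 3) * iteratedDeriv 2 u x + σ * s := by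
    rw [hw]
    field_simp
  have hfac : u x * (60 * γ 2 * u x * w ^ 2 + 20 * γ 2 * iteratedDeriv 2 u x * w +
      γ 2 * iteratedDeriv 4 u x) = 0 := by
    have h2 : (2 * u x * w + (1 / 3) * iteratedDeriv 2 u x) ^ 2 =
        (1 / 9) * iteratedDeriv 2 u x ^ 2 - (1 / 15) * u x * iteratedDeriv 4 u x := by
      rw [hw', ← hsq, ← one_mul (s ^ 2), ← hσ2]
      ring
    linear_combination 15 * γ 2 * h2
  exact (mul_eq_zero.1 hfac).resolve_left hx

theorem theorem3p1 :
    -- The Gaussian and every smooth positive definite radial function are smooth RBFs.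
    IsSmoothRBF gaussianProfile ∧
    (∀ Φ : ℝ → ℝ, ContDiffAt ℝ ∞ Φ 0 → ContDiff ℝ ∞ (radial Φ 1) →
      IsPositiveDefinite (radial Φ 1) → IsSmoothRBF Φ) ∧
    -- Gaussian: coefficients exist for all data, all mesh sizes and all nonzero shape parameters.
    (∀ (A : Reconstruction) (n : ℕ), 1 ≤ n → ∀ μ x h : ℝ, μ ≠ 0 → 0 < h →
      ∀ ubar : Fin (2 * n) → ℝ, ∃! α, A.IsSolution gaussianProfile μ x h n ubar α) ∧
    -- All smooth RBFs, all even `N = 2 * n`, both reconstructions.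
    (∀ Φ : ℝ → ℝ, IsSmoothRBF Φ → ∀ (A : Reconstruction) (n : ℕ), 1 ≤ n →
      ∃ γ : ℕ → ℝ, γ n ≠ 0 ∧
        ∀ (Ω : Set ℝ) (u : ℝ → ℝ) (K : Set ℝ), IsOpen Ω → ContDiffOn ℝ ∞ u Ω →
          IsCompact K → K ⊆ Ω → ∀ M : ℝ,
          -- the error is `h ^ N` times the leading error coefficient, up to `O(h ^ (N + 2))`
          (∃ C h₀ : ℝ, 0 < h₀ ∧ ∀ x ∈ K, ∀ h : ℝ, 0 < h → h < h₀ →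
            ∀ μ : ℝ, μ ≠ 0 → |μ| ≤ M →
              Set.Icc (x - n * h) (x + n * h) ⊆ Ω ∧
              A.IsAccurate Φ μ x h n u
                (u x + h ^ (2 * n) * errorCoeff γ n u x μ) (C * h ^ (2 * n + 2))) ∧
          -- tuned shape parameter: order `N + p`
          (∀ p : ℝ, 0 ≤ p → p ≤ 2 → ∀ c : ℝ, ∃ C h₀ : ℝ, 0 < h₀ ∧
            ∀ x ∈ K, ∀ h : ℝ, 0 < h → h < h₀ →
            ∀ μ μ₀ : ℝ, μ ≠ 0 → |μ₀| ≤ M → errorCoeff γ n u x μ₀ = 0 → |μ - μ₀| ≤ c * h ^ p →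
              Set.Icc (x - n * h) (x + n * h) ⊆ Ω ∧
              A.IsAccurate Φ μ x h n u (u x) (C * h ^ (2 * (n : ℝ) + p)))) ∧
    -- The explicit Gaussian cases.
    (∀ (Ω : Set ℝ) (u : ℝ → ℝ) (K : Set ℝ), IsOpen Ω → ContDiffOn ℝ ∞ u Ω →
      IsCompact K → K ⊆ Ω → (∀ x ∈ K, u x ≠ 0) → ∀ p : ℝ, 0 ≤ p → p ≤ 2 → ∀ c : ℝ,
      -- `N = 2`, primitive function
      (∃ C h₀ : ℝ, 0 < h₀ ∧ ∀ x ∈ K, ∀ h : ℝ, 0 < h → h < h₀ → ∀ μ : ℝ, μ ≠ 0 →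
        |μ - (-(iteratedDeriv 2 u x) / (6 * u x))| ≤ c * h ^ p →
          Reconstruction.primitive.IsAccurate gaussianProfile μ x h 1 u (u x)
            (C * h ^ (2 + p))) ∧
      -- `N = 2`, direct
      (∃ C h₀ : ℝ, 0 < h₀ ∧ ∀ x ∈ K, ∀ h : ℝ, 0 < h → h < h₀ → ∀ μ : ℝ, μ ≠ 0 →
        |μ - (-(iteratedDeriv 2 u x) / (2 * u x))| ≤ c * h ^ p →
          Reconstruction.direct.IsAccurate gaussianProfile μ x h 1 u (u x)
            (C * h ^ (2 + p))) ∧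
      -- `N = 4`, primitive function, either sign of the square root
      (∀ σ : ℝ, σ = 1 ∨ σ = -1 →
        ∃ C h₀ : ℝ, 0 < h₀ ∧ ∀ x ∈ K, ∀ h : ℝ, 0 < h → h < h₀ → ∀ μ : ℝ, μ ≠ 0 →
          0 ≤ (1 / 9) * iteratedDeriv 2 u x ^ 2 - (1 / 15) * u x * iteratedDeriv 4 u x →
          |μ - (-(1 / 3) * iteratedDeriv 2 u x + σ * Real.sqrt ((1 / 9) * iteratedDeriv 2 u x ^ 2
              - (1 / 15) * u x * iteratedDeriv 4 u x)) / (2 * u x)| ≤ c * h ^ p →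
            Reconstruction.primitive.IsAccurate gaussianProfile μ x h 2 u (u x)
              (C * h ^ (4 + p)))) := by
  refine ⟨isSmoothRBF_gaussian, fun Φ hΦ hs hφ => hφ.isSmoothRBF hΦ hs,
    fun A n _ μ x h hμ hh ubar => existsUnique_isSolution_gaussian A n hμ hh.ne' ubar,
    fun Φ hΦ A n hn => ?_, fun Ω u K hΩ hu hK hKΩ hu0 p hp0 hp2 c => ?_⟩
  · obtain ⟨γ, hγ, -, hexp⟩ := exists_errorExpansion hΦ A hn
    exact ⟨γ, hγ, fun Ω u K hΩ hu hK hKΩ M => ⟨hexp Ω u K hΩ hu hK hKΩ M,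
      fun p hp0 hp2 c => order_of_near_root hΩ hu hK hKΩ (hexp Ω u K hΩ hu hK hKΩ) M hp0 hp2 c⟩⟩
  · have hder : ∀ i, ContinuousOn (iteratedDeriv i u) K := fun i =>
      ((contDiffOn_infty.1 hu i).continuousOn_iteratedDeriv_of_isOpen hΩ le_rfl).mono hKΩ
    have huc : ContinuousOn u K := hu.continuousOn.mono hKΩ
    have hden : ∀ a : ℝ, a ≠ 0 → ∀ x ∈ K, a * u x ≠ 0 := fun a ha x hx => mul_ne_zero ha (hu0 x hx)
    refine ⟨?_, ?_, fun σ hσ => ?_⟩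
    · obtain ⟨C, h₀, hh₀, h⟩ := gaussian_order_of_near_root .primitive le_rfl hΩ hu hK hKΩ hp0 hp2 c
        (root := fun x => -(iteratedDeriv 2 u x) / (6 * u x)) (P := fun _ => True)
        ((hder 2).neg.div (huc.const_mul 6) (hden 6 (by norm_num)))
        (fun γ hγ x hx _ => errorCoeff_primitive_one (hu0 x hx) hγ)
      refine ⟨C, h₀, hh₀, fun x hx h' hh hlt μ hμ hnear => ?_⟩
      simpa using h x hx h' hh hlt μ hμ trivial hnear
    · obtain ⟨C, h₀, hh₀, h⟩ := gaussian_order_of_near_root .direct le_rfl hΩ hu hK hKΩ hp0 hp2 c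
        (root := fun x => -(iteratedDeriv 2 u x) / (2 * u x)) (P := fun _ => True)
        ((hder 2).neg.div (huc.const_mul 2) (hden 2 (by norm_num)))
        (fun γ hγ x hx _ => errorCoeff_direct_one (hu0 x hx) hγ)
      refine ⟨C, h₀, hh₀, fun x hx h' hh hlt μ hμ hnear => ?_⟩
      simpa using h x hx h' hh hlt μ hμ trivial hnear
    · obtain ⟨C, h₀, hh₀, h⟩ := gaussian_order_of_near_root .primitive one_le_two hΩ hu hK hKΩ hp0
        hp2 c (root := fun x => (-(1 / 3) * iteratedDeriv 2 u x + σ * Real.sqrt ((1 / 9) *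
          iteratedDeriv 2 u x ^ 2 - (1 / 15) * u x * iteratedDeriv 4 u x)) / (2 * u x))
        (P := fun x => 0 ≤ (1 / 9) * iteratedDeriv 2 u x ^ 2 -
          (1 / 15) * u x * iteratedDeriv 4 u x)
        -- Since `Real.sqrt` is continuous on all of `ℝ`, the root formula is continuous on all of
        -- `K`, including points where the discriminant is negative; its sign matters only for being
        -- a root.
        (by
          have h2 := hder 2
          have h4 := hder 4
          refine ContinuousOn.div ?_ (huc.const_mul 2) (hden 2 (by norm_num))
          fun_prop)
        (fun γ hγ x hx hP => errorCoeff_primitive_two (hu0 x hx) hσ hP hγ)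
      refine ⟨C, h₀, hh₀, fun x hx h' hh hlt μ hμ hP hnear => ?_⟩
      have := h x hx h' hh hlt μ hμ hP hnear
      rwa [show 2 * ((2 : ℕ) : ℝ) + p = 4 + p by norm_num] at this
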